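/- Let $n\ge 2$ and $T>0$, and let $v_0\in L^2(\mathbb R^n;\mathbb R^n)$ be weakly divergence-free. Write $C([0,T];L^2_w)$ for the space of curves $v:[0,T]\to L^2(\mathbb R^n;\mathbb R^n)$ such that $t\mapsto\int v(x,t)\cdot f(x)\,dx$ is continuous for every $f\in L^2(\mathbb R^n;\mathbb R^n)$. Let $v\in C([0,T];L^2_w)$ be a weak solution of the incompressible Euler equations with initial datum $v_0$, that is, $v(\cdot,t)$ is weakly divergence-free for a.e. $t\in(0,T)$ and $$\int_0^T\!\!\int_{\mathbb R^n}\bigl[v\cdot\partial_t\varphi+\langle v\otimes v,\nabla\varphi\rangle\bigr]dx\,dt+\int_{\mathbb R^n}v_0(x)\cdot\varphi(x,0)\,dx=0$$ for every $\varphi\in C_c^\infty(\mathbb R^n\times[0,T);\mathbb R^n)$ with $\operatorname{div}\varphi=0$. Suppose that $v$ satisfies the weak energy inequality $$\int_{\mathbb R^n}|v(x,t)|^2dx\le\int_{\mathbb R^n}|v_0(x)|^2dx\qquad\text{for every }t\in(0,T].$$ Then $v$ is a dissipative solution in the sense of Lions with initial datum $v_0$, that is: $v\in L^\infty([0,T];L^2(\mathbb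 R^n))\cap C([0,T];L^2_w)$; $v(\cdot,0)=v_0$; $\operatorname{div}v=0$ in the sense of distributions on $\mathbb R^n\times(0,T)$; and for every $w\in C([0,T];L^2(\mathbb R^n;\mathbb R^n))$ with $\operatorname{div}w=0$ in the sense of distributions, $d(w)\in L^1(0,T;L^\infty(\mathbb R^n))$ and $E(w)\in L^1(0,T;L^2(\mathbb R^n))$, and every $t\in[0,T]$, $$\begin{aligned}\|v(\cdot,t)-w(\cdot,t)\|_{L^2_x}^2\le{}&e^{\int_0^t2\|d^-(w)\|_{L^\infty_x}d\tau}\,\|v_0-w(\cdot,0)\|_{L^2_x}^2\\&+2\int_0^t\!\!\int_{\mathbb R^n}e^{\int_s^t2\|d^-(w)\|_{L^\infty_x}d\tau}\,E(w)(x,s)\cdot\bigl(v(x,s)-w(x,s)\bigr)\,dx\,ds .\end{aligned}$$ Here $d(w)=\frac12(\nabla w+\nabla w^{t})$ and $E(w)=-\partial_tw-P(\operatorname{div}(w\otimes w))$ are taken in the sense of distributions on $\mathbb R^n\times(0,T)$, $P$ is the Helmholtz projection onto divergence-free fields (the Fourier multiplier $\mathrm{Id}-\xi\otimes\xi/|\xi|^2$),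 and $d^-(w)=(-\lambda_{\min}(d(w)))^+$ is the negative part of the smallest eigenvalue of $d(w)$. -/

import Mathlib

open MeasureTheory Set
open scoped ContDiff FourierTransform

noncomputable section

namespace Euler

/-- The space `ℝⁿ` with its Euclidean norm. -/
abbrev Space (n : ℕ) := EuclideanSpace ℝ (Fin n)

/-- The Hilbert space `L²(ℝⁿ; ℝⁿ)`. Time-dependent fields are curves `v : ℝ → L2Field n`, of which
only the values at times in `[0,T]` matter. -/
abbrev L2Field (n : ℕ) := Lp (Space n) 2 (volume : Measure (Space n))

/-- `∂_i f (x)`. -/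
def partialD {n : ℕ} {F : Type*} [NormedAddCommGroup F] [NormedSpace ℝ F]
    (i : Fin n) (f : Space n → F) (x : Space n) : F :=
  fderiv ℝ f x (EuclideanSpace.single i 1)

/-- The divergence `∑ i, ∂_i f_i (x)` of a smooth field. -/
def divergence {n : ℕ} (f : Space n → Space n) (x : Space n) : ℝ :=
  ∑ i, partialD i f x i

/-- Smooth functions of `(t,x)` with compact support contained in `U`. -/
structure IsTest {n : ℕ} {F : Type*} [NormedAddCommGroup F] [NormedSpace ℝ F]
    (U : Set (ℝ × Space n)) (φ : ℝ × Space n → F) : Prop where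
  smooth : ContDiff ℝ ∞ φ
  compact : HasCompactSupport φ
  supp : tsupport φ ⊆ U

/-- The open slab `]0,T[ × ℝⁿ`. -/
def slab (n : ℕ) (T : ℝ) : Set (ℝ × Space n) := Ioo 0 T ×ˢ univ

/-- The half space `]-∞,T[ × ℝⁿ`. The restrictions to `t ≥ 0` of the test functions supported in it
are the test functions of class `C_c^∞(ℝⁿ × [0,T[)`. -/
def beforeT (n : ℕ) (T : ℝ) : Set (ℝ × Space n) := Iio T ×ˢ univ

/-- `u ∈ L²` is weakly divergence-free: `∫ u · ∇ψ = 0` for all `ψ ∈ C_c^∞(ℝⁿ)`. -/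
def WeaklyDivFree {n : ℕ} (u : L2Field n) : Prop :=
  ∀ ψ : Space n → ℝ, ContDiff ℝ ∞ ψ → HasCompactSupport ψ →
    ∫ x, ∑ i, u x i * partialD i ψ x = 0

/-- `div v = 0` in the sense of distributions on `]0,T[ × ℝⁿ`. -/
def DistribDivFree {n : ℕ} (T : ℝ) (v : ℝ → L2Field n) : Prop :=
  ∀ ψ : ℝ × Space n → ℝ, IsTest (slab n T) ψ →
    ∫ t in Ioo 0 T, ∫ x, ∑ i, v t x i * partialD i (fun y => ψ (t, y)) x = 0

/-- `v ∈ C([0,T]; L²_w)`: `t ↦ ∫ v(x,t) · f(x) dx` is continuous on `[0,T]` for each `f ∈ L²`. -/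
def WeaklyContinuous {n : ℕ} (T : ℝ) (v : ℝ → L2Field n) : Prop :=
  ∀ f : L2Field n, ContinuousOn (fun t => inner ℝ (v t) f) (Icc 0 T)

/-- `v` is a weak solution on `[0,T]` of the incompressible Euler equations with initial datum `v₀`.
Here `inner ℝ u (fderiv ℝ φ x u) = ∑ i j, u_i u_j ∂_i φ_j = ⟨u ⊗ u, ∇φ⟩`. -/
structure IsWeakSolution {n : ℕ} (T : ℝ) (v₀ : L2Field n) (v : ℝ → L2Field n) : Prop where
  divFree : ∀ᵐ t ∂(volume.restrict (Ioo 0 T)), WeaklyDivFree (v t)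
  momentum : ∀ φ : ℝ × Space n → Space n, IsTest (beforeT n T) φ →
    (∀ t ∈ Ico 0 T, ∀ x, divergence (fun y => φ (t, y)) x = 0) →
    (∫ t in Ioo 0 T, ∫ x, (inner ℝ (v t x) (deriv (fun s => φ (s, x)) t)
        + inner ℝ (v t x) (fderiv ℝ (fun y => φ (t, y)) x (v t x))))
      + ∫ x, inner ℝ (v₀ x) (φ (0, x)) = 0

/-- The weak energy inequality `∫ |v(x,t)|² dx ≤ ∫ |v₀(x)|² dx` for every time `t > 0`. -/
def WeakEnergyInequality {n : ℕ} (T : ℝ) (v₀ : L2Field n) (v : ℝ → L2Field n) : Prop :=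
  ∀ t ∈ Ioc 0 T, ∫ x, ‖v t x‖ ^ 2 ≤ ∫ x, ‖v₀ x‖ ^ 2

/-- The `j`-th component of the Helmholtz projection, in frequency:
`φ̂_j - ξ_j (ξ · φ̂) / |ξ|²`. -/
def helmholtzSymbol {n : ℕ} (φ : Space n → Space n) (j : Fin n) (ξ : Space n) : ℂ :=
  𝓕 (fun x => (φ x j : ℂ)) ξ
    - (ξ j : ℂ) * (∑ k, (ξ k : ℂ) * 𝓕 (fun x => (φ x k : ℂ)) ξ) / ((‖ξ‖ ^ 2 : ℝ) : ℂ)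

/-- The Helmholtz projection `Pφ` of a test field `φ` onto divergence-free fields, that is,
`Pφ = φ - ∇ Δ⁻¹ div φ`, as a Fourier multiplier. (The inverse transform is real-valued because the
multiplier is real and even.) -/
def helmholtz {n : ℕ} (φ : Space n → Space n) (x : Space n) : Space n :=
  WithLp.toLp 2 fun j => (𝓕⁻ (helmholtzSymbol φ j) x).re

/-- `e = E(w) := -∂_t w - P (div (w ⊗ w))` in the sense of distributions on `]0,T[ × ℝⁿ`. The
projection `P`, being symmetric, acts on a distribution through the test field:
`⟨P (div (w ⊗ w)), φ⟩ = -∫ ⟨w ⊗ w, ∇(Pφ)⟩`. -/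
def IsDefect {n : ℕ} (T : ℝ) (w e : ℝ → L2Field n) : Prop :=
  ∀ φ : ℝ × Space n → Space n, IsTest (slab n T) φ →
    ∫ t in Ioo 0 T, ∫ x, inner ℝ (e t x) (φ (t, x))
      = ∫ t in Ioo 0 T, ∫ x, (inner ℝ (w t x) (deriv (fun s => φ (s, x)) t)
          + inner ℝ (w t x) (fderiv ℝ (helmholtz fun y => φ (t, y)) x (w t x)))

/-- `D = d(w) = (∇w + ∇wᵗ) / 2` in the sense of distributions on `]0,T[ × ℝⁿ`. -/
def IsSymGrad {n : ℕ} (T : ℝ) (w : ℝ → L2Field n)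
    (D : ℝ × Space n → Matrix (Fin n) (Fin n) ℝ) : Prop :=
  ∀ i j, ∀ ψ : ℝ × Space n → ℝ, IsTest (slab n T) ψ →
    ∫ t in Ioo 0 T, ∫ x, D (t, x) i j * ψ (t, x)
      = -(1 / 2) * ∫ t in Ioo 0 T, ∫ x, (w t x j * partialD i (fun y => ψ (t, y)) x
          + w t x i * partialD j (fun y => ψ (t, y)) x)

/-- `D ∈ L¹_t(L^∞_x)` on `]0,T[ × ℝⁿ`. -/
structure MemL1Linfty {n : ℕ} (T : ℝ) (D : ℝ × Space n → Matrix (Fin n) (Fin n) ℝ) : Prop where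
  aemeas : ∀ i j, AEStronglyMeasurable (fun z => D z i j)
    ((volume.restrict (Ioo 0 T)).prod (volume : Measure (Space n)))
  finite : ∀ i j, ∫⁻ t in Ioo 0 T, eLpNorm (fun x => D (t, x) i j) ⊤ volume < ⊤

/-- The negative part `(-λ_min(M))⁺` of the smallest eigenvalue of a symmetric matrix `M`. -/
def negPartMinEigenvalue {n : ℕ} (M : Matrix (Fin n) (Fin n) ℝ) : ℝ :=
  max (-sInf (spectrum ℝ M)) 0

/-- `‖d⁻(w)(·,t)‖_{L^∞_x}`, where `D = d(w)`. -/
def dMinusNorm {n : ℕ} (D : ℝ × Space n → Matrix (Fin n) (Fin n) ℝ) (t : ℝ) : ℝ :=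
  (eLpNorm (fun x => negPartMinEigenvalue (D (t, x))) ⊤ volume).toReal

/-- Dissipative solutions of the Euler equations on `[0,T]` with initial datum `v₀`, in the sense
of Lions. -/
structure IsDissipativeSolution {n : ℕ} (T : ℝ) (v₀ : L2Field n) (v : ℝ → L2Field n) :
    Prop where
  bounded : MemLp v ⊤ (volume.restrict (Icc 0 T))
  weaklyContinuous : WeaklyContinuous T v
  initial : v 0 = v₀
  divFree : DistribDivFree T v
  stability : ∀ (w e : ℝ → L2Field n) (D : ℝ × Space n → Matrix (Fin n) (Fin n) ℝ),
    ContinuousOn w (Icc 0 T) →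
    IsSymGrad T w D → MemL1Linfty T D →
    IsDefect T w e → IntegrableOn e (Ioo 0 T) →
    DistribDivFree T w →
    ∀ t ∈ Icc 0 T,
      ∫ x, ‖v t x - w t x‖ ^ 2
        ≤ Real.exp (∫ τ in 0..t, 2 * dMinusNorm D τ) * (∫ x, ‖v₀ x - w 0 x‖ ^ 2)
          + 2 * (∫ s in 0..t, ∫ x, Real.exp (∫ τ in s..t, 2 * dMinusNorm D τ)
              * inner ℝ (e s x) (v s x - w s x))

end Euler

end

/-! This is a relative energy argument. Write `M` for `d(w)` and `e` for `E(w)`. Formally `‖v - w‖²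
= ‖v‖² + ‖w‖² - 2⟪v, w⟫`. The first term is controlled by the energy inequality, and the other two
by the equations.

For divergence-free `w`, `div (w ⊗ w) = 2 M w - ∇|w|²/2`. Hence `∂ₜw` is the solenoidal part of `-(e
+ 2 M w)`, which lies in `L¹(0,T; L²)`, and `w` is an absolutely continuous curve in `L²`
(`SymGradField.eq_add_integral`). Since `∫ ⟨w, M w⟩ = 0`, its energy satisfies `‖w(t)‖² = ‖w(0)‖² -
2 ∫ ⟪e, w⟫` (`SymGradField.norm_sq_eq`).

The cross term comes from testing the equation of `v` with `w`. As `w` is not smooth, it is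
mollified in space. The flux `⟨v ⊗ v, ∇(η ⋆ w)⟩` only sees the symmetric part `η ⋆ M`, which is
bounded by the `L^∞` bound of `M` uniformly in the kernel. Dominated convergence then gives
(`SymGradField.inner_eq`) `⟪v, w⟫(t) = ⟪v, w⟫(0) + ∫ (⟪v, M v⟫ - ⟪e, v⟫ - 2 ⟪v, M w⟫)`.

In the combination, `⟪v, M v⟫ - 2⟪v, M w⟫` equals `⟪v - w, M (v - w)⟫`, because `M` is symmetric and
`⟪w, M w⟫ = 0`. This is at least `-‖d⁻(w)‖_∞ ‖v - w‖²`, and Gronwall's inequality finishes the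
proof.

Three technical points support this. The equations are only tested with smooth compactly supported
solenoidal fields, so these must be dense among the weakly divergence-free `L²` fields
(`mem_solSpace_iff`). On such fields the Helmholtz projection is the identity
(`SolTest.helmholtz_eq`), so no other property of `P` is needed. Finally `D` is only given almost
everywhere, so it is replaced by a jointly measurable representative, symmetric and bounded at every
point (`exists_symGradField`). -/

noncomputable section

namespace Euler

open Filter Topology

/-! ### Measurability, the fundamental theorem and Gronwall's inequality -/

/-- A weakly measurable map into a separable Hilbert space is strongly measurable. -/
theorem aestronglyMeasurable_of_inner {α E : Type*} [MeasurableSpace α] {μ : Measure α}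
    [NormedAddCommGroup E] [InnerProductSpace ℝ E] [CompleteSpace E] [SecondCountableTopology E]
    {u : α → E} (h : ∀ f : E, AEMeasurable (fun t => inner ℝ (u t) f) μ) :
    AEStronglyMeasurable u μ := by
  borelize E
  obtain ⟨d, hd⟩ := TopologicalSpace.exists_dense_seq E
  let J : E → (ℕ → ℝ) := fun x k => inner ℝ x (d k)
  have hJ : Continuous J := by fun_prop
  have hinj : Function.Injective J := by
    intro x y hxy
    refine ext_inner_right ℝ fun z => ?_
    have : (fun z => inner ℝ x z) = fun z => inner ℝ y z :=
      hd.equalizer (by fun_prop) (by fun_prop) (funext fun k => congrFun hxy k)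
    exact congrFun this z
  -- Lusin–Souslin: a continuous injection between Polish spaces is a measurable embedding, so
  -- measurability may be checked on the countably many coordinates.
  have he : MeasurableEmbedding J := hJ.measurableEmbedding hinj
  refine AEMeasurable.aestronglyMeasurable ?_
  rw [← he.aemeasurable_comp_iff]
  exact aemeasurable_pi_lambda _ fun k => h (d k)

/-- The product rule for two absolutely continuous curves in a Hilbert space. -/
theorem inner_add_integral_add_integral {E : Type*} [NormedAddCommGroup E] [InnerProductSpace ℝ E]
    [CompleteSpace E] {A B : ℝ → E} {t : ℝ} (ht : 0 ≤ t) (a b : E)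
    (hA : IntegrableOn A (Ioc 0 t)) (hB : IntegrableOn B (Ioc 0 t)) :
    inner ℝ (a + ∫ s in 0..t, A s) (b + ∫ s in 0..t, B s) = inner ℝ a b
      + ((∫ s in 0..t, inner ℝ (A s) (b + ∫ r in 0..s, B r))
        + ∫ s in 0..t, inner ℝ (a + ∫ r in 0..s, A r) (B s)) := by
  set μ := (volume : Measure ℝ).restrict (Ioc 0 t) with hμ
  -- Fubini on the square: the double integral of `⟪A s, B r⟫` splits into the triangles `r ≤ s` and
  -- `s ≤ r`, which overlap only on the null diagonal. Each triangle is one of the two terms of the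
  -- product rule.
  have hF : Integrable (fun z : ℝ × ℝ => inner ℝ (A z.1) (B z.2)) (μ.prod μ) :=
    Integrable.op_fst_snd (op := fun x y => inner ℝ x y) (by fun_prop)
      ⟨1, fun x y => by rw [one_mul]; exact norm_inner_le_norm x y⟩ hA hB
  have hms : MeasurableSet {z : ℝ × ℝ | z.2 ≤ z.1} := measurableSet_le measurable_snd measurable_fst
  have hms' : MeasurableSet {z : ℝ × ℝ | z.1 ≤ z.2} := measurableSet_le measurable_fst measurable_snd
  have hF1 := hF.indicator hms
  have hF2 := hF.indicator hms'
  have hres : ∀ s ∈ Ioc 0 t, ∀ k : ℝ → E, ∫ r in 0..s, k r = ∫ r, (Iic s).indicator k r ∂μ := by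
    intro s hs k
    rw [intervalIntegral.integral_of_le hs.1.le, integral_indicator measurableSet_Iic,
      hμ, Measure.restrict_restrict measurableSet_Iic]
    congr 2
    ext r; simp only [mem_Ioc, mem_inter_iff, mem_Iic]
    constructor
    · rintro ⟨h1, h2⟩; exact ⟨h2, h1, h2.trans hs.2⟩
    · rintro ⟨h1, h2, h3⟩; exact ⟨h2, h1⟩
  have e1 : ∀ s ∈ Ioc 0 t, inner ℝ (A s) (∫ r in 0..s, B r)
      = ∫ r, {z : ℝ × ℝ | z.2 ≤ z.1}.indicator (fun z => inner ℝ (A z.1) (B z.2)) (s, r) ∂μ := by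
    intro s hs
    rw [hres s hs, ← integral_inner (hB.indicator measurableSet_Iic)]
    refine integral_congr_ae (Eventually.of_forall fun r => ?_)
    by_cases h : r ≤ s <;> simp [indicator, h]
  have e2 : ∀ s ∈ Ioc 0 t, inner ℝ (∫ r in 0..s, A r) (B s)
      = ∫ r, {z : ℝ × ℝ | z.1 ≤ z.2}.indicator (fun z => inner ℝ (A z.1) (B z.2)) (r, s) ∂μ := by
    intro s hs
    rw [hres s hs, real_inner_comm, ← integral_inner (hA.indicator measurableSet_Iic)]
    refine integral_congr_ae (Eventually.of_forall fun r => ?_)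
    by_cases h : r ≤ s <;> simp [indicator, h, real_inner_comm]
  have i1 : Integrable (fun s => inner ℝ (A s) (∫ r in 0..s, B r)) μ :=
    hF1.integral_prod_left.congr ((ae_restrict_iff' measurableSet_Ioc).2
      (Eventually.of_forall fun s hs => (e1 s hs).symm))
  have i2 : Integrable (fun s => inner ℝ (∫ r in 0..s, A r) (B s)) μ :=
    hF2.integral_prod_right.congr ((ae_restrict_iff' measurableSet_Ioc).2
      (Eventually.of_forall fun s hs => (e2 s hs).symm))
  have hsum : (∫ s, inner ℝ (A s) (∫ r in 0..s, B r) ∂μ) + ∫ s, inner ℝ (∫ r in 0..s, A r) (B s) ∂μ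
      = inner ℝ (∫ s, A s ∂μ) (∫ s, B s ∂μ) := by
    rw [setIntegral_congr_fun measurableSet_Ioc e1, setIntegral_congr_fun measurableSet_Ioc e2]
    rw [integral_integral_swap (f := fun s r =>
      {z : ℝ × ℝ | z.1 ≤ z.2}.indicator (fun z => inner ℝ (A z.1) (B z.2)) (r, s)) hF2.swap]
    rw [← integral_add hF1.integral_prod_left hF2.integral_prod_left]
    have : ∀ᵐ s ∂μ, ((∫ r, {z : ℝ × ℝ | z.2 ≤ z.1}.indicator
        (fun z => inner ℝ (A z.1) (B z.2)) (s, r) ∂μ)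
        + ∫ r, {z : ℝ × ℝ | z.1 ≤ z.2}.indicator (fun z => inner ℝ (A z.1) (B z.2)) (s, r) ∂μ)
        = inner ℝ (A s) (∫ r, B r ∂μ) := by
      filter_upwards [hF1.prod_right_ae, hF2.prod_right_ae] with s h1 h2
      rw [← integral_add h1 h2, ← integral_inner hB]
      refine integral_congr_ae ?_
      have : ∀ᵐ r ∂μ, r ≠ s := ae_restrict_of_ae (Measure.ae_ne volume s)
      filter_upwards [this] with r hr
      rcases lt_or_gt_of_ne hr with h | h
      · simp [indicator, h.le, h.not_ge]
      · simp [indicator, h.le, h.not_ge]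
    rw [integral_congr_ae this]
    simp_rw [real_inner_comm (∫ r, B r ∂μ)]
    rw [integral_inner hA]
  simp only [intervalIntegral.integral_of_le ht] at *
  simp only [inner_add_left, inner_add_right]
  rw [← hμ, integral_add (hA.inner_const b) i1, integral_add (hB.const_inner a) i2]
  rw [integral_inner hB]
  have : ∫ s, inner ℝ (A s) b ∂μ = inner ℝ (∫ s, A s ∂μ) b := by
    simp_rw [real_inner_comm b]; rw [integral_inner hA]
  rw [this, ← hsum]
  ring

theorem exists_Icc_of_isCompact_subset_Ioo {T : ℝ} (hT : 0 < T) {K : Set ℝ} (hK : IsCompact K)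
    (hKT : K ⊆ Ioo 0 T) : ∃ α β, 0 < α ∧ β < T ∧ K ⊆ Icc α β := by
  rcases K.eq_empty_or_nonempty with rfl | hne
  · exact ⟨T, 0, hT, hT, by simp⟩
  · obtain ⟨α, hα⟩ := hK.exists_isLeast hne
    obtain ⟨β, hβ⟩ := hK.exists_isGreatest hne
    exact ⟨α, β, (hKT hα.1).1, (hKT hβ.1).2, fun x hx => ⟨hα.2 hx, hβ.2 hx⟩⟩

theorem contDiff_primitive {σ : ℝ → ℝ} (hσ : ContDiff ℝ ∞ σ) (a : ℝ) :
    ContDiff ℝ ∞ (fun t => ∫ s in a..t, σ s) := by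
  have hd : ∀ t, HasDerivAt (fun t => ∫ s in a..t, σ s) (σ t) t := fun t =>
    hσ.continuous.integral_hasStrictDerivAt a t |>.hasDerivAt
  rw [contDiff_infty_iff_deriv]
  refine ⟨fun t => (hd t).differentiableAt, ?_⟩
  rwa [show deriv (fun t => ∫ s in a..t, σ s) = σ from funext fun t => (hd t).deriv]

theorem deriv_primitive {σ : ℝ → ℝ} (hσ : Continuous σ) (a t : ℝ) :
    deriv (fun t => ∫ s in a..t, σ s) t = σ t :=
  (hσ.integral_hasStrictDerivAt a t).hasDerivAt.deriv

/-- Integration by parts of a smooth function against a primitive. -/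
theorem integral_mul_eq_sub_integral_deriv_mul_primitive {T : ℝ} (hT : 0 < T) {θ c : ℝ → ℝ}
    (hθ : ContDiff ℝ ∞ θ) (hc : IntegrableOn c (Ioo 0 T)) :
    ∫ t in Ioo 0 T, θ t * c t = θ T * (∫ s in 0..T, c s)
      - ∫ t in Ioo 0 T, deriv θ t * ∫ s in 0..t, c s := by
  have hci : IntervalIntegrable c volume 0 T := by
    rwa [intervalIntegrable_iff_integrableOn_Ioo_of_le hT.le]
  have h1 : AbsolutelyContinuousOnInterval θ 0 T :=
    ((hθ.of_le (by simp)).contDiffOn (n := 1)).absolutelyContinuousOnInterval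
  have h2 : AbsolutelyContinuousOnInterval (fun x => ∫ s in 0..x, c s) 0 T :=
    hci.absolutelyContinuousOnInterval_intervalIntegral left_mem_uIcc
  have h3 := h1.integral_mul_deriv_eq_deriv_mul h2
  have h4 : ∫ x in 0..T, θ x * deriv (fun x => ∫ s in 0..x, c s) x = ∫ x in 0..T, θ x * c x := by
    refine intervalIntegral.integral_congr_ae ?_
    filter_upwards [hci.ae_hasDerivAt_integral] with x hx hxT
    rw [(hx (uIoc_subset_uIcc hxT) 0 left_mem_uIcc).deriv]
  rw [h4] at h3
  simp only [intervalIntegral.integral_same, mul_zero, sub_zero] at h3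
  simpa only [intervalIntegral.integral_of_le hT.le, integral_Ioc_eq_integral_Ioo] using h3

theorem eqOn_Icc_of_ae_Ioo {T : ℝ} (hT : 0 < T) {f g : ℝ → ℝ} (hf : ContinuousOn f (Icc 0 T))
    (hg : ContinuousOn g (Icc 0 T)) (h : ∀ᵐ t ∂(volume.restrict (Ioo 0 T)), f t = g t) :
    EqOn f g (Icc 0 T) := by
  refine Measure.eqOn_Icc_of_ae_eq volume hT.ne ?_ hf hg
  rw [restrict_Ioo_eq_restrict_Icc] at h
  exact h

/-- The lemma of du Bois-Reymond. -/
theorem eq_add_integral_of_forall_integral_deriv_mul {T : ℝ} (hT : 0 < T) {a c : ℝ → ℝ}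
    (ha : ContinuousOn a (Icc 0 T)) (hc : IntegrableOn c (Ioo 0 T))
    (h : ∀ θ : ℝ → ℝ, ContDiff ℝ ∞ θ → HasCompactSupport θ → tsupport θ ⊆ Ioo 0 T →
      ∫ t in Ioo 0 T, (deriv θ t * a t + θ t * c t) = 0) {t : ℝ} (ht : t ∈ Icc 0 T) :
    a t = a 0 + ∫ s in 0..t, c s := by
  have hci : IntervalIntegrable c volume 0 T := by
    rwa [intervalIntegrable_iff_integrableOn_Ioo_of_le hT.le]
  set F : ℝ → ℝ := fun t => a t - ∫ s in 0..t, c s with hF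
  have hCc : ContinuousOn (fun x => ∫ s in 0..x, c s) (Icc 0 T) := by
    have := intervalIntegral.continuousOn_primitive_interval' hci left_mem_uIcc
    rwa [uIcc_of_le hT.le] at this
  have hFc : ContinuousOn F (Icc 0 T) := ha.sub hCc
  have hint : ∀ {k u : ℝ → ℝ}, Continuous k → ContinuousOn u (Icc 0 T) →
      IntegrableOn (fun t => k t * u t) (Ioo 0 T) := fun hk hu =>
    ((hk.continuousOn.mul hu).integrableOn_Icc).mono_set Ioo_subset_Icc_self
  -- Integrating the `c`-term by parts reduces the claim to the case `c = 0`, for `F` in place of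
  -- `a`.
  have hz : ∀ θ : ℝ → ℝ, ContDiff ℝ ∞ θ → HasCompactSupport θ → tsupport θ ⊆ Ioo 0 T →
      ∫ t in Ioo 0 T, deriv θ t * F t = 0 := by
    intro θ h1 h2 h3
    have hθT : θ T = 0 := image_eq_zero_of_notMem_tsupport fun hh => lt_irrefl _ (h3 hh).2
    have hd : Continuous (deriv θ) := h1.continuous_deriv (by simp)
    have hθc : IntegrableOn (fun t => θ t * c t) (Ioo 0 T) := by
      have := hci.continuousOn_mul h1.continuous.continuousOn
      rwa [intervalIntegrable_iff_integrableOn_Ioo_of_le hT.le] at this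
    have := h θ h1 h2 h3
    rw [integral_add (hint hd ha) hθc,
      integral_mul_eq_sub_integral_deriv_mul_primitive hT h1 hc, hθT, zero_mul, zero_sub,
      ← sub_eq_add_neg, ← integral_sub (hint hd ha) (hint hd hCc)] at this
    simpa only [hF, mul_sub] using this
  have hball : Metric.closedBall (T / 2) (T / 3) ⊆ Ioo 0 T := by
    rw [Real.closedBall_eq_Icc]
    intro x hx
    exact ⟨by linarith [hx.1], by linarith [hx.2]⟩
  let bump : ContDiffBump (T / 2) := ⟨T / 4, T / 3, by linarith, by linarith⟩
  set ρ₀ := bump.normed volume with hρ₀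
  have hρ₀s : ContDiff ℝ ∞ ρ₀ := bump.contDiff_normed
  have hρ₀c : HasCompactSupport ρ₀ := bump.hasCompactSupport_normed
  have hρ₀t : tsupport ρ₀ ⊆ Ioo 0 T := by rw [hρ₀, bump.tsupport_normed_eq]; exact hball
  set c₀ := ∫ t in Ioo 0 T, ρ₀ t * F t with hc₀
  have hFae : ∀ᵐ t ∂(volume.restrict (Ioo 0 T)), F t = c₀ := by
    have key : ∀ᵐ t, t ∈ Ioo 0 T → F t - c₀ = 0 := by
      refine isOpen_Ioo.ae_eq_zero_of_integral_contDiff_smul_eq_zero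
        (((hFc.mono Ioo_subset_Icc_self).sub continuousOn_const).locallyIntegrableOn
          measurableSet_Ioo) ?_
      intro ρ hρ hρc hρt
      -- Subtracting `m ρ₀` makes the mean vanish, so the primitive of `σ` is again compactly
      -- supported in `(0,T)` and is an admissible test function. It yields `∫ ρ F = m c₀`.
      set m := ∫ s, ρ s with hm
      set σ : ℝ → ℝ := fun s => ρ s - m * ρ₀ s with hσ
      have hσs : ContDiff ℝ ∞ σ := hρ.sub (contDiff_const.mul hρ₀s)
      have hσts : tsupport σ ⊆ tsupport ρ ∪ tsupport ρ₀ := by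
        refine closure_minimal (fun x hx => ?_) ((isClosed_tsupport _).union (isClosed_tsupport _))
        by_contra hx'
        simp only [mem_union, not_or] at hx'
        exact hx (by simp [hσ, image_eq_zero_of_notMem_tsupport hx'.1,
          image_eq_zero_of_notMem_tsupport hx'.2])
      have hσc : HasCompactSupport σ :=
        (hρc.isCompact.union hρ₀c.isCompact).of_isClosed_subset (isClosed_tsupport _) hσts
      obtain ⟨α, β, hα, hβ, hαβ⟩ := exists_Icc_of_isCompact_subset_Ioo hT hσc.isCompact
        (hσts.trans (union_subset hρt hρ₀t))
      have hσ0 : ∫ s, σ s = 0 := by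
        rw [hσ, integral_sub (hρ.continuous.integrable_of_hasCompactSupport hρc)
          ((hρ₀s.continuous.integrable_of_hasCompactSupport hρ₀c).const_mul m),
          integral_const_mul, bump.integral_normed]
        simp [hm]
      have hsupp : ∀ s, s ∉ Icc α β → σ s = 0 := fun s hs =>
        image_eq_zero_of_notMem_tsupport fun h => hs (hαβ h)
      set θ : ℝ → ℝ := fun t => ∫ s in 0..t, σ s with hθ
      have hθt : tsupport θ ⊆ Icc α β := by
        refine closure_minimal (fun x hx => ?_) isClosed_Icc
        by_contra hx'
        refine hx ?_
        simp only [mem_Icc, not_and_or, not_le] at hx'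
        rcases hx' with h1 | h1
        · refine (intervalIntegral.integral_congr (g := fun _ => (0 : ℝ)) fun s hs => ?_).trans (by simp)
          refine hsupp s fun h2 => ?_
          have : s ≤ max 0 x := hs.2
          rcases le_max_iff.1 this with h3 | h3
          · linarith [h2.1]
          · linarith [h2.1]
        · rw [← hσ0]
          refine intervalIntegral.integral_eq_integral_of_support_subset fun s hs => ?_
          have : s ∈ Icc α β := by
            by_contra h2; exact hs (hsupp s h2)
          exact ⟨by linarith [this.1], by linarith [this.2]⟩
      have := hz θ (contDiff_primitive hσs 0)
        (isCompact_Icc.of_isClosed_subset (isClosed_tsupport _) hθt)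
        (hθt.trans fun x hx => ⟨by linarith [hx.1], by linarith [hx.2]⟩)
      simp only [hθ, deriv_primitive hσs.continuous] at this
      have hrest : ∀ k : ℝ → ℝ, ∫ x, ρ x * k x = ∫ x in Ioo 0 T, ρ x * k x := fun k =>
        (setIntegral_eq_integral_of_forall_compl_eq_zero fun x hx => by
          rw [image_eq_zero_of_notMem_tsupport fun h => hx (hρt h), zero_mul]).symm
      have hm' : m = ∫ x in Ioo 0 T, ρ x * 1 := by rw [← hrest]; simp [hm]
      simp only [smul_eq_mul]
      rw [hrest]
      simp only [mul_sub]
      rw [integral_sub (hint hρ.continuous hFc) (hint hρ.continuous continuousOn_const),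
        integral_mul_const]
      simp only [hσ, sub_mul, mul_assoc] at this
      rw [integral_sub (hint hρ.continuous hFc) ((hint hρ₀s.continuous hFc).const_mul m),
        integral_const_mul, ← hc₀, hm'] at this
      simpa using this
    exact (ae_restrict_iff' measurableSet_Ioo).2 (key.mono fun t h1 h2 => sub_eq_zero.1 (h1 h2))
  have hE := eqOn_Icc_of_ae_Ioo hT hFc continuousOn_const hFae
  have h1 := hE ht
  have h2 := hE (left_mem_Icc.2 hT.le)
  simp only [hF, intervalIntegral.integral_same, sub_zero] at h1 h2
  linarith

/-- The composition of a nonnegative primitive with `exp (-·)` is absolutely continuous. -/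
theorem AbsolutelyContinuousOnInterval.exp_neg {A : ℝ → ℝ} {a b : ℝ}
    (hA : AbsolutelyContinuousOnInterval A a b) (h0 : ∀ x ∈ uIcc a b, 0 ≤ A x) :
    AbsolutelyContinuousOnInterval (fun x => Real.exp (-A x)) a b := by
  rw [absolutelyContinuousOnInterval_iff] at hA ⊢
  intro ε hε
  obtain ⟨δ, hδ, h⟩ := hA ε hε
  refine ⟨δ, hδ, fun E hE hE' => lt_of_le_of_lt (Finset.sum_le_sum fun i hi => ?_) (h E hE hE')⟩
  have hi' := hE.1 i hi
  -- `exp (-·)` is 1-Lipschitz on `[0, ∞)`, so the `δ` that works for `A` works unchanged.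
  have key : ∀ p q : ℝ, 0 ≤ p → p ≤ q → |Real.exp (-p) - Real.exp (-q)| ≤ |p - q| := by
    intro p q hp hpq
    rw [abs_of_nonneg (by simpa using hpq), abs_of_nonpos (by linarith)]
    have h1 := Real.add_one_le_exp (-(q - p))
    have h2 : Real.exp (-q) = Real.exp (-p) * Real.exp (-(q - p)) := by
      rw [← Real.exp_add]; ring_nf
    have h3 : Real.exp (-p) ≤ 1 := by simpa using hp
    have h4 := Real.exp_pos (-p)
    rw [h2]
    nlinarith
  rw [Real.dist_eq, Real.dist_eq]
  rcases le_total (A (E.2 i).1) (A (E.2 i).2) with hle | hle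
  · exact key _ _ (h0 _ hi'.1) hle
  · rw [abs_sub_comm, abs_sub_comm (A _)]
    exact key _ _ (h0 _ hi'.2) hle

/-- Gronwall's inequality in integral form. -/
theorem gronwall_integral {T : ℝ} {a f g : ℝ → ℝ} {f₀ : ℝ} (ha0 : ∀ s, 0 ≤ a s)
    (ha : IntegrableOn a (Ioc 0 T)) (hg : IntegrableOn g (Ioc 0 T))
    (haf : IntegrableOn (fun s => a s * f s) (Ioc 0 T))
    (h : ∀ t ∈ Icc 0 T, f t ≤ f₀ + ∫ s in 0..t, (g s + a s * f s)) {t : ℝ} (ht : t ∈ Icc 0 T) :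
    f t ≤ Real.exp (∫ s in 0..t, a s) * f₀
      + ∫ s in 0..t, Real.exp (∫ τ in s..t, a τ) * g s := by
  have hT : ∀ {k : ℝ → ℝ}, IntegrableOn k (Ioc 0 T) → IntervalIntegrable k volume 0 t := fun hk =>
    (intervalIntegrable_iff_integrableOn_Ioc_of_le ht.1).2
      (hk.mono_set (Ioc_subset_Ioc_right ht.2))
  have hai := hT ha
  have hgi := hT hg
  have hki := hgi.add (hT haf)
  set A : ℝ → ℝ := fun x => ∫ s in 0..x, a s with hAdef
  set K : ℝ → ℝ := fun x => ∫ s in 0..x, (g s + a s * f s) with hKdef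
  have hI : uIcc 0 t = Icc 0 t := uIcc_of_le ht.1
  have hA0 : ∀ x ∈ uIcc 0 t, 0 ≤ A x := fun x hx =>
    intervalIntegral.integral_nonneg (by rw [hI] at hx; exact hx.1) fun s _ => ha0 s
  have hAac : AbsolutelyContinuousOnInterval A 0 t :=
    hai.absolutelyContinuousOnInterval_intervalIntegral left_mem_uIcc
  have hKac : AbsolutelyContinuousOnInterval (fun x => f₀ + K x) 0 t := by
    refine AbsolutelyContinuousOnInterval.add ?_
      (hki.absolutelyContinuousOnInterval_intervalIntegral left_mem_uIcc)
    exact (contDiff_const.contDiffOn (n := 1)).absolutelyContinuousOnInterval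
  have hEac := AbsolutelyContinuousOnInterval.exp_neg hAac hA0
  -- `f` need not be continuous, so the quantity differentiated is `exp (-A) (f₀ + K)`, with the
  -- absolutely continuous majorant in place of `f`. Its derivative `exp (-A) (g + a f - a (f₀ +
  -- K))` is at most `exp (-A) g`, because `a ≥ 0`.
  have hmain := hEac.integral_deriv_mul_eq_sub hKac
  have hle : ∫ x in 0..t, (deriv (fun x => Real.exp (-A x)) x * (f₀ + K x)
      + Real.exp (-A x) * deriv (fun x => f₀ + K x) x) ≤ ∫ x in 0..t, Real.exp (-A x) * g x := by
    refine intervalIntegral.integral_mono_ae_restrict ht.1 ?_ ?_ ?_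
    · exact (hEac.intervalIntegrable_deriv.mul_continuousOn hKac.continuousOn).add
        (hKac.intervalIntegrable_deriv.continuousOn_mul hEac.continuousOn)
    · exact hgi.continuousOn_mul hEac.continuousOn
    · have h1 := hai.ae_hasDerivAt_integral
      have h2 := hki.ae_hasDerivAt_integral
      refine (ae_restrict_iff' measurableSet_Icc).2 ?_
      filter_upwards [h1, h2] with x hx1 hx2 hx
      have hx' : x ∈ uIcc 0 t := by rwa [hI]
      have d1 := hx1 hx' 0 left_mem_uIcc
      have d2 := hx2 hx' 0 left_mem_uIcc
      have d3 : HasDerivAt (fun x => Real.exp (-A x)) (Real.exp (-A x) * -a x) x := d1.neg.exp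
      have d4 : HasDerivAt (fun x => f₀ + K x) (g x + a x * f x) x := d2.const_add f₀
      simp only [d3.deriv, d4.deriv]
      have := h x ⟨hx.1, hx.2.trans ht.2⟩
      have h5 := mul_le_mul_of_nonneg_left this (mul_nonneg (Real.exp_pos (-A x)).le (ha0 x))
      simp only [hKdef]
      linarith
  rw [hmain] at hle
  have h0 : A 0 = 0 := by simp [hAdef]
  have h0' : K 0 = 0 := by simp [hKdef]
  simp only [h0, h0', neg_zero, Real.exp_zero, one_mul, add_zero] at hle
  have hft := h t ht
  have hpos := Real.exp_pos (A t)
  have hee : Real.exp (A t) * Real.exp (-A t) = 1 := by rw [← Real.exp_add]; simp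
  have hint : ∫ s in 0..t, Real.exp (∫ τ in s..t, a τ) * g s
      = Real.exp (A t) * ∫ x in 0..t, Real.exp (-A x) * g x := by
    rw [← intervalIntegral.integral_const_mul]
    refine intervalIntegral.integral_congr fun s hs => ?_
    have hsub : ∫ τ in s..t, a τ = A t - A s := by
      rw [hAdef]
      exact (intervalIntegral.integral_interval_sub_left hai
        (hai.mono_set (uIcc_subset_uIcc left_mem_uIcc hs))).symm
    simp only [hsub]
    rw [sub_eq_add_neg, Real.exp_add, mul_assoc]
  rw [hint]
  calc f t ≤ f₀ + K t := hft
    _ = Real.exp (A t) * (Real.exp (-A t) * (f₀ + K t)) := by rw [← mul_assoc, hee, one_mul]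
    _ ≤ Real.exp (A t) * (f₀ + ∫ x in 0..t, Real.exp (-A x) * g x) := by
        gcongr; linarith
    _ = _ := by ring

open scoped Convolution
open ContinuousLinearMap (lsmul)

/-! ### Mollification -/

variable {n : ℕ}

/-- The convolution `η ⋆ u` of a scalar kernel with a vector-valued function. -/
def conv {E : Type*} [NormedAddCommGroup E] [NormedSpace ℝ E] (η : Space n → ℝ)
    (u : Space n → E) : Space n → E := η ⋆[lsmul ℝ ℝ, volume] u

theorem conv_apply {E : Type*} [NormedAddCommGroup E] [NormedSpace ℝ E] (η : Space n → ℝ)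
    (u : Space n → E) (x : Space n) : conv η u x = ∫ y, η (x - y) • u y := by
  rw [conv, convolution_lsmul_swap]

theorem conv_apply' {E : Type*} [NormedAddCommGroup E] [NormedSpace ℝ E] (η : Space n → ℝ)
    (u : Space n → E) (x : Space n) : conv η u x = ∫ y, η y • u (x - y) := by
  rw [conv, convolution_lsmul]

theorem locallyIntegrable_L2 (u : L2Field n) : LocallyIntegrable u volume :=
  (Lp.memLp u).locallyIntegrable (by norm_num)

theorem memLp_of_hasCompactSupport {E : Type*} [NormedAddCommGroup E] {f : Space n → E}
    (hf : Continuous f) (hc : HasCompactSupport f) (p : ENNReal) : MemLp f p volume :=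
  hf.memLp_of_hasCompactSupport hc

/-- Translation of an `L²` field. -/
def translate (y : Space n) : L2Field n →ₗᵢ[ℝ] L2Field n :=
  Lp.compMeasurePreservingₗᵢ ℝ (fun x => x - y) (measurePreserving_sub_right volume y)

theorem translate_ae (y : Space n) (u : L2Field n) : translate y u =ᵐ[volume] fun x => u (x - y) :=
  Lp.coeFn_compMeasurePreserving u (measurePreserving_sub_right volume y)

theorem translate_zero (u : L2Field n) : translate 0 u = u := by
  refine Lp.ext ?_
  filter_upwards [translate_ae 0 u] with x hx
  rw [hx, sub_zero]

theorem continuous_translate (u : L2Field n) : Continuous fun y : Space n => translate y u := by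
  let g : Space n → C(Space n, Space n) := fun y => ⟨fun x => x - y, by fun_prop⟩
  have hg : Continuous g := ContinuousMap.continuous_of_continuous_uncurry _ (by
    simp only [g, Function.uncurry_def, ContinuousMap.coe_mk]; fun_prop)
  exact (continuous_const (y := u)).compMeasurePreservingLp hg
    (fun y => measurePreserving_sub_right volume y) (by norm_num)

theorem integrable_smul_translate {η : Space n → ℝ} (hη : Continuous η) (hc : HasCompactSupport η)
    (u : L2Field n) : Integrable (fun y => η y • translate y u) volume :=
  (hη.smul (continuous_translate u)).integrable_of_hasCompactSupport hc.smul_right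

theorem norm_integral_smul_translate_le (η : Space n → ℝ) (u : L2Field n) :
    ‖∫ y, η y • translate y u‖ ≤ (∫ y, ‖η y‖) * ‖u‖ := by
  refine (norm_integral_le_integral_norm _).trans ?_
  rw [← integral_mul_const]
  simp only [norm_smul, LinearIsometry.norm_map, le_refl]

/-- Mollification by a continuous compactly supported kernel, as a bounded operator on `L²`. -/
def moll (η : Space n → ℝ) (hη : Continuous η) (hc : HasCompactSupport η) :
    L2Field n →L[ℝ] L2Field n :=
  LinearMap.mkContinuous
    { toFun := fun u => ∫ y, η y • translate y u
      map_add' := fun u w => by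
        rw [← integral_add (integrable_smul_translate hη hc u) (integrable_smul_translate hη hc w)]
        simp only [map_add, smul_add]
      map_smul' := fun c u => by
        rw [RingHom.id_apply, ← integral_smul]
        simp only [map_smul, smul_comm c] }
    (∫ y, ‖η y‖) (norm_integral_smul_translate_le η)

theorem moll_apply {η : Space n → ℝ} (hη : Continuous η) (hc : HasCompactSupport η)
    (u : L2Field n) : moll η hη hc u = ∫ y, η y • translate y u := rfl

/-- `η ⋆ u` is the value of a bounded bilinear map. -/
theorem exists_convolution_eq {E G : Type*} [NormedAddCommGroup E] [NormedSpace ℝ E]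
    [NormedAddCommGroup G] [NormedSpace ℝ G] [CompleteSpace G] (L : E →L[ℝ] Space n →L[ℝ] G)
    {k : Space n → E} (hk : Continuous k) (hc : HasCompactSupport k) :
    ∃ C, ∀ x, ∃ Λ : L2Field n →L[ℝ] G, ‖Λ‖ ≤ C ∧ ∀ u : L2Field n, (k ⋆[L, volume] u) x = Λ u := by
  -- The value at `x` pairs `k` with `y ↦ u (x - y)`. Reflection and translation are isometries of
  -- `L²`, so the norm bound does not depend on `x`.
  set B := L.lpPairing volume 2 2 (memLp_of_hasCompactSupport hk hc 2).toLp with hB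
  refine ⟨‖B‖, fun x => ?_⟩
  have hmp : MeasurePreserving (fun y : Space n => x - y) volume volume :=
    Measure.measurePreserving_sub_left volume x
  set R := (Lp.compMeasurePreservingₗᵢ (E := Space n) (p := 2) ℝ (fun y => x - y) hmp) with hR
  refine ⟨B.comp R.toContinuousLinearMap, ?_, fun u => ?_⟩
  · refine ContinuousLinearMap.opNorm_le_bound _ (norm_nonneg _) fun u => ?_
    refine (B.le_opNorm _).trans ?_
    simp
  · rw [ContinuousLinearMap.comp_apply, hB, ContinuousLinearMap.lpPairing_eq_integral, convolution_def]
    refine integral_congr_ae ?_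
    filter_upwards [(memLp_of_hasCompactSupport hk hc 2).coeFn_toLp,
      Lp.coeFn_compMeasurePreserving u hmp] with y h1 h2
    rw [h1]
    congr 1
    exact h2.symm

/-- The Bochner integral of translates and the pointwise convolution have the same integral against
every test function, by Fubini. -/
theorem moll_ae {η : Space n → ℝ} (hη : Continuous η) (hc : HasCompactSupport η) (u : L2Field n) :
    moll η hη hc u =ᵐ[volume] conv η u := by
  have hcont : Continuous (conv η u) := hc.continuous_convolution_left _ hη (locallyIntegrable_L2 u)
  refine ae_eq_of_integral_contDiff_smul_eq (locallyIntegrable_L2 _) hcont.locallyIntegrable ?_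
  intro g hg hgc
  set Λ : L2Field n →L[ℝ] Space n := (lsmul ℝ ℝ : ℝ →L[ℝ] Space n →L[ℝ] Space n).lpPairing volume 2 2
    (memLp_of_hasCompactSupport hg.continuous hgc 2).toLp with hΛ
  have hΛu : ∀ w : L2Field n, Λ w = ∫ x, g x • w x := by
    intro w
    rw [hΛ, ContinuousLinearMap.lpPairing_eq_integral]
    refine integral_congr_ae ?_
    filter_upwards [(memLp_of_hasCompactSupport hg.continuous hgc 2).coeFn_toLp] with y h1
    rw [h1]; rfl
  rw [← hΛu, moll_apply, ← Λ.integral_comp_comm (integrable_smul_translate hη hc u)]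
  have e1 : ∀ y, Λ (η y • translate y u) = ∫ x, g x • η y • u (x - y) := by
    intro y
    rw [map_smul, hΛu, ← integral_smul]
    refine integral_congr_ae ?_
    filter_upwards [translate_ae y u] with x hx
    rw [hx, smul_comm]
  simp only [e1, conv_apply', ← integral_smul]
  rw [integral_integral_swap]
  -- For `x` in the support of `g` and `y` in that of `η`, the point `x - y` stays in the compact
  -- set `K`. There the locally integrable `u` may be replaced by an integrable function.
  set K := (fun p : Space n × Space n => p.1 - p.2) '' (tsupport g ×ˢ tsupport η) with hK
  have hKc : IsCompact K := (hgc.isCompact.prod hc.isCompact).image (by fun_prop)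
  have hu1 : Integrable (K.indicator u) volume :=
    ((locallyIntegrable_L2 u).integrableOn_isCompact hKc).integrable_indicator hKc.measurableSet
  have h1 : Integrable (fun p : Space n × Space n => η p.2 • K.indicator u (p.1 - p.2))
      (volume.prod volume) :=
    (hη.integrable_of_hasCompactSupport hc).convolution_integrand (lsmul ℝ ℝ) hu1
  obtain ⟨C, hC⟩ := hg.continuous.bounded_above_of_compact_support hgc
  have h2 : Integrable (fun p : Space n × Space n => g p.1 • η p.2 • K.indicator u (p.1 - p.2))
      (volume.prod volume) :=
    h1.bdd_smul C (by fun_prop) (Eventually.of_forall fun p => hC p.1)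
  refine (h2.swap).congr (Eventually.of_forall fun p => ?_)
  simp only [Function.comp_apply, Prod.fst_swap, Prod.snd_swap, Function.uncurry]
  by_cases hx : p.2 ∈ tsupport g
  · by_cases hy : p.1 ∈ tsupport η
    · rw [indicator_of_mem (show p.2 - p.1 ∈ K from ⟨p.swap, ⟨hx, hy⟩, rfl⟩)]
    · simp [image_eq_zero_of_notMem_tsupport hy]
  · simp [image_eq_zero_of_notMem_tsupport hx]

/-- A sequence of mollifiers. -/
def bump (n k : ℕ) : ContDiffBump (0 : Space n) :=
  ⟨1 / (2 * (k + 1)), 1 / (k + 1), by positivity, by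
    rw [div_lt_div_iff₀ (by positivity) (by positivity)]; linarith [(k.cast_nonneg : (0 : ℝ) ≤ k)]⟩

/-- The kernel of the `k`-th mollifier. -/
def mol (n k : ℕ) : Space n → ℝ := (bump n k).normed volume

theorem mol_contDiff (k : ℕ) : ContDiff ℝ ∞ (mol n k) := (bump n k).contDiff_normed
theorem mol_hasCompactSupport (k : ℕ) : HasCompactSupport (mol n k) :=
  (bump n k).hasCompactSupport_normed
theorem mol_nonneg (k : ℕ) (x : Space n) : 0 ≤ mol n k x := (bump n k).nonneg_normed x
theorem mol_integral (k : ℕ) : ∫ x, mol n k x = 1 := (bump n k).integral_normed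

theorem bump_rOut_tendsto : Tendsto (fun k => (bump n k).rOut) atTop (𝓝 0) :=
  tendsto_one_div_add_atTop_nhds_zero_nat

/-- The `k`-th mollification operator. -/
def mollify (k : ℕ) : L2Field n →L[ℝ] L2Field n :=
  moll (mol n k) (mol_contDiff k).continuous (mol_hasCompactSupport k)

theorem mollify_ae (k : ℕ) (u : L2Field n) : mollify k u =ᵐ[volume] conv (mol n k) u := moll_ae _ _ u

theorem norm_mollify_le (k : ℕ) (u : L2Field n) : ‖mollify k u‖ ≤ ‖u‖ := by
  refine (norm_integral_smul_translate_le (mol n k) u).trans ?_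
  have : ∫ y, ‖mol n k y‖ = 1 := by
    rw [← mol_integral (n := n) k]
    exact integral_congr_ae (Eventually.of_forall fun x => Real.norm_of_nonneg (mol_nonneg k x))
  rw [this, one_mul]

/-- The Bochner integral is a convolution evaluated at `0`, with the continuous `L²`-valued function
`z ↦ translate (-z) u`. Convergence at a point of continuity therefore gives convergence in `L²`. -/
theorem mollify_tendsto (u : L2Field n) : Tendsto (fun k => mollify k u) atTop (𝓝 u) := by
  have hg : Continuous fun z : Space n => translate (-z) u :=
    (continuous_translate u).comp continuous_neg
  have := ContDiffBump.convolution_tendsto_right_of_continuous (μ := volume)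
    (φ := bump n) bump_rOut_tendsto hg 0
  simp only [convolution_lsmul, zero_sub, neg_neg, neg_zero, translate_zero] at this
  exact this

theorem ae_conv_mol_tendsto {E : Type*} [NormedAddCommGroup E] [NormedSpace ℝ E] [CompleteSpace E]
    {g : Space n → E} (hg : LocallyIntegrable g volume) :
    ∀ᵐ x, Tendsto (fun k => conv (mol n k) g x) atTop (𝓝 (g x)) := by
  -- The constant 2 is the ratio of the outer to the inner radius of every bump; Lebesgue
  -- differentiation requires it to stay bounded.
  refine ContDiffBump.ae_convolution_tendsto_right_of_locallyIntegrable (φ := bump n) (K := 2)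
    bump_rOut_tendsto (Eventually.of_forall fun k => ?_) hg
  simp only [bump]
  field_simp
  norm_num

theorem norm_conv_mol_le {E : Type*} [NormedAddCommGroup E] [NormedSpace ℝ E]
    {g : Space n → E} {C : ℝ} (hg : ∀ x, ‖g x‖ ≤ C) (k : ℕ) (x : Space n) :
    ‖conv (mol n k) g x‖ ≤ C := by
  rw [conv_apply']
  calc ‖∫ y, mol n k y • g (x - y)‖ ≤ ∫ y, mol n k y * C := by
        refine norm_integral_le_of_norm_le
          (((mol_contDiff k).continuous.integrable_of_hasCompactSupport
            (mol_hasCompactSupport k)).mul_const C) (Eventually.of_forall fun y => ?_)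
        rw [norm_smul, Real.norm_of_nonneg (mol_nonneg k y)]
        exact mul_le_mul_of_nonneg_left (hg _) (mol_nonneg k y)
    _ = C := by rw [integral_mul_const, mol_integral, one_mul]

theorem conv_contDiff {η : Space n → ℝ} (hη : ContDiff ℝ ∞ η) (hc : HasCompactSupport η)
    {E : Type*} [NormedAddCommGroup E] [NormedSpace ℝ E]
    [CompleteSpace E] {g : Space n → E} (hg : LocallyIntegrable g volume) : ContDiff ℝ ∞ (conv η g) :=
  hc.contDiff_convolution_left (n := ⊤) _ hη hg

theorem conv_integrable {η : Space n → ℝ} (hη : ContDiff ℝ ∞ η) (hc : HasCompactSupport η)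
    {E : Type*} [NormedAddCommGroup E] [NormedSpace ℝ E]
    {g : Space n → E} (hg : LocallyIntegrable g volume) (x : Space n) :
    Integrable (fun y => η (x - y) • g y) volume :=
  (hc.convolutionExists_left (lsmul ℝ ℝ) hη.continuous hg x).integrable_swap

/-! ### Derivatives of mollified fields -/

theorem sum_smul_single (u : Space n) : ∑ i, u i • EuclideanSpace.single i (1 : ℝ) = u := by
  ext j
  simp [Finset.sum_apply, Pi.single_apply]

theorem sum_mul_partialD (f : Space n → ℝ) (x u : Space n) :
    ∑ i, u i * partialD i f x = fderiv ℝ f x u := by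
  conv_rhs => rw [← sum_smul_single u, map_sum]
  simp [partialD]

theorem partialD_contDiff {E : Type*} [NormedAddCommGroup E] [NormedSpace ℝ E] {η : Space n → E}
    (hη : ContDiff ℝ ∞ η) (i : Fin n) : ContDiff ℝ ∞ (partialD i η) :=
  (hη.fderiv_right (m := ∞) (by simp)).clm_apply contDiff_const

theorem partialD_hasCompactSupport {E : Type*} [NormedAddCommGroup E] [NormedSpace ℝ E]
    {η : Space n → E} (hc : HasCompactSupport η) (i : Fin n) : HasCompactSupport (partialD i η) :=
  hc.fderiv_apply ℝ _

theorem fderiv_conv_apply {E : Type*} [NormedAddCommGroup E] [NormedSpace ℝ E] [CompleteSpace E]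
    {η : Space n → ℝ} (hη : ContDiff ℝ ∞ η) (hc : HasCompactSupport η) {g : Space n → E}
    (hg : LocallyIntegrable g volume) (x e : Space n) :
    fderiv ℝ (conv η g) x e = conv (fun y => fderiv ℝ η y e) g x := by
  have h := hc.hasFDerivAt_convolution_left (lsmul ℝ ℝ) (hη.of_le (by simp)) hg x
  have hi : ConvolutionExists (fderiv ℝ η) g ((lsmul ℝ ℝ : ℝ →L[ℝ] E →L[ℝ] E).precompL (Space n))
      volume :=
    (hc.fderiv ℝ).convolutionExists_left _ (hη.continuous_fderiv (by simp)) hg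
  rw [conv, h.fderiv, convolution_def, ContinuousLinearMap.integral_apply (hi x), conv_apply']
  rfl

theorem partialD_conv {E : Type*} [NormedAddCommGroup E] [NormedSpace ℝ E] [CompleteSpace E]
    {η : Space n → ℝ} (hη : ContDiff ℝ ∞ η) (hc : HasCompactSupport η) {g : Space n → E}
    (hg : LocallyIntegrable g volume) (i : Fin n) :
    partialD i (conv η g) = conv (partialD i η) g :=
  funext fun x => fderiv_conv_apply hη hc hg x _

theorem exists_norm_conv_le {η : Space n → ℝ} (hη : Continuous η) (hc : HasCompactSupport η) :
    ∃ C, ∀ (u : L2Field n) x, ‖conv η u x‖ ≤ C * ‖u‖ := by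
  obtain ⟨C, hC⟩ := exists_convolution_eq (lsmul ℝ ℝ : ℝ →L[ℝ] Space n →L[ℝ] Space n) hη hc
  refine ⟨C, fun u x => ?_⟩
  obtain ⟨Λ, h1, h2⟩ := hC x
  rw [conv, h2]
  exact Λ.le_of_opNorm_le h1 u

/-- `u ↦ ∇(η ⋆ u)` is a bounded linear map from `L²` to bounded functions, pointwise. -/
theorem exists_fderiv_conv_eq {η : Space n → ℝ} (hη : ContDiff ℝ ∞ η) (hc : HasCompactSupport η) :
    ∃ C, ∀ x, ∃ Λ : L2Field n →L[ℝ] (Space n →L[ℝ] Space n), ‖Λ‖ ≤ C ∧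
      ∀ u : L2Field n, fderiv ℝ (conv η u) x = Λ u := by
  obtain ⟨C, hC⟩ := exists_convolution_eq
    ((lsmul ℝ ℝ : ℝ →L[ℝ] Space n →L[ℝ] Space n).precompL (Space n))
    (hη.continuous_fderiv (by simp)) (hc.fderiv ℝ)
  refine ⟨C, fun x => ?_⟩
  obtain ⟨Λ, h1, h2⟩ := hC x
  exact ⟨Λ, h1, fun u => by
    rw [← h2]
    exact (hc.hasFDerivAt_convolution_left (lsmul ℝ ℝ) (hη.of_le (by simp))
      (locallyIntegrable_L2 u) x).fderiv⟩

theorem fderiv_conv_continuous {η : Space n → ℝ} (hη : ContDiff ℝ ∞ η) (hc : HasCompactSupport η)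
    (u : L2Field n) : Continuous (fderiv ℝ (conv η u)) :=
  (conv_contDiff hη hc (locallyIntegrable_L2 u)).continuous_fderiv (by simp)

theorem memLp_top_fderiv_conv {η : Space n → ℝ} (hη : ContDiff ℝ ∞ η) (hc : HasCompactSupport η)
    (u : L2Field n) : MemLp (fderiv ℝ (conv η u)) ⊤ volume := by
  obtain ⟨C, hC⟩ := exists_fderiv_conv_eq hη hc
  refine memLp_top_of_bound (fderiv_conv_continuous hη hc u).aestronglyMeasurable (C * ‖u‖)
    (Eventually.of_forall fun x => ?_)
  obtain ⟨Λ, h1, h2⟩ := hC x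
  rw [h2]
  exact Λ.le_of_opNorm_le h1 u

/-- The operator `u ↦ ∇(η ⋆ u)` from `L²` to `L^∞`. -/
def gradConv (η : Space n → ℝ) (hη : ContDiff ℝ ∞ η) (hc : HasCompactSupport η) :
    L2Field n →L[ℝ] Lp (Space n →L[ℝ] Space n) ⊤ (volume : Measure (Space n)) :=
  LinearMap.mkContinuous
    { toFun := fun u => (memLp_top_fderiv_conv hη hc u).toLp
      map_add' := fun u w => by
        rw [← MemLp.toLp_add]
        congr 1
        ext1 x
        obtain ⟨Λ, h1, h2⟩ := (exists_fderiv_conv_eq hη hc).choose_spec x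
        simp only [Pi.add_apply, h2, map_add]
      map_smul' := fun c u => by
        rw [RingHom.id_apply, ← MemLp.toLp_const_smul]
        congr 1
        ext1 x
        obtain ⟨Λ, h1, h2⟩ := (exists_fderiv_conv_eq hη hc).choose_spec x
        simp only [Pi.smul_apply, h2, map_smul] }
    (exists_fderiv_conv_eq hη hc).choose fun u => by
      have hC0 : 0 ≤ (exists_fderiv_conv_eq hη hc).choose := by
        obtain ⟨Λ, h1, h2⟩ := (exists_fderiv_conv_eq hη hc).choose_spec 0
        exact (norm_nonneg Λ).trans h1
      refine (Lp.norm_toLp _ (memLp_top_fderiv_conv hη hc u)).trans_le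
        (ENNReal.toReal_le_of_le_ofReal (by positivity) ?_)
      rw [eLpNorm_exponent_top]
      refine eLpNormEssSup_le_of_ae_bound (Eventually.of_forall fun x => ?_)
      obtain ⟨Λ, h1, h2⟩ := (exists_fderiv_conv_eq hη hc).choose_spec x
      rw [h2]
      exact Λ.le_of_opNorm_le h1 u

theorem integral_coord {f : Space n → Space n} (hf : Integrable f volume) (i : Fin n) :
    (∫ x, f x) i = ∫ x, f x i :=
  ((EuclideanSpace.proj i : Space n →L[ℝ] ℝ).integral_comp_comm hf).symm

theorem partialD_apply_coord {f : Space n → Space n} (hf : ContDiff ℝ ∞ f) (i j : Fin n)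
    (x : Space n) : partialD i f x j = partialD i (fun y => f y j) x := by
  have h : HasFDerivAt (fun y => f y j)
      ((EuclideanSpace.proj j : Space n →L[ℝ] ℝ).comp (fderiv ℝ f x)) x :=
    (EuclideanSpace.proj j : Space n →L[ℝ] ℝ).hasFDerivAt.comp x
      (hf.differentiable (by simp) x).hasFDerivAt
  rw [partialD, partialD, h.fderiv]
  rfl

theorem partialD_comp_sub {η : Space n → ℝ} (hη : ContDiff ℝ ∞ η) (i : Fin n) (x y : Space n) :
    partialD i (fun z => η (x - z)) y = -partialD i η (x - y) := by
  have h : HasFDerivAt (fun z => η (x - z)) ((fderiv ℝ η (x - y)).comp (-ContinuousLinearMap.id ℝ _)) y :=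
    (hη.differentiable (by simp) (x - y)).hasFDerivAt.comp y ((hasFDerivAt_id y).const_sub x)
  rw [partialD, h.fderiv]
  simp [partialD]

theorem hasCompactSupport_comp_sub {η : Space n → ℝ} (hc : HasCompactSupport η) (x : Space n) :
    HasCompactSupport fun z => η (x - z) :=
  hc.comp_homeomorph (Homeomorph.subLeft x)

theorem conv_apply_coord {η : Space n → ℝ} (hη : ContDiff ℝ ∞ η) (hc : HasCompactSupport η)
    (u : L2Field n) (x : Space n) (j : Fin n) : conv η u x j = ∫ y, η (x - y) * u y j := by
  rw [conv_apply, integral_coord (conv_integrable hη hc (locallyIntegrable_L2 u) x)]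
  rfl

theorem integrable_mul_coord {ψ : Space n → ℝ} (hψ : Continuous ψ) (hc : HasCompactSupport ψ)
    (u : L2Field n) (j : Fin n) : Integrable (fun y => ψ y * u y j) volume := by
  have := (locallyIntegrable_L2 u).integrable_smul_left_of_hasCompactSupport hψ hc
  exact (EuclideanSpace.proj j : Space n →L[ℝ] ℝ).integrable_comp this

/-- Mollification preserves the divergence-free condition. -/
theorem divergence_conv {η : Space n → ℝ} (hη : ContDiff ℝ ∞ η) (hc : HasCompactSupport η)
    {u : L2Field n} (hu : WeaklyDivFree u) (x : Space n) : divergence (conv η u) x = 0 := by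
  have h := hu (fun z => η (x - z)) (hη.comp (contDiff_const.sub contDiff_id))
    (hasCompactSupport_comp_sub hc x)
  have hi : ∀ i, Integrable (fun y => u y i * partialD i (fun z => η (x - z)) y) volume := by
    intro i
    have := integrable_mul_coord
      (partialD_contDiff (hη.comp (contDiff_const.sub contDiff_id)) i).continuous
      (partialD_hasCompactSupport (hasCompactSupport_comp_sub hc x) i) u i
    exact this.congr (Eventually.of_forall fun y => mul_comm _ _)
  rw [integral_finsetSum _ fun i _ => hi i] at h
  rw [divergence, ← neg_eq_zero, ← h, ← Finset.sum_neg_distrib]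
  refine Finset.sum_congr rfl fun i _ => ?_
  rw [partialD_conv hη hc (locallyIntegrable_L2 u),
    conv_apply_coord (partialD_contDiff hη i) (partialD_hasCompactSupport hc i), ← integral_neg]
  refine integral_congr_ae (Eventually.of_forall fun y => ?_)
  simp only [partialD_comp_sub hη]
  ring

/-- A divergence-free field is orthogonal to gradients. -/
theorem integral_fderiv_apply_eq_zero {a : Space n → Space n} {f : Space n → ℝ}
    (ha : ContDiff ℝ ∞ a) (hf : ContDiff ℝ ∞ f) (hdiv : ∀ x, divergence a x = 0)
    (h1 : Integrable (fun x => ‖a x‖ * ‖f x‖) volume)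
    (h2 : Integrable (fun x => ‖a x‖ * ‖fderiv ℝ f x‖) volume)
    (h3 : Integrable (fun x => ‖fderiv ℝ a x‖ * ‖f x‖) volume) :
    ∫ x, fderiv ℝ f x (a x) = 0 := by
  have hac : ∀ i, ContDiff ℝ ∞ (fun x => a x i) := fun i =>
    (EuclideanSpace.proj i : Space n →L[ℝ] ℝ).contDiff.comp ha
  have hle : ∀ (u : Space n) i, ‖u i‖ ≤ ‖u‖ := fun u i => PiLp.norm_apply_le u i
  have hone : ∀ i : Fin n, ‖(EuclideanSpace.single i (1 : ℝ) : Space n)‖ = 1 := by simp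
  have i1 : ∀ i, Integrable (fun x => a x i * f x) volume := fun i =>
    h1.mono' ((hac i).continuous.mul hf.continuous).aestronglyMeasurable
      (Eventually.of_forall fun x => by
        rw [norm_mul]; exact mul_le_mul_of_nonneg_right (hle _ _) (norm_nonneg _))
  have i2 : ∀ i, Integrable (fun x => a x i * partialD i f x) volume := fun i =>
    h2.mono' ((hac i).continuous.mul (partialD_contDiff hf i).continuous).aestronglyMeasurable
      (Eventually.of_forall fun x => by
        rw [norm_mul]
        refine mul_le_mul (hle _ _) ?_ (norm_nonneg _) (norm_nonneg _)
        exact (ContinuousLinearMap.le_opNorm _ _).trans (by rw [hone, mul_one]))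
  have i3 : ∀ i, Integrable (fun x => partialD i (fun y => a y i) x * f x) volume := fun i =>
    h3.mono' ((partialD_contDiff (hac i) i).continuous.mul hf.continuous).aestronglyMeasurable
      (Eventually.of_forall fun x => by
        rw [norm_mul, ← partialD_apply_coord ha]
        refine mul_le_mul_of_nonneg_right ((hle _ _).trans ?_) (norm_nonneg _)
        exact (ContinuousLinearMap.le_opNorm _ _).trans (by rw [hone, mul_one]))
  have key : ∀ i, ∫ x, a x i * partialD i f x = -∫ x, partialD i a x i * f x := by
    intro i
    simp only [partialD_apply_coord ha]
    exact integral_mul_fderiv_eq_neg_fderiv_mul_of_integrable (i3 i) (i2 i) (i1 i)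
      (fun x _ => (hac i).differentiable (by simp) x) (fun x _ => hf.differentiable (by simp) x)
  simp only [← sum_mul_partialD]
  rw [integral_finsetSum _ fun i _ => i2 i]
  simp only [key, Finset.sum_neg_distrib]
  rw [← integral_finsetSum _ fun i _ => by simpa only [partialD_apply_coord ha] using i3 i]
  simp only [← Finset.sum_mul]
  rw [neg_eq_zero]
  refine (integral_congr_ae (Eventually.of_forall fun x => ?_)).trans (integral_zero _ _)
  have := hdiv x
  simp only [divergence] at this
  simp only [this, zero_mul]

/-! ### Density of smooth solenoidal fields -/

/-- The gradient of a test function, as an element of `L²`. -/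
def gradL (ψ : Space n → ℝ) (hψ : ContDiff ℝ ∞ ψ) (hc : HasCompactSupport ψ) : L2Field n :=
  MemLp.toLp (gradient ψ) <| memLp_of_hasCompactSupport
    ((InnerProductSpace.toDual ℝ (Space n)).symm.continuous.comp (hψ.continuous_fderiv (by simp)))
    ((hc.fderiv ℝ).comp_left (map_zero _)) 2

theorem inner_gradL {ψ : Space n → ℝ} (hψ : ContDiff ℝ ∞ ψ) (hc : HasCompactSupport ψ)
    (u : L2Field n) : inner ℝ u (gradL ψ hψ hc) = ∫ x, ∑ i, u x i * partialD i ψ x := by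
  rw [L2.inner_def]
  refine integral_congr_ae ?_
  filter_upwards [MemLp.coeFn_toLp (memLp_of_hasCompactSupport (f := gradient ψ)
    ((InnerProductSpace.toDual ℝ (Space n)).symm.continuous.comp (hψ.continuous_fderiv (by simp)))
    ((hc.fderiv ℝ).comp_left (map_zero _)) 2)] with x hx
  rw [sum_mul_partialD, gradL, hx, real_inner_comm, gradient, InnerProductSpace.toDual_symm_apply]

theorem weaklyDivFree_iff {u : L2Field n} : WeaklyDivFree u ↔
    ∀ ψ : Space n → ℝ, ∀ (hψ : ContDiff ℝ ∞ ψ) (hc : HasCompactSupport ψ),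
      inner ℝ u (gradL ψ hψ hc) = 0 := by
  simp only [inner_gradL, WeaklyDivFree]

theorem isClosed_weaklyDivFree : IsClosed {u : L2Field n | WeaklyDivFree u} := by
  simp only [weaklyDivFree_iff, ofPred_forall]
  exact isClosed_iInter fun ψ => isClosed_iInter fun hψ => isClosed_iInter fun hc =>
    isClosed_eq (by fun_prop) continuous_const

theorem WeaklyDivFree.sub {u w : L2Field n} (hu : WeaklyDivFree u) (hw : WeaklyDivFree w) :
    WeaklyDivFree (u - w) := by
  rw [weaklyDivFree_iff] at *
  intro ψ hψ hc
  rw [inner_sub_left, hu ψ hψ hc, hw ψ hψ hc, sub_zero]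

/-- Smooth compactly supported divergence-free fields. -/
structure SolTest (ψ : Space n → Space n) : Prop where
  smooth : ContDiff ℝ ∞ ψ
  compact : HasCompactSupport ψ
  div : ∀ x, divergence ψ x = 0

theorem SolTest.memLp {ψ : Space n → Space n} (h : SolTest ψ) : MemLp ψ 2 volume :=
  memLp_of_hasCompactSupport h.smooth.continuous h.compact 2

theorem divergence_add {f g : Space n → Space n} (hf : ContDiff ℝ ∞ f) (hg : ContDiff ℝ ∞ g)
    (x : Space n) : divergence (f + g) x = divergence f x + divergence g x := by
  simp only [divergence, partialD, ← Finset.sum_add_distrib]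
  rw [fderiv_add (hf.differentiable (by simp) x) (hg.differentiable (by simp) x)]
  rfl

theorem divergence_const_smul (c : ℝ) {f : Space n → Space n} (hf : ContDiff ℝ ∞ f)
    (x : Space n) : divergence (c • f) x = c * divergence f x := by
  simp only [divergence, partialD, Finset.mul_sum]
  rw [fderiv_const_smul (hf.differentiable (by simp) x)]
  rfl

theorem SolTest.add {f g : Space n → Space n} (hf : SolTest f) (hg : SolTest g) :
    SolTest (f + g) :=
  ⟨hf.smooth.add hg.smooth, hf.compact.add hg.compact, fun x => by
    rw [divergence_add hf.smooth hg.smooth, hf.div, hg.div, add_zero]⟩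

theorem SolTest.const_smul {f : Space n → Space n} (hf : SolTest f) (c : ℝ) : SolTest (c • f) :=
  ⟨contDiff_const.smul hf.smooth, hf.compact.smul_left (f := fun _ => c), fun x => by
    rw [divergence_const_smul c hf.smooth, hf.div, mul_zero]⟩

/-- The test fields, as a subspace of `L²`. -/
def solTestSpace (n : ℕ) : Submodule ℝ (L2Field n) where
  carrier := {u | ∃ ψ, SolTest ψ ∧ u =ᵐ[volume] ψ}
  zero_mem' := ⟨0, ⟨contDiff_const, HasCompactSupport.zero, fun x => by simp [divergence, partialD]⟩,
    Lp.coeFn_zero _ _ _⟩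
  add_mem' := by
    rintro u w ⟨f, hf, hu⟩ ⟨g, hg, hw⟩
    exact ⟨f + g, hf.add hg, (Lp.coeFn_add u w).trans (hu.add hw)⟩
  smul_mem' := by
    rintro c u ⟨f, hf, hu⟩
    exact ⟨c • f, hf.const_smul c, (Lp.coeFn_smul c u).trans (hu.const_smul c)⟩

/-- The solenoidal fields: the closure of the test fields in `L²`. -/
def solSpace (n : ℕ) : Submodule ℝ (L2Field n) := (solTestSpace n).topologicalClosure

theorem SolTest.toLp_mem {ψ : Space n → Space n} (h : SolTest ψ) :
    h.memLp.toLp ψ ∈ solTestSpace n := ⟨ψ, h, h.memLp.coeFn_toLp⟩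

theorem integral_fderiv_apply_eq_zero_of_hasCompactSupport {a : Space n → Space n}
    {f : Space n → ℝ} (ha : ContDiff ℝ ∞ a) (hf : ContDiff ℝ ∞ f) (hdiv : ∀ x, divergence a x = 0)
    (hc : HasCompactSupport f) : ∫ x, fderiv ℝ f x (a x) = 0 := by
  have ha' := ha.continuous_fderiv (by simp)
  have hf' := hf.continuous_fderiv (by simp)
  have c1 : HasCompactSupport (fun x => ‖f x‖) := hc.norm
  have c2 : HasCompactSupport (fun x => ‖fderiv ℝ f x‖) := (hc.fderiv ℝ).norm
  exact integral_fderiv_apply_eq_zero ha hf hdiv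
    ((ha.continuous.norm.mul hf.continuous.norm).integrable_of_hasCompactSupport c1.mul_left)
    ((ha.continuous.norm.mul hf'.norm).integrable_of_hasCompactSupport c2.mul_left)
    ((ha'.norm.mul hf.continuous.norm).integrable_of_hasCompactSupport c1.mul_left)

theorem weaklyDivFree_of_mem_solTestSpace {u : L2Field n} (hu : u ∈ solTestSpace n) :
    WeaklyDivFree u := by
  obtain ⟨ψ, hψ, h⟩ := hu
  intro χ hχ hc
  simp only [sum_mul_partialD]
  rw [← integral_fderiv_apply_eq_zero_of_hasCompactSupport hψ.smooth hχ hψ.div hc]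
  refine integral_congr_ae ?_
  filter_upwards [h] with x hx
  rw [hx]

theorem weaklyDivFree_of_mem_solSpace {u : L2Field n} (hu : u ∈ solSpace n) : WeaklyDivFree u :=
  closure_minimal (fun _ => weaklyDivFree_of_mem_solTestSpace) isClosed_weaklyDivFree hu

theorem partialD_comm {ζ : Space n → ℝ} (hζ : ContDiff ℝ ∞ ζ) (i j : Fin n) (x : Space n) :
    partialD i (partialD j ζ) x = partialD j (partialD i ζ) x := by
  have hd : DifferentiableAt ℝ (fderiv ℝ ζ) x :=
    (hζ.fderiv_right (m := ∞) (by simp)).differentiable (by simp) x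
  have e : ∀ k l : Fin n, partialD k (partialD l ζ) x
      = fderiv ℝ (fderiv ℝ ζ) x (EuclideanSpace.single k 1) (EuclideanSpace.single l 1) := by
    intro k l
    have := hd.hasFDerivAt.clm_apply (hasFDerivAt_const (EuclideanSpace.single l (1 : ℝ)) x)
    change fderiv ℝ (fun y => fderiv ℝ ζ y (EuclideanSpace.single l 1)) x _ = _
    rw [this.fderiv]
    simp
  rw [e, e]
  exact ((contDiff_infty.1 hζ 2).contDiffAt.isSymmSndFDerivAt (by simp)) _ _

/-- The rotation field `∂_j ζ e_i - ∂_i ζ e_j`. -/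
theorem solTest_rotation {ζ : Space n → ℝ} (hζ : ContDiff ℝ ∞ ζ) (hc : HasCompactSupport ζ)
    (i j : Fin n) : SolTest fun y => partialD j ζ y • EuclideanSpace.single i (1 : ℝ)
      + (-1 : ℝ) • partialD i ζ y • EuclideanSpace.single j (1 : ℝ) := by
  have hs : ∀ i j : Fin n, ContDiff ℝ ∞ fun y => partialD j ζ y • EuclideanSpace.single i (1 : ℝ) :=
    fun i j => ContDiff.fun_smul (partialD_contDiff hζ j)
      (contDiff_const (c := EuclideanSpace.single i (1 : ℝ)))
  have hd : ∀ (i j : Fin n) x, divergence (fun y => partialD j ζ y • EuclideanSpace.single i (1 : ℝ)) x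
      = partialD i (partialD j ζ) x := by
    intro i j x
    have h := ((partialD_contDiff hζ j).differentiable (by simp) x).hasFDerivAt.smul_const
      (EuclideanSpace.single i (1 : ℝ))
    simp only [divergence]
    rw [Finset.sum_eq_single i]
    · rw [partialD, h.fderiv]; simp [partialD]
    · intro k _ hk
      rw [partialD, h.fderiv]; simp [hk]
    · simp
  refine ⟨(hs i j).add ((hs j i).const_smul (-1 : ℝ)), ?_, fun x => ?_⟩
  · exact ((partialD_hasCompactSupport hc j).smul_right).add
      (((partialD_hasCompactSupport hc i).smul_right).smul_left (f := fun _ => (-1 : ℝ)))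
  · have h1 := divergence_add (hs i j) ((hs j i).const_smul (-1 : ℝ)) x
    have h2 := divergence_const_smul (-1) (hs j i) x
    refine h1.trans ((congrArg _ h2).trans ?_)
    rw [hd, hd, partialD_comm hζ]
    ring

theorem norm_clm_le_sum {G : Type*} [NormedAddCommGroup G] [NormedSpace ℝ G]
    (L : Space n →L[ℝ] G) : ‖L‖ ≤ ∑ i, ‖L (EuclideanSpace.single i 1)‖ := by
  refine L.opNorm_le_bound (Finset.sum_nonneg fun _ _ => norm_nonneg _) fun u => ?_
  conv_lhs => rw [← sum_smul_single u, map_sum]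
  refine (norm_sum_le _ _).trans ?_
  rw [Finset.sum_mul]
  refine Finset.sum_le_sum fun i _ => ?_
  rw [map_smul, norm_smul, mul_comm]
  exact mul_le_mul_of_nonneg_left (PiLp.norm_apply_le u i) (norm_nonneg _)

theorem memLp_conv {η : Space n → ℝ} (hη : ContDiff ℝ ∞ η) (hc : HasCompactSupport η)
    (u : L2Field n) : MemLp (conv η u) 2 volume :=
  (memLp_congr_ae (moll_ae hη.continuous hc u)).1 (Lp.memLp _)

theorem memLp_fderiv_conv {η : Space n → ℝ} (hη : ContDiff ℝ ∞ η) (hc : HasCompactSupport η)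
    (u : L2Field n) : MemLp (fderiv ℝ (conv η u)) 2 volume := by
  have h : ∀ i, MemLp (fun x => ‖partialD i (conv η u) x‖) 2 volume := fun i => by
    rw [partialD_conv hη hc (locallyIntegrable_L2 u)]
    exact (memLp_conv (partialD_contDiff hη i) (partialD_hasCompactSupport hc i) u).norm
  refine (memLp_finsetSum Finset.univ fun i _ => h i).mono
    (fderiv_conv_continuous hη hc u).aestronglyMeasurable (Eventually.of_forall fun x => ?_)
  refine (norm_clm_le_sum _).trans ?_
  exact le_abs_self _

theorem integrable_norm_mul_norm {α E F : Type*} [MeasurableSpace α] {μ : Measure α}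
    [NormedAddCommGroup E] [NormedAddCommGroup F] {f : α → E} {g : α → F} (hf : MemLp f 2 μ)
    (hg : MemLp g 2 μ) : Integrable (fun x => ‖f x‖ * ‖g x‖) μ :=
  hf.norm.integrable_mul hg.norm

/-- A solenoidal field orthogonal to all test fields vanishes. -/
theorem eq_zero_of_weaklyDivFree_of_orthogonal (hn : 0 < n) {q : L2Field n} (hq : WeaklyDivFree q)
    (ho : ∀ u ∈ solTestSpace n, inner ℝ u q = 0) : q = 0 := by
  have key : ∀ {η : Space n → ℝ} (hη : ContDiff ℝ ∞ η) (hc : HasCompactSupport η) (x : Space n),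
      conv η q x = 0 := by
    intro η hη hc
    set a := conv η q with ha
    have has : ContDiff ℝ ∞ a := conv_contDiff hη hc (locallyIntegrable_L2 q)
    have hpc : ∀ i, partialD i a = conv (partialD i η) q := fun i =>
      partialD_conv hη hc (locallyIntegrable_L2 q) i
    -- Orthogonality to the rotation field built from `ζ = η (x - ·)` says precisely that `η ⋆ q`
    -- has no curl at `x`.
    have hcurl : ∀ i j x, partialD i a x j = partialD j a x i := by
      intro i j x
      have hζ : ContDiff ℝ ∞ fun z => η (x - z) := hη.comp (contDiff_const.sub contDiff_id)
      have hζc := hasCompactSupport_comp_sub hc x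
      have hψ := solTest_rotation hζ hζc i j
      have h := ho _ hψ.toLp_mem
      rw [L2.inner_def] at h
      have e : ∫ y, inner ℝ ((hψ.memLp.toLp _) y) (q y)
          = ∫ y, (partialD i η (x - y) * q y j - partialD j η (x - y) * q y i) := by
        refine integral_congr_ae ?_
        filter_upwards [hψ.memLp.coeFn_toLp] with y hy
        rw [hy]
        simp only [partialD_comp_sub hη, inner_add_left, inner_smul_left,
          EuclideanSpace.inner_single_left]
        simp
        ring
      have hi : ∀ i j, Integrable (fun y => partialD i η (x - y) * q y j) volume := fun i j =>
        integrable_mul_coord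
          (((partialD_contDiff hη i).continuous).comp (continuous_const.sub continuous_id))
          (hasCompactSupport_comp_sub (partialD_hasCompactSupport hc i) x) q j
      rw [e, integral_sub (hi i j) (hi j i)] at h
      rw [hpc, hpc, conv_apply_coord (partialD_contDiff hη i) (partialD_hasCompactSupport hc i),
        conv_apply_coord (partialD_contDiff hη j) (partialD_hasCompactSupport hc j)]
      linarith
    -- A Liouville argument by energy: `b = ∂_j a` is divergence-free, and `|b|² = ∇a_j · b` since
    -- the curl of `a` vanishes. All the fields are in `L²`, so integration by parts gives `∫ |b|² =
    -- 0`.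
    have hzero : ∀ j x, partialD j a x = 0 := by
      intro j
      set b := partialD j a with hb
      have hbs : ContDiff ℝ ∞ b := partialD_contDiff has j
      have hfs : ContDiff ℝ ∞ fun y => a y j :=
        (EuclideanSpace.proj j : Space n →L[ℝ] ℝ).contDiff.comp has
      have hb2 : MemLp b 2 volume := by
        rw [hb, hpc]
        exact memLp_conv (partialD_contDiff hη j) (partialD_hasCompactSupport hc j) q
      have hb2' : MemLp (fderiv ℝ b) 2 volume := by
        rw [hb, hpc]
        exact memLp_fderiv_conv (partialD_contDiff hη j) (partialD_hasCompactSupport hc j) q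
      have hf2 : MemLp (fun y => a y j) 2 volume :=
        (memLp_conv hη hc q).mono hfs.continuous.aestronglyMeasurable
          (Eventually.of_forall fun x => PiLp.norm_apply_le _ _)
      have hf2' : MemLp (fderiv ℝ fun y => a y j) 2 volume := by
        refine (memLp_fderiv_conv hη hc q).mono
          (hfs.continuous_fderiv (by simp)).aestronglyMeasurable (Eventually.of_forall fun x => ?_)
        refine ContinuousLinearMap.opNorm_le_bound _ (norm_nonneg _) fun e => ?_
        have h : HasFDerivAt (fun y => a y j)
            ((EuclideanSpace.proj j : Space n →L[ℝ] ℝ).comp (fderiv ℝ a x)) x :=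
          (EuclideanSpace.proj j : Space n →L[ℝ] ℝ).hasFDerivAt.comp x
            (has.differentiable (by simp) x).hasFDerivAt
        rw [h.fderiv]
        exact (PiLp.norm_apply_le _ _).trans (ContinuousLinearMap.le_opNorm _ _)
      have hdiv : ∀ x, divergence b x = 0 := fun x => by
        rw [hb, hpc]
        exact divergence_conv (partialD_contDiff hη j) (partialD_hasCompactSupport hc j) hq x
      have h0 := integral_fderiv_apply_eq_zero hbs hfs hdiv (integrable_norm_mul_norm hb2 hf2)
        (integrable_norm_mul_norm hb2 hf2') (integrable_norm_mul_norm hb2' hf2)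
      have e : ∀ x, fderiv ℝ (fun y => a y j) x (b x) = ‖b x‖ ^ 2 := by
        intro x
        rw [← sum_mul_partialD, EuclideanSpace.norm_sq_eq]
        refine Finset.sum_congr rfl fun i _ => ?_
        rw [← partialD_apply_coord has, hcurl i j, Real.norm_eq_abs, sq_abs, sq]
      simp only [e] at h0
      have hint : Integrable (fun x => ‖b x‖ ^ 2) volume := by
        simpa only [sq] using integrable_norm_mul_norm hb2 hb2
      have h1 := (integral_eq_zero_iff_of_nonneg (fun x => by positivity) hint).1 h0
      have h2 := (hbs.continuous.norm.pow 2).ae_eq_iff_eq volume continuous_const |>.1 h1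
      intro x
      exact norm_eq_zero.1 (pow_eq_zero_iff (two_ne_zero)|>.1 (congrFun h2 x))
    have hfd : ∀ x, fderiv ℝ a x = 0 := fun x => by
      refine norm_le_zero_iff.1 ((norm_clm_le_sum _).trans (le_of_eq ?_))
      exact Finset.sum_eq_zero fun i _ => by
        have := hzero i x
        rw [partialD] at this
        rw [this, norm_zero]
    -- A constant field in `L²` of a space of infinite measure is zero; infinite measure is where `0
    -- < n` enters.
    have hconst : a = fun _ => a 0 := funext fun x =>
      is_const_of_fderiv_eq_zero (has.differentiable (by simp)) hfd x 0
    have hm : MemLp (fun _ : Space n => a 0) 2 volume := hconst ▸ memLp_conv hη hc q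
    have : Nonempty (Fin n) := ⟨⟨0, hn⟩⟩
    rw [memLp_const_iff (by simp) (by simp)] at hm
    intro x
    rw [hconst]
    rcases hm with h | h
    · exact h
    · simp [measure_univ_of_isAddLeftInvariant] at h
  have hk : ∀ k, mollify k q = 0 := fun k => by
    refine Lp.ext ?_
    filter_upwards [mollify_ae k q, Lp.coeFn_zero (Space n) 2 (volume : Measure (Space n))]
      with x h1 h2
    rw [h1, h2, key (mol_contDiff k) (mol_hasCompactSupport k)]
    rfl
  have := mollify_tendsto q
  simp only [hk] at this
  exact tendsto_nhds_unique this tendsto_const_nhds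

/-- Weakly divergence-free fields are `L²` limits of divergence-free test fields. -/
theorem mem_solSpace_iff (hn : 0 < n) {u : L2Field n} : u ∈ solSpace n ↔ WeaklyDivFree u := by
  refine ⟨weaklyDivFree_of_mem_solSpace, fun hu => ?_⟩
  have : CompleteSpace (solSpace n) :=
    (Submodule.isClosed_topologicalClosure _).completeSpace_coe
  set p := (solSpace n).starProjection u with hp
  have hpm : p ∈ solSpace n := Submodule.starProjection_apply_mem _ _
  -- The part of `u` orthogonal to `solSpace n` is also weakly divergence-free, so it vanishes by
  -- the preceding theorem.
  have hq : u - p = 0 := by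
    refine eq_zero_of_weaklyDivFree_of_orthogonal hn
      (hu.sub (weaklyDivFree_of_mem_solSpace hpm)) fun w hw => ?_
    exact Submodule.sub_starProjection_mem_orthogonal (K := solSpace n) u w
      (Submodule.le_topologicalClosure _ hw)
  rw [sub_eq_zero] at hq
  rw [hq]
  exact hpm

/-! ### The Helmholtz projection of a divergence-free test field -/

open scoped SchwartzMap LineDeriv in
/-- The Helmholtz projection leaves divergence-free test fields unchanged. -/
theorem SolTest.helmholtz_eq {φ : Space n → Space n} (hφ : SolTest φ) : helmholtz φ = φ := by
  have hs : ∀ k, ContDiff ℝ ∞ fun x => (φ x k : ℂ) := fun k =>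
    Complex.ofRealCLM.contDiff.comp ((EuclideanSpace.proj k : Space n →L[ℝ] ℝ).contDiff.comp hφ.smooth)
  have hc : ∀ k, HasCompactSupport fun x => (φ x k : ℂ) := fun k =>
    hφ.compact.comp_left (g := fun u : Space n => (u k : ℂ)) (by simp)
  let F : Fin n → 𝓢(Space n, ℂ) := fun k => (hc k).toSchwartzMap (hs k)
  have hF : ∀ k, (F k : Space n → ℂ) = fun x => (φ x k : ℂ) := fun k => rfl
  have hdiv : ∑ k, ∂_{(EuclideanSpace.single k (1 : ℝ) : Space n)} (F k) = 0 := by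
    ext x
    have h := hφ.div x
    simp only [sum_apply, SchwartzMap.lineDerivOp_apply_eq_fderiv, hF]
    have e : ∀ k, fderiv ℝ (fun x => (φ x k : ℂ)) x (EuclideanSpace.single k 1)
        = ((partialD k φ x k : ℝ) : ℂ) := by
      intro k
      rw [partialD_apply_coord hφ.smooth]
      have := Complex.ofRealCLM.hasFDerivAt.comp x
        (((EuclideanSpace.proj k : Space n →L[ℝ] ℝ).contDiff.comp hφ.smooth).differentiable
          (by simp) x).hasFDerivAt
      have h2 : HasFDerivAt (fun x => (φ x k : ℂ)) _ x := this
      rw [h2.fderiv]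
      rfl
    simp only [e, ← Complex.ofReal_sum]
    rw [divergence] at h
    simp [h]
  -- The Fourier transform of `div φ = 0` is `2πi ξ · φ̂`, so the correction in the Helmholtz symbol
  -- vanishes, including at `ξ = 0`.
  have hsum : ∀ ξ : Space n, ∑ k, (ξ k : ℂ) * 𝓕 (fun x => (φ x k : ℂ)) ξ = 0 := by
    intro ξ
    have h := congrArg (fun f => SchwartzMap.fourierTransformCLM ℂ f ξ) hdiv
    simp only [map_sum, map_zero, SchwartzMap.fourierTransformCLM_apply, sum_apply,
      SchwartzMap.fourier_lineDerivOp_eq, zero_apply, smul_apply,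
      ← Finset.smul_sum] at h
    have h2 : (2 * Real.pi * Complex.I : ℂ) ≠ 0 := by simp [Real.pi_ne_zero]
    rw [smul_eq_zero_iff_right h2] at h
    rw [← h]
    refine Finset.sum_congr rfl fun k _ => ?_
    have ht : (fun y : Space n => inner ℝ y (EuclideanSpace.single k (1 : ℝ))).HasTemperateGrowth := by
      fun_prop
    rw [SchwartzMap.smulLeftCLM_apply_apply ht, SchwartzMap.fourier_coe, hF]
    simp [EuclideanSpace.inner_single_right]
  have hsymb : ∀ j, helmholtzSymbol φ j = 𝓕 (fun x => (φ x j : ℂ)) := by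
    intro j
    funext ξ
    simp [helmholtzSymbol, hsum]
  funext x
  ext j
  simp only [helmholtz, hsymb]
  rw [Continuous.fourierInv_fourier_eq (hs j).continuous (F j).integrable (𝓕 (F j)).integrable]
  simp

/-! ### Multiplication operators -/

/-- Multiplication of `L²` fields by an essentially bounded field of operators. -/
def mulOp (m : Space n → Space n →L[ℝ] Space n) : L2Field n →L[ℝ] L2Field n :=
  -- The default value `0` makes `mulOp` total in `m`, so `t ↦ mulOp (M t)` can be written without
  -- carrying proofs of boundedness.
  open scoped Classical in
  if h : MemLp m ⊤ volume then
    (ContinuousLinearMap.id ℝ (Space n →L[ℝ] Space n)).holderL volume ⊤ 2 2 h.toLp else 0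

theorem mulOp_eq {m : Space n → Space n →L[ℝ] Space n} (h : MemLp m ⊤ volume) : mulOp m =
    (ContinuousLinearMap.id ℝ (Space n →L[ℝ] Space n)).holderL volume ⊤ 2 2 h.toLp := dif_pos h

theorem mulOp_ae {m : Space n → Space n →L[ℝ] Space n} (h : MemLp m ⊤ volume) (u : L2Field n) :
    mulOp m u =ᵐ[volume] fun x => m x (u x) := by
  rw [mulOp_eq h]
  filter_upwards [(ContinuousLinearMap.id ℝ (Space n →L[ℝ] Space n)).coeFn_holder (r := 2) h.toLp u,
    h.coeFn_toLp] with x h1 h2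
  refine h1.trans ?_
  rw [h2]
  rfl

theorem inner_mulOp {m : Space n → Space n →L[ℝ] Space n} (h : MemLp m ⊤ volume)
    (u f : L2Field n) : inner ℝ u (mulOp m f) = ∫ x, inner ℝ (u x) (m x (f x)) := by
  rw [L2.inner_def]
  refine integral_congr_ae ?_
  filter_upwards [mulOp_ae h f] with x hx
  rw [hx]

theorem integrable_inner_apply {m : Space n → Space n →L[ℝ] Space n} (h : MemLp m ⊤ volume)
    (u f : L2Field n) : Integrable (fun x => inner ℝ (u x) (m x (f x))) volume := by
  refine (L2.integrable_inner (𝕜 := ℝ) u (mulOp m f)).congr ?_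
  filter_upwards [mulOp_ae h f] with x hx
  rw [hx]

theorem norm_mulOp_le {m : Space n → Space n →L[ℝ] Space n} {C : ℝ} (hC : 0 ≤ C)
    (h : ∀ x, ‖m x‖ ≤ C) (u : L2Field n) : ‖mulOp m u‖ ≤ C * ‖u‖ := by
  by_cases hm : MemLp m ⊤ volume
  · refine Lp.norm_le_mul_norm_of_ae_le_mul ?_
    filter_upwards [mulOp_ae hm u] with x hx
    rw [hx]
    exact (m x).le_of_opNorm_le (h x) _
  · rw [mulOp, dif_neg hm]
    simp
    positivity

theorem norm_integral_inner_apply_le {m : Space n → Space n →L[ℝ] Space n} {C : ℝ} (hC : 0 ≤ C)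
    (h : ∀ x, ‖m x‖ ≤ C) (u f : L2Field n) : |inner ℝ u (mulOp m f)| ≤ C * ‖u‖ * ‖f‖ := by
  refine (abs_real_inner_le_norm _ _).trans ?_
  calc ‖u‖ * ‖mulOp m f‖ ≤ ‖u‖ * (C * ‖f‖) := by gcongr; exact norm_mulOp_le hC h f
    _ = _ := by ring

/-! ### The symmetric gradient of a solenoidal field -/

/-- `M` is a bounded field of symmetric operators, and the symmetric gradient of `w`. -/
structure IsSymGradAt (w : L2Field n) (M : Space n → Space n →L[ℝ] Space n) (C : ℝ) : Prop where
  meas : AEStronglyMeasurable M volume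
  nonneg : 0 ≤ C
  bound : ∀ x, ‖M x‖ ≤ C
  -- The distributional identity is recorded after mollification, where `w` has classical
  -- derivatives, and in polarized form, since both the diagonal and the off-diagonal cases are
  -- used.
  grad : ∀ k x p q, inner ℝ p (fderiv ℝ (conv (mol n k) w) x q)
    + inner ℝ q (fderiv ℝ (conv (mol n k) w) x p) = 2 * inner ℝ p (conv (mol n k) M x q)

section SymGrad

variable {w : L2Field n} {M : Space n → Space n →L[ℝ] Space n} {C : ℝ}

theorem IsSymGradAt.memLp (h : IsSymGradAt w M C) : MemLp M ⊤ volume :=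
  memLp_top_of_bound h.meas C (Eventually.of_forall h.bound)

theorem IsSymGradAt.locallyIntegrable (h : IsSymGradAt w M C) : LocallyIntegrable M volume :=
  h.memLp.locallyIntegrable le_top

theorem IsSymGradAt.conv_bound (h : IsSymGradAt w M C) (k : ℕ) (x : Space n) :
    ‖conv (mol n k) M x‖ ≤ C := norm_conv_mol_le h.bound k x

theorem IsSymGradAt.memLp_conv (h : IsSymGradAt w M C) (k : ℕ) :
    MemLp (conv (mol n k) M) ⊤ volume :=
  memLp_top_of_bound (conv_contDiff (mol_contDiff k) (mol_hasCompactSupport k)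
    h.locallyIntegrable).continuous.aestronglyMeasurable C (Eventually.of_forall (h.conv_bound k))

/-- The mollified multipliers converge only almost everywhere, under the uniform bound `C`.
Dominated convergence gives convergence of the pairings for fixed fields, without any convergence in
operator norm. -/
theorem IsSymGradAt.tendsto_inner (h : IsSymGradAt w M C) (u f : L2Field n) :
    Tendsto (fun k => inner ℝ u (mulOp (conv (mol n k) M) f)) atTop
      (𝓝 (inner ℝ u (mulOp M f))) := by
  rw [inner_mulOp h.memLp]
  simp only [inner_mulOp (h.memLp_conv _)]
  refine tendsto_integral_of_dominated_convergence (fun x => C * (‖u x‖ * ‖f x‖))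
    (fun k => (integrable_inner_apply (h.memLp_conv k) u f).aestronglyMeasurable)
    ((integrable_norm_mul_norm (Lp.memLp u) (Lp.memLp f)).const_mul C)
    (fun k => Eventually.of_forall fun x => ?_) ?_
  · refine (norm_inner_le_norm _ _).trans ?_
    calc ‖u x‖ * ‖conv (mol n k) M x (f x)‖ ≤ ‖u x‖ * (C * ‖f x‖) := by
          gcongr; exact ContinuousLinearMap.le_of_opNorm_le _ (h.conv_bound k x) _
      _ = _ := by ring
  · filter_upwards [ae_conv_mol_tendsto h.locallyIntegrable] with x hx
    exact tendsto_const_nhds.inner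
      (((ContinuousLinearMap.apply ℝ (Space n) (f x)).continuous.tendsto _).comp hx)

/-- The operators are uniformly bounded by `C`, so the strong convergence of the mollified argument
can be absorbed. -/
theorem IsSymGradAt.tendsto_inner_mollify (h : IsSymGradAt w M C) (u : L2Field n) :
    Tendsto (fun k => inner ℝ u (mulOp (conv (mol n k) M) (mollify k w))) atTop
      (𝓝 (inner ℝ u (mulOp M w))) := by
  have h0 : Tendsto (fun k => inner ℝ u (mulOp (conv (mol n k) M) (mollify k w - w))) atTop (𝓝 0) := by
    refine squeeze_zero_norm (a := fun k => C * ‖u‖ * ‖mollify k w - w‖)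
      (fun k => norm_integral_inner_apply_le h.nonneg (h.conv_bound k) _ _) ?_
    have := ((mollify_tendsto w).sub_const w).norm.const_mul (C * ‖u‖)
    simpa using this
  have := h0.add (h.tendsto_inner u w)
  simpa only [map_sub, inner_sub_right, sub_add_cancel, zero_add] using this

theorem IsSymGradAt.tendsto_inner_mollify_mollify (h : IsSymGradAt w M C) :
    Tendsto (fun k => inner ℝ (mollify k w) (mulOp (conv (mol n k) M) (mollify k w))) atTop
      (𝓝 (inner ℝ w (mulOp M w))) := by
  have h0 : Tendsto (fun k => inner ℝ (mollify k w - w)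
      (mulOp (conv (mol n k) M) (mollify k w))) atTop (𝓝 0) := by
    refine squeeze_zero_norm (a := fun k => C * ‖mollify k w - w‖ * ‖w‖)
      (fun k => (norm_integral_inner_apply_le h.nonneg (h.conv_bound k) _ _).trans ?_) ?_
    · have := norm_mollify_le k w
      have := h.nonneg
      gcongr
    · have := (((mollify_tendsto w).sub_const w).norm.const_mul C).mul_const ‖w‖
      simpa using this
  have := h0.add (h.tendsto_inner_mollify w)
  simpa only [inner_sub_left, sub_add_cancel, zero_add] using this

/-- `⟨v, ∇(η ⋆ w) v⟩` only involves the symmetric gradient. -/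
theorem IsSymGradAt.inner_mulOp_fderiv (h : IsSymGradAt w M C) (k : ℕ) (v : L2Field n) :
    inner ℝ v (mulOp (fderiv ℝ (conv (mol n k) w)) v)
      = inner ℝ v (mulOp (conv (mol n k) M) v) := by
  rw [inner_mulOp (memLp_top_fderiv_conv (mol_contDiff k) (mol_hasCompactSupport k) w),
    inner_mulOp (h.memLp_conv k)]
  refine integral_congr_ae (Eventually.of_forall fun x => ?_)
  have := h.grad k x (v x) (v x)
  simp only
  linarith

/-- `∫ ⟨w, d(w) w⟩ = 0`. -/
theorem IsSymGradAt.inner_self (h : IsSymGradAt w M C) (hw : WeaklyDivFree w) :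
    inner ℝ w (mulOp M w) = 0 := by
  refine tendsto_nhds_unique h.tendsto_inner_mollify_mollify ?_
  refine tendsto_const_nhds.congr fun k => ?_
  have hη := mol_contDiff (n := n) k
  have hc := mol_hasCompactSupport (n := n) k
  set a := conv (mol n k) w with ha
  have has : ContDiff ℝ ∞ a := conv_contDiff hη hc (locallyIntegrable_L2 w)
  have ha2 : MemLp a 2 volume := Euler.memLp_conv hη hc w
  have ha2' : MemLp (fderiv ℝ a) 2 volume := memLp_fderiv_conv hη hc w
  obtain ⟨K, hK⟩ := exists_norm_conv_le hη.continuous hc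
  have hKa : ∀ x, ‖a x‖ ≤ K * ‖w‖ := hK w
  have hfs : ContDiff ℝ ∞ fun x => ‖a x‖ ^ 2 := has.norm_sq ℝ
  have hfd : ∀ x e, fderiv ℝ (fun x => ‖a x‖ ^ 2) x e = 2 * inner ℝ (a x) (fderiv ℝ a x e) := by
    intro x e
    have := ((has.differentiable (by simp) x).hasFDerivAt).norm_sq
    rw [this.fderiv]
    simp
  have haa := integrable_norm_mul_norm ha2 ha2
  have haa' := integrable_norm_mul_norm ha2 ha2'
  have hfc := hfs.continuous_fderiv (by simp)
  have hac := has.continuous_fderiv (by simp)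
  -- For the smooth field `a`, `⟨a, ∇a a⟩ = a · ∇|a|² / 2` integrates to zero because `a` is
  -- divergence-free. The sup bound on `a` makes the cubic expressions integrable.
  have h0 := integral_fderiv_apply_eq_zero has hfs (divergence_conv hη hc hw)
    ((haa.const_mul (K * ‖w‖)).mono' (by
        have := has.continuous; have := hfs.continuous
        exact (Continuous.aestronglyMeasurable (by fun_prop)))
      (Eventually.of_forall fun x => by
        simp only [norm_mul, norm_norm, norm_pow]
        nlinarith [mul_le_mul_of_nonneg_right (hKa x) (mul_self_nonneg ‖a x‖)]))
    ((haa'.const_mul (2 * (K * ‖w‖))).mono' (by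
        have := has.continuous
        exact (Continuous.aestronglyMeasurable (by fun_prop)))
      (Eventually.of_forall fun x => by
        have h1 : ‖fderiv ℝ (fun x => ‖a x‖ ^ 2) x‖ ≤ 2 * (‖a x‖ * ‖fderiv ℝ a x‖) := by
          refine ContinuousLinearMap.opNorm_le_bound _ (by positivity) fun e => ?_
          rw [hfd, norm_mul, Real.norm_two]
          have := (norm_inner_le_norm (𝕜 := ℝ) (a x) (fderiv ℝ a x e)).trans
            (mul_le_mul_of_nonneg_left ((fderiv ℝ a x).le_opNorm e) (norm_nonneg _))
          linarith
        simp only [norm_mul, norm_norm]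
        refine (mul_le_mul (hKa x) h1 (norm_nonneg _) ((norm_nonneg _).trans (hKa x))).trans
          (le_of_eq (by ring))))
    ((haa'.const_mul (K * ‖w‖)).mono' (by
        have := has.continuous
        exact (Continuous.aestronglyMeasurable (by fun_prop)))
      (Eventually.of_forall fun x => by
        simp only [norm_mul, norm_norm, norm_pow]
        nlinarith [mul_le_mul_of_nonneg_right (hKa x)
          (mul_nonneg (norm_nonneg (a x)) (norm_nonneg (fderiv ℝ a x)))]))
  rw [inner_mulOp (h.memLp_conv k)]
  have h00 : (0 : ℝ) = 1 / 2 * ∫ x, fderiv ℝ (fun x => ‖a x‖ ^ 2) x (a x) := by rw [h0, mul_zero]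
  rw [h00, ← integral_const_mul]
  refine integral_congr_ae ?_
  filter_upwards [mollify_ae k w] with x hx
  rw [hx, hfd]
  have := h.grad k x (a x) (a x)
  rw [← ha] at this ⊢
  linarith

theorem integral_fderiv_apply_eq_zero_of_hasCompactSupport_left {a : Space n → Space n}
    {f : Space n → ℝ} (ha : ContDiff ℝ ∞ a) (hf : ContDiff ℝ ∞ f) (hdiv : ∀ x, divergence a x = 0)
    (hc : HasCompactSupport a) : ∫ x, fderiv ℝ f x (a x) = 0 := by
  have ha' := ha.continuous_fderiv (by simp)
  have hf' := hf.continuous_fderiv (by simp)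
  have c1 : HasCompactSupport (fun x => ‖a x‖) := hc.norm
  have c2 : HasCompactSupport (fun x => ‖fderiv ℝ a x‖) := (hc.fderiv ℝ).norm
  exact integral_fderiv_apply_eq_zero ha hf hdiv
    ((ha.continuous.norm.mul hf.continuous.norm).integrable_of_hasCompactSupport c1.mul_right)
    ((ha.continuous.norm.mul hf'.norm).integrable_of_hasCompactSupport c1.mul_right)
    ((ha'.norm.mul hf.continuous.norm).integrable_of_hasCompactSupport c2.mul_right)

/-- The identity `div (w ⊗ w) = 2 d(w) w - ∇ |w|² / 2` tested with a solenoidal field. -/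
theorem IsSymGradAt.inner_mulOp_test (h : IsSymGradAt w M C) (hw : WeaklyDivFree w)
    {ψ : Space n → Space n} (hψ : SolTest ψ) :
    inner ℝ w (mulOp (fderiv ℝ ψ) w) = -2 * inner ℝ (hψ.memLp.toLp ψ) (mulOp M w) := by
  have hDm : MemLp (fderiv ℝ ψ) ⊤ volume :=
    memLp_of_hasCompactSupport (hψ.smooth.continuous_fderiv (by simp)) (hψ.compact.fderiv ℝ) ⊤
  have l1 : Tendsto (fun k => inner ℝ (mollify k w) (mulOp (fderiv ℝ ψ) (mollify k w))) atTop
      (𝓝 (inner ℝ w (mulOp (fderiv ℝ ψ) w))) :=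
    (mollify_tendsto w).inner (((mulOp (fderiv ℝ ψ)).continuous.tendsto w).comp (mollify_tendsto w))
  have l2 := (h.tendsto_inner_mollify (hψ.memLp.toLp ψ)).const_mul (-2)
  refine tendsto_nhds_unique l1 (l2.congr fun k => ?_)
  have hη := mol_contDiff (n := n) k
  have hc := mol_hasCompactSupport (n := n) k
  set a := conv (mol n k) w with ha
  have has : ContDiff ℝ ∞ a := conv_contDiff hη hc (locallyIntegrable_L2 w)
  have hfs : ContDiff ℝ ∞ fun x => inner ℝ (a x) (ψ x) := has.inner ℝ hψ.smooth
  have hfc : HasCompactSupport fun x => inner ℝ (a x) (ψ x) := by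
    refine hψ.compact.mono fun x hx => ?_
    contrapose! hx
    simp only [Function.mem_support, not_not] at hx
    simp [hx]
  -- Two orthogonalities are combined. From `a ⊥ ∇(a · ψ)` the derivative moves from `ψ` to `a`;
  -- from `ψ ⊥ ∇|a|²` (`h2` below) the transposed term can be added freely. Their sum is the
  -- symmetric gradient.
  have h1 := integral_fderiv_apply_eq_zero_of_hasCompactSupport has hfs (divergence_conv hη hc hw) hfc
  have hd : ∀ x e, fderiv ℝ (fun x => inner ℝ (a x) (ψ x)) x e
      = inner ℝ (a x) (fderiv ℝ ψ x e) + inner ℝ (fderiv ℝ a x e) (ψ x) := fun x e =>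
    fderiv_inner_apply ℝ (has.differentiable (by simp) x) (hψ.smooth.differentiable (by simp) x) e
  have hgs : ContDiff ℝ ∞ fun x => inner ℝ (a x) (a x) := has.inner ℝ has
  have hd' : ∀ x e, fderiv ℝ (fun x => inner ℝ (a x) (a x)) x e
      = inner ℝ (a x) (fderiv ℝ a x e) + inner ℝ (fderiv ℝ a x e) (a x) := fun x e =>
    fderiv_inner_apply ℝ (has.differentiable (by simp) x) (has.differentiable (by simp) x) e
  have h2 := integral_fderiv_apply_eq_zero_of_hasCompactSupport_left hψ.smooth hgs hψ.div hψ.compact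
  have hac := has.continuous_fderiv (by simp)
  have hψc := hψ.smooth.continuous
  have i1 : Integrable (fun x => fderiv ℝ (fun x => inner ℝ (a x) (ψ x)) x (a x)) volume := by
    refine Continuous.integrable_of_hasCompactSupport
      ((hfs.continuous_fderiv (by simp)).clm_apply has.continuous) ?_
    refine (hfc.fderiv ℝ).mono fun x hx => ?_
    contrapose! hx
    simp only [Function.mem_support, not_not] at hx
    simp [hx]
  have i2 : Integrable (fun x => fderiv ℝ (fun x => inner ℝ (a x) (a x)) x (ψ x)) volume := by
    refine Continuous.integrable_of_hasCompactSupport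
      ((hgs.continuous_fderiv (by simp)).clm_apply hψc) ?_
    refine hψ.compact.mono fun x hx => ?_
    contrapose! hx
    simp only [Function.mem_support, not_not] at hx
    simp [hx]
  have i3 := integrable_inner_apply (h.memLp_conv k) (hψ.memLp.toLp ψ) (mollify k w)
  rw [inner_mulOp (h.memLp_conv k), inner_mulOp hDm]
  have e : ∫ x, inner ℝ (mollify k w x) (fderiv ℝ ψ x (mollify k w x))
      = ∫ x, (-2 * inner ℝ (hψ.memLp.toLp ψ x) (conv (mol n k) M x (mollify k w x))
        + fderiv ℝ (fun x => inner ℝ (a x) (ψ x)) x (a x)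
          + 1 / 2 * fderiv ℝ (fun x => inner ℝ (a x) (a x)) x (ψ x)) := by
    refine integral_congr_ae ?_
    filter_upwards [mollify_ae k w, hψ.memLp.coeFn_toLp] with x hx hx'
    rw [hx, hx', hd, hd']
    have := h.grad k x (ψ x) (a x)
    rw [← ha] at this ⊢
    rw [real_inner_comm (ψ x) (fderiv ℝ a x (a x)),
      real_inner_comm (a x) (fderiv ℝ a x (ψ x))] at *
    linarith
  rw [e, integral_add ((i3.const_mul _).fun_add i1) (i2.const_mul _), integral_add (i3.const_mul _) i1,
    integral_const_mul, integral_const_mul, h1, h2]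
  ring

end SymGrad

/-! ### Test functions with separated variables, and the equations in integral form -/

theorem isTest_smul {F : Type*} [NormedAddCommGroup F] [NormedSpace ℝ F] {I : Set ℝ} {θ : ℝ → ℝ}
    {ψ : Space n → F} (hθ : ContDiff ℝ ∞ θ) (hθc : HasCompactSupport θ) (hθI : tsupport θ ⊆ I)
    (hψ : ContDiff ℝ ∞ ψ) (hc : HasCompactSupport ψ) :
    IsTest (I ×ˢ univ) fun z : ℝ × Space n => θ z.1 • ψ z.2 := by
  have hsub : tsupport (fun z : ℝ × Space n => θ z.1 • ψ z.2) ⊆ tsupport θ ×ˢ tsupport ψ := by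
    refine closure_minimal (fun z hz => ?_) ((isClosed_tsupport _).prod (isClosed_tsupport _))
    refine ⟨subset_tsupport _ fun h => hz ?_, subset_tsupport _ fun h => hz ?_⟩ <;> simp [h]
  refine ⟨(hθ.comp contDiff_fst).smul (hψ.comp contDiff_snd), ?_, fun z hz => ?_⟩
  · exact (hθc.isCompact.prod hc.isCompact).of_isClosed_subset (isClosed_tsupport _) hsub
  · exact ⟨hθI (hsub hz).1, mem_univ _⟩

theorem integral_norm_sq (u : L2Field n) : ∫ x, ‖u x‖ ^ 2 = ‖u‖ ^ 2 := by
  rw [← real_inner_self_eq_norm_sq, L2.inner_def]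
  simp only [real_inner_self_eq_norm_sq]

/-- The integral of `(θ a)'` for an absolutely continuous `a`. The boundary term at `0` is kept,
since it is the one that identifies the initial datum. -/
theorem integral_deriv_mul_add_mul {T : ℝ} (hT : 0 < T) {a c θ : ℝ → ℝ} {a₀ : ℝ}
    (hc : IntegrableOn c (Ioo 0 T)) (ha : ∀ t ∈ Icc 0 T, a t = a₀ + ∫ s in 0..t, c s)
    (hθ : ContDiff ℝ ∞ θ) (hθT : θ T = 0) :
    ∫ t in Ioo 0 T, (deriv θ t * a t + θ t * c t) = -(θ 0 * a₀) := by
  have hci : IntervalIntegrable c volume 0 T := by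
    rwa [intervalIntegrable_iff_integrableOn_Ioo_of_le hT.le]
  have hd : Continuous (deriv θ) := hθ.continuous_deriv (by simp)
  have hCc : ContinuousOn (fun x => ∫ s in 0..x, c s) (Icc 0 T) := by
    have := intervalIntegral.continuousOn_primitive_interval' hci left_mem_uIcc
    rwa [uIcc_of_le hT.le] at this
  have i1 : IntegrableOn (fun t => deriv θ t * a₀) (Ioo 0 T) :=
    ((hd.mul continuous_const).integrableOn_Icc).mono_set Ioo_subset_Icc_self
  have i2 : IntegrableOn (fun t => deriv θ t * ∫ s in 0..t, c s) (Ioo 0 T) :=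
    ((hd.continuousOn.mul hCc).integrableOn_Icc).mono_set Ioo_subset_Icc_self
  have i3 : IntegrableOn (fun t => θ t * c t) (Ioo 0 T) := by
    have := hci.continuousOn_mul hθ.continuous.continuousOn
    rwa [intervalIntegrable_iff_integrableOn_Ioo_of_le hT.le] at this
  have e : ∫ t in Ioo 0 T, (deriv θ t * a t + θ t * c t)
      = ∫ t in Ioo 0 T, (deriv θ t * a₀ + (deriv θ t * ∫ s in 0..t, c s) + θ t * c t) :=
    setIntegral_congr_fun measurableSet_Ioo fun t ht => by
      simp only [ha t (Ioo_subset_Icc_self ht)]; ring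
  have h0 : ∫ t in Ioo 0 T, deriv θ t = θ T - θ 0 := by
    rw [← integral_Ioc_eq_integral_Ioo, ← intervalIntegral.integral_of_le hT.le]
    exact intervalIntegral.integral_deriv_eq_sub (fun x _ => hθ.differentiable (by simp) x)
      (hd.intervalIntegrable _ _)
  rw [e, integral_add (i1.fun_add i2) i3, integral_add i1 i2, integral_mul_const, h0,
    integral_mul_eq_sub_integral_deriv_mul_primitive hT hθ hc, hθT]
  ring

theorem SolTest.memLp_fderiv {ψ : Space n → Space n} (hψ : SolTest ψ) :
    MemLp (fderiv ℝ ψ) ⊤ volume :=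
  memLp_of_hasCompactSupport (hψ.smooth.continuous_fderiv (by simp)) (hψ.compact.fderiv ℝ) ⊤

theorem SolTest.inner_toLp {ψ : Space n → Space n} (hψ : SolTest ψ) (u : L2Field n) :
    inner ℝ u (hψ.memLp.toLp ψ) = ∫ x, inner ℝ (u x) (ψ x) := by
  rw [L2.inner_def]
  refine integral_congr_ae ?_
  filter_upwards [hψ.memLp.coeFn_toLp] with x hx
  rw [hx]

theorem SolTest.integrable_inner {ψ : Space n → Space n} (hψ : SolTest ψ) (u : L2Field n) :
    Integrable (fun x => inner ℝ (u x) (ψ x)) volume := by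
  refine (L2.integrable_inner (𝕜 := ℝ) u (hψ.memLp.toLp ψ)).congr ?_
  filter_upwards [hψ.memLp.coeFn_toLp] with x hx
  rw [hx]

/-- The space integral in the weak formulation, for a test field with separated variables. -/
theorem SolTest.integral_weak {ψ : Space n → Space n} (hψ : SolTest ψ) {θ : ℝ → ℝ}
    (hθ : ContDiff ℝ ∞ θ) (u : L2Field n) (t : ℝ) :
    ∫ x, (inner ℝ (u x) (deriv (fun s => θ s • ψ x) t)
      + inner ℝ (u x) (fderiv ℝ (fun y => θ t • ψ y) x (u x)))
      = deriv θ t * inner ℝ u (hψ.memLp.toLp ψ) + θ t * inner ℝ u (mulOp (fderiv ℝ ψ) u) := by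
  have e1 : ∀ x, deriv (fun s => θ s • ψ x) t = deriv θ t • ψ x := fun x =>
    ((hθ.differentiable (by simp) t).hasDerivAt.smul_const (ψ x)).deriv
  have e2 : ∀ x, fderiv ℝ (fun y => θ t • ψ y) x = θ t • fderiv ℝ ψ x := fun x =>
    ((hψ.smooth.differentiable (by simp) x).hasFDerivAt.const_smul (θ t)).fderiv
  simp only [e1, e2, smul_apply, inner_smul_right]
  rw [integral_add ((hψ.integrable_inner u).const_mul _)
    ((integrable_inner_apply hψ.memLp_fderiv u u).const_mul _), integral_const_mul,
    integral_const_mul, hψ.inner_toLp, inner_mulOp hψ.memLp_fderiv]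

theorem SolTest.divergence_smul {ψ : Space n → Space n} (hψ : SolTest ψ) (c : ℝ) (x : Space n) :
    divergence (fun y => c • ψ y) x = 0 := (hψ.const_smul c).div x

instance : SecondCountableTopology (L2Field n) :=
  have : Fact ((2 : ENNReal) ≠ ⊤) := ⟨by norm_num⟩
  Lp.SecondCountableTopology

theorem WeaklyContinuous.aestronglyMeasurable {T : ℝ} {v : ℝ → L2Field n}
    (hv : WeaklyContinuous T v) : AEStronglyMeasurable v (volume.restrict (Icc 0 T)) :=
  aestronglyMeasurable_of_inner fun f => (hv f).aemeasurable measurableSet_Icc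

theorem integrableOn_inner_clm {T K : ℝ} {u : ℝ → L2Field n}
    (hu : AEStronglyMeasurable u (volume.restrict (Ioo 0 T))) (hK : ∀ t ∈ Ioo 0 T, ‖u t‖ ≤ K)
    (A : L2Field n →L[ℝ] L2Field n) : IntegrableOn (fun t => inner ℝ (u t) (A (u t))) (Ioo 0 T) := by
  refine Integrable.mono' (g := fun _ => K * (‖A‖ * K)) (integrable_const _)
    (hu.inner (A.continuous.comp_aestronglyMeasurable hu)) ?_
  refine (ae_restrict_iff' measurableSet_Ioo).2 (Eventually.of_forall fun t ht => ?_)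
  have h0 : 0 ≤ K := (norm_nonneg _).trans (hK t ht)
  refine (norm_inner_le_norm _ _).trans (mul_le_mul (hK t ht) ?_ (norm_nonneg _) h0)
  exact (A.le_opNorm _).trans (mul_le_mul_of_nonneg_left (hK t ht) (norm_nonneg _))

/-! ### Consequences of the weak formulation for `v` -/

section EulerFlow

variable {T : ℝ} {v₀ : L2Field n} {v : ℝ → L2Field n}

/-- The pairing with each gradient is continuous in time, so vanishing at almost every time becomes
vanishing at every time. -/
theorem IsWeakSolution.weaklyDivFree (hT : 0 < T) (hv : IsWeakSolution T v₀ v)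
    (hvc : WeaklyContinuous T v) {t : ℝ} (ht : t ∈ Icc 0 T) : WeaklyDivFree (v t) := by
  rw [weaklyDivFree_iff]
  intro ψ hψ hc
  refine eqOn_Icc_of_ae_Ioo hT (hvc (gradL ψ hψ hc)) (continuousOn_const (c := 0)) ?_ ht
  filter_upwards [hv.divFree] with s hs
  exact weaklyDivFree_iff.1 hs ψ hψ hc

/-- The weak formulation with separated variables. -/
theorem IsWeakSolution.momentum_separated (hv : IsWeakSolution T v₀ v)
    {ψ : Space n → Space n} (hψ : SolTest ψ) {θ : ℝ → ℝ} (hθ : ContDiff ℝ ∞ θ)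
    (hθc : HasCompactSupport θ) (hθT : tsupport θ ⊆ Iio T) :
    (∫ t in Ioo 0 T, (deriv θ t * inner ℝ (v t) (hψ.memLp.toLp ψ)
      + θ t * inner ℝ (v t) (mulOp (fderiv ℝ ψ) (v t))))
      + θ 0 * inner ℝ v₀ (hψ.memLp.toLp ψ) = 0 := by
  have h := hv.momentum (fun z => θ z.1 • ψ z.2)
    (isTest_smul hθ hθc hθT hψ.smooth hψ.compact) (fun t _ x => hψ.divergence_smul (θ t) x)
  simp only [hψ.integral_weak hθ, inner_smul_right, integral_const_mul, ← hψ.inner_toLp] at h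
  exact h

/-- The momentum equation integrated in time. -/
theorem IsWeakSolution.inner_eq (hT : 0 < T) (hv : IsWeakSolution T v₀ v)
    (hvc : WeaklyContinuous T v) {K : ℝ} (hK : ∀ t ∈ Ioo 0 T, ‖v t‖ ≤ K)
    {ψ : Space n → Space n} (hψ : SolTest ψ) {t : ℝ} (ht : t ∈ Icc 0 T) :
    inner ℝ (v t) (hψ.memLp.toLp ψ) = inner ℝ (v 0) (hψ.memLp.toLp ψ)
      + ∫ s in 0..t, inner ℝ (v s) (mulOp (fderiv ℝ ψ) (v s)) := by
  have hvm := hvc.aestronglyMeasurable.mono_measure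
    (Measure.restrict_mono (Ioo_subset_Icc_self (a := (0 : ℝ)) (b := T)) le_rfl)
  refine eq_add_integral_of_forall_integral_deriv_mul hT (hvc _)
    (integrableOn_inner_clm hvm hK _) (fun θ h1 h2 h3 => ?_) ht
  have h := hv.momentum_separated hψ h1 h2 fun s hs => (h3 hs).2
  have h0 : θ 0 = 0 := image_eq_zero_of_notMem_tsupport fun hh => lt_irrefl _ (h3 hh).1
  rwa [h0, zero_mul, add_zero] at h

/-- A time cutoff equal to 1 at `0` sees `v₀` in the weak formulation and `v 0` in the integrated
equation. Hence `v 0 - v₀` is orthogonal to all solenoidal test fields; being solenoidal itself, it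
is zero. -/
theorem IsWeakSolution.initial (hn : 0 < n) (hT : 0 < T) (hv₀ : WeaklyDivFree v₀)
    (hv : IsWeakSolution T v₀ v) (hvc : WeaklyContinuous T v) {K : ℝ}
    (hK : ∀ t ∈ Ioo 0 T, ‖v t‖ ≤ K) : v 0 = v₀ := by
  have hvm := hvc.aestronglyMeasurable.mono_measure
    (Measure.restrict_mono (Ioo_subset_Icc_self (a := (0 : ℝ)) (b := T)) le_rfl)
  rw [← sub_eq_zero]
  refine eq_zero_of_weaklyDivFree_of_orthogonal hn
    ((hv.weaklyDivFree hT hvc (left_mem_Icc.2 hT.le)).sub hv₀) fun u hu => ?_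
  obtain ⟨ψ, hψ, hu⟩ := hu
  have hu' : u = hψ.memLp.toLp ψ := Lp.ext (hu.trans hψ.memLp.coeFn_toLp.symm)
  -- Equal to 1 near `0` and supported in `[-T/2, T/2]`, hence strictly before `T`.
  let χ : ContDiffBump (0 : ℝ) := ⟨T / 3, T / 2, by linarith, by linarith⟩
  have hχT : tsupport χ ⊆ Iio T := by
    rw [χ.tsupport_eq, Real.closedBall_eq_Icc]
    intro x hx
    have : x ≤ 0 + T / 2 := hx.2
    exact lt_of_le_of_lt this (by linarith)
  have hχ0 : χ 0 = 1 := χ.one_of_mem_closedBall (by simp [χ]; linarith)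
  have h := hv.momentum_separated hψ χ.contDiff χ.hasCompactSupport hχT
  rw [integral_deriv_mul_add_mul hT (integrableOn_inner_clm hvm hK _)
    (fun t ht => hv.inner_eq hT hvc hK hψ ht) χ.contDiff
    (image_eq_zero_of_notMem_tsupport fun hh => lt_irrefl T (hχT hh)), hχ0] at h
  rw [hu', real_inner_comm, inner_sub_left]
  linarith

theorem IsWeakSolution.distribDivFree (hv : IsWeakSolution T v₀ v) : DistribDivFree T v := by
  intro ψ hψ
  refine (integral_congr_ae ?_).trans (integral_zero _ _)
  filter_upwards [hv.divFree] with t ht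
  refine ht (fun y => ψ (t, y)) (hψ.smooth.comp (contDiff_const.prodMk contDiff_id)) ?_
  refine hψ.compact.comp_isClosedEmbedding (g := fun y => (t, y)) ?_
  exact (Isometry.of_dist_eq fun x y => by simp [Prod.dist_eq]).isClosedEmbedding

end EulerFlow

/-! ### Time-integrated equations for the comparison field `w` -/

section Strong

variable {T : ℝ} {w e : ℝ → L2Field n}

theorem weaklyContinuous_of_continuousOn (hw : ContinuousOn w (Icc 0 T)) : WeaklyContinuous T w :=
  fun _ => hw.inner continuousOn_const

/-- Test functions `θ(t) ψ(x)` localize the condition in time, first at almost every time for a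
fixed `ψ`. Continuity of `w` then gives every time. -/
theorem DistribDivFree.weaklyDivFree (hT : 0 < T) (hw : ContinuousOn w (Icc 0 T))
    (hd : DistribDivFree T w) {t : ℝ} (ht : t ∈ Icc 0 T) : WeaklyDivFree (w t) := by
  rw [weaklyDivFree_iff]
  intro ψ hψ hc
  have hcont : ContinuousOn (fun s => inner ℝ (w s) (gradL ψ hψ hc)) (Icc 0 T) :=
    hw.inner continuousOn_const
  refine eqOn_Icc_of_ae_Ioo hT hcont (continuousOn_const (c := 0)) ?_ ht
  refine (ae_restrict_iff' measurableSet_Ioo).2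
    (isOpen_Ioo (a := (0 : ℝ)) (b := T) |>.ae_eq_zero_of_integral_contDiff_smul_eq_zero
    ((hcont.mono Ioo_subset_Icc_self).locallyIntegrableOn measurableSet_Ioo) fun θ h1 h2 h3 => ?_)
  have h := hd (fun z => θ z.1 • ψ z.2) (isTest_smul h1 h2 h3 hψ hc)
  rw [← setIntegral_eq_integral_of_forall_compl_eq_zero (s := Ioo 0 T) fun x hx => by
    rw [image_eq_zero_of_notMem_tsupport fun h => hx (h3 h), zero_smul]]
  refine Eq.trans ?_ h
  refine setIntegral_congr_fun (measurableSet_Ioo (a := (0 : ℝ)) (b := T)) fun s _ => ?_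
  simp only [inner_gradL, smul_eq_mul, ← integral_const_mul]
  refine integral_congr_ae (Eventually.of_forall fun x => ?_)
  simp only [Finset.mul_sum]
  refine Finset.sum_congr rfl fun i _ => ?_
  have : partialD i (fun y => θ s * ψ y) x = θ s * partialD i ψ x := by
    have := ((hψ.differentiable (by simp) x).hasFDerivAt.const_mul (θ s))
    rw [partialD, this.fderiv]
    rfl
  rw [this]
  ring

/-- The equation for `w`, integrated in time. -/
theorem IsDefect.inner_eq (hT : 0 < T) (hw : ContinuousOn w (Icc 0 T)) (he : IsDefect T w e)
    (hei : IntegrableOn e (Ioo 0 T)) {K : ℝ} (hK : ∀ t ∈ Ioo 0 T, ‖w t‖ ≤ K)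
    {ψ : Space n → Space n} (hψ : SolTest ψ) {t : ℝ} (ht : t ∈ Icc 0 T) :
    inner ℝ (w t) (hψ.memLp.toLp ψ) = inner ℝ (w 0) (hψ.memLp.toLp ψ)
      + ∫ s in 0..t, (inner ℝ (w s) (mulOp (fderiv ℝ ψ) (w s))
        - inner ℝ (e s) (hψ.memLp.toLp ψ)) := by
  have hwc := weaklyContinuous_of_continuousOn hw
  have hwm := hwc.aestronglyMeasurable.mono_measure
    (Measure.restrict_mono (Ioo_subset_Icc_self (a := (0 : ℝ)) (b := T)) le_rfl)
  have hci := integrableOn_inner_clm hwm hK (mulOp (fderiv ℝ ψ))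
  have hei' : IntegrableOn (fun s => inner ℝ (e s) (hψ.memLp.toLp ψ)) (Ioo 0 T) := hei.inner_const _
  refine eq_add_integral_of_forall_integral_deriv_mul hT (hwc _) (hci.fun_sub hei')
    (fun θ h1 h2 h3 => ?_) ht
  have h := he (fun z => θ z.1 • ψ z.2) (isTest_smul h1 h2 h3 hψ.smooth hψ.compact)
  -- The projection in the definition of the defect disappears because `θ s • ψ` is solenoidal.
  have hP : ∀ s, helmholtz (fun y => θ s • ψ y) = fun y => θ s • ψ y := fun s =>
    (hψ.const_smul (θ s)).helmholtz_eq
  simp only [hP, hψ.integral_weak h1, inner_smul_right, integral_const_mul, ← hψ.inner_toLp] at h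
  have hmul : ∀ {k : ℝ → ℝ}, IntegrableOn k (Ioo 0 T) →
      IntegrableOn (fun s => θ s * k s) (Ioo 0 T) := fun {k} hk => by
    obtain ⟨C, hC⟩ := h1.continuous.bounded_above_of_compact_support h2
    exact hk.bdd_mul (c := C) h1.continuous.aestronglyMeasurable (Eventually.of_forall hC)
  have hdi : IntegrableOn (fun s => deriv θ s * inner ℝ (w s) (hψ.memLp.toLp ψ)) (Ioo 0 T) :=
    (((h1.continuous_deriv (by simp)).continuousOn.mul (hwc _)).integrableOn_Icc).mono_set
      Ioo_subset_Icc_self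
  rw [integral_add hdi (hmul hci)] at h
  have hs : IntegrableOn (fun s => θ s * inner ℝ (w s) (mulOp (fderiv ℝ ψ) (w s))
      - θ s * inner ℝ (e s) (hψ.memLp.toLp ψ)) (Ioo 0 T) := (hmul hci).sub (hmul hei')
  simp only [mul_sub]
  rw [integral_add hdi hs, integral_sub (hmul hci) (hmul hei'), h]
  ring

end Strong

section MatrixField

open scoped Pointwise Matrix

/-! ### Matrix fields -/

/-- The elementary operator `u ↦ u_j e_i`. -/
def elemOp (i j : Fin n) : Space n →L[ℝ] Space n :=
  (EuclideanSpace.proj j : Space n →L[ℝ] ℝ).smulRight (EuclideanSpace.single i (1 : ℝ))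

/-- The operator on `ℝⁿ` with the given matrix. -/
def matOp (M : Matrix (Fin n) (Fin n) ℝ) : Space n →L[ℝ] Space n := ∑ i, ∑ j, M i j • elemOp i j

theorem inner_elemOp (i j : Fin n) (p q : Space n) : inner ℝ p (elemOp i j q) = p i * q j := by
  simp only [elemOp, ContinuousLinearMap.smulRight_apply, inner_smul_right,
    EuclideanSpace.inner_single_right]
  simp [mul_comm]

theorem inner_matOp (M : Matrix (Fin n) (Fin n) ℝ) (p q : Space n) :
    inner ℝ p (matOp M q) = ∑ i, ∑ j, M i j * (p i * q j) := by
  simp only [matOp, sum_apply, inner_sum, smul_apply, inner_smul_right, inner_elemOp]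

theorem norm_elemOp_le (i j : Fin n) : ‖(elemOp i j : Space n →L[ℝ] Space n)‖ ≤ 1 := by
  refine ContinuousLinearMap.opNorm_le_bound _ zero_le_one fun u => ?_
  simp only [elemOp, ContinuousLinearMap.smulRight_apply, norm_smul]
  rw [show ‖(EuclideanSpace.single i (1 : ℝ) : Space n)‖ = 1 by simp, mul_one, one_mul]
  exact PiLp.norm_apply_le u j

theorem norm_matOp_le {M : Matrix (Fin n) (Fin n) ℝ} {C : ℝ} (h : ∀ i j, |M i j| ≤ C) :
    ‖matOp M‖ ≤ n * (n * C) := by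
  refine (norm_sum_le _ _).trans ?_
  have : ∀ i : Fin n, ‖∑ j, M i j • (elemOp i j : Space n →L[ℝ] Space n)‖ ≤ n * C := fun i => by
    refine (norm_sum_le _ _).trans ?_
    have : ∀ j : Fin n, ‖M i j • (elemOp i j : Space n →L[ℝ] Space n)‖ ≤ C := fun j => by
      rw [norm_smul]
      exact (mul_le_of_le_one_right (norm_nonneg _) (norm_elemOp_le i j)).trans (h i j)
    refine (Finset.sum_le_sum fun j _ => this j).trans ?_
    simp
  refine (Finset.sum_le_sum fun j _ => this j).trans ?_
  simp

theorem negPartMinEigenvalue_nonneg (M : Matrix (Fin n) (Fin n) ℝ) : 0 ≤ negPartMinEigenvalue M :=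
  le_max_right _ _

/-- The variational characterization of the negative part of the smallest eigenvalue. -/
theorem negPartMinEigenvalue_le_iff (hn : 0 < n) {M : Matrix (Fin n) (Fin n) ℝ}
    (hM : ∀ i j, M i j = M j i) {c : ℝ} (hc : 0 ≤ c) :
    negPartMinEigenvalue M ≤ c ↔ ∀ q : Space n, -inner ℝ q (matOp M q) ≤ c * ‖q‖ ^ 2 := by
  have hH : M.IsHermitian := Matrix.IsHermitian.ext fun i j => by simp [hM i j]
  have : Nonempty (Fin n) := ⟨⟨0, hn⟩⟩
  have hfin : (spectrum ℝ M).Finite := by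
    rw [hH.spectrum_real_eq_range_eigenvalues]; exact finite_range _
  have hne : (spectrum ℝ M).Nonempty := by
    rw [hH.spectrum_real_eq_range_eigenvalues]; exact range_nonempty _
  have hH' : (M + algebraMap ℝ _ c).IsHermitian := by
    refine hH.add ?_
    rw [Matrix.algebraMap_eq_diagonal]
    exact Matrix.isHermitian_diagonal _
  -- For `c ≥ 0` the bound says that the spectrum of `M + c` is nonnegative, that is, that `M + c`
  -- is positive semidefinite.
  have h1 : negPartMinEigenvalue M ≤ c ↔ ∀ l ∈ spectrum ℝ M, 0 ≤ c + l := by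
    rw [negPartMinEigenvalue, max_le_iff, and_iff_left hc, neg_le]
    constructor
    · intro h l hl
      linarith [csInf_le hfin.bddBelow hl]
    · intro h
      refine le_csInf hne fun l hl => ?_
      linarith [h l hl]
  have h2 : (∀ l ∈ spectrum ℝ M, 0 ≤ c + l) ↔ (M + algebraMap ℝ _ c).PosSemidef := by
    rw [hH'.posSemidef_iff_eigenvalues_nonneg]
    have hr := hH'.spectrum_real_eq_range_eigenvalues
    rw [← spectrum.add_singleton_eq] at hr
    rw [Pi.le_def]
    constructor
    · intro h i
      have : hH'.eigenvalues i ∈ spectrum ℝ M + {c} := by rw [hr]; exact mem_range_self i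
      rw [Set.add_singleton] at this
      obtain ⟨l, hl, he⟩ := this
      simp only at he
      rw [← he, Pi.zero_apply]
      linarith [h l hl]
    · intro h l hl
      have : l + c ∈ spectrum ℝ M + {c} := Set.add_mem_add hl rfl
      rw [hr] at this
      obtain ⟨i, hi⟩ := this
      have := h i
      rw [hi, Pi.zero_apply] at this
      linarith
  rw [h1, h2, Matrix.posSemidef_iff_dotProduct_mulVec, and_iff_right hH']
  have e : ∀ q : Space n, star (WithLp.ofLp q) ⬝ᵥ ((M + algebraMap ℝ _ c) *ᵥ (WithLp.ofLp q))
      = inner ℝ q (matOp M q) + c * ‖q‖ ^ 2 := by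
    intro q
    rw [Matrix.add_mulVec, dotProduct_add, inner_matOp, EuclideanSpace.norm_sq_eq]
    congr 1
    · simp only [dotProduct, Matrix.mulVec, Finset.mul_sum, Pi.star_apply, star_trivial]
      refine Finset.sum_congr rfl fun i _ => Finset.sum_congr rfl fun j _ => by ring
    · rw [Matrix.algebraMap_eq_diagonal, Finset.mul_sum]
      simp only [dotProduct, Matrix.mulVec_diagonal, Pi.star_apply, star_trivial]
      refine Finset.sum_congr rfl fun i _ => ?_
      simp
      ring
  constructor
  · intro h q
    have := h (WithLp.ofLp q)
    rw [e] at this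
    linarith
  · intro h q
    have h3 := h (WithLp.toLp 2 q)
    have h4 := e (WithLp.toLp 2 q)
    simp only at h4
    rw [h4]
    linarith

/-- By the variational characterization, a sublevel set is cut out by countably many inequalities
that are linear in the entries, one for each vector of a dense sequence. -/
theorem measurable_negPartMinEigenvalue {α : Type*} [MeasurableSpace α] (hn : 0 < n)
    {S : α → Matrix (Fin n) (Fin n) ℝ} (hS : ∀ i j, Measurable fun z => S z i j)
    (hsymm : ∀ z i j, S z i j = S z j i) : Measurable fun z => negPartMinEigenvalue (S z) := by
  refine measurable_of_Iic fun c => ?_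
  rcases lt_or_ge c 0 with hc | hc
  · convert MeasurableSet.empty
    ext z
    simp only [mem_preimage, mem_Iic, mem_empty_iff_false, iff_false, not_le]
    exact hc.trans_le (negPartMinEigenvalue_nonneg _)
  · obtain ⟨d, hd⟩ := TopologicalSpace.exists_dense_seq (Space n)
    have : (fun z => negPartMinEigenvalue (S z)) ⁻¹' Iic c
        = ⋂ k, {z | -inner ℝ (d k) (matOp (S z) (d k)) ≤ c * ‖d k‖ ^ 2} := by
      ext z
      simp only [mem_preimage, mem_Iic, mem_iInter, mem_ofPred_eq]
      rw [negPartMinEigenvalue_le_iff hn (hsymm z) hc]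
      refine ⟨fun h k => h (d k), fun h q => ?_⟩
      have hcl : IsClosed {q : Space n | -inner ℝ q (matOp (S z) q) ≤ c * ‖q‖ ^ 2} :=
        isClosed_le (by fun_prop) (by fun_prop)
      have hsub := hcl.closure_subset_iff.2 (range_subset_iff.2 h)
      rw [hd.closure_range] at hsub
      exact hsub (mem_univ q)
    rw [this]
    refine MeasurableSet.iInter fun k => measurableSet_le ?_ measurable_const
    simp only [inner_matOp]
    fun_prop

/-- The norm is at most `c` exactly when the slice of `{|F| > c}` is null, and the measure of a
slice depends measurably on `t`. -/
theorem measurable_eLpNorm_top {F : ℝ × Space n → ℝ} (hF : Measurable F) :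
    Measurable fun t => eLpNorm (fun x => F (t, x)) ⊤ (volume : Measure (Space n)) := by
  refine measurable_of_Iic fun c => ?_
  have : (fun t => eLpNorm (fun x => F (t, x)) ⊤ (volume : Measure (Space n))) ⁻¹' Iic c
      = {t | volume (Prod.mk t ⁻¹' {z : ℝ × Space n | c < ‖F z‖ₑ}) = 0} := by
    ext t
    simp only [mem_preimage, mem_Iic, mem_ofPred_eq, eLpNorm_exponent_top, eLpNormEssSup]
    have : (∀ᵐ x, ‖F (t, x)‖ₑ ≤ c) ↔ volume (Prod.mk t ⁻¹' {z : ℝ × Space n | c < ‖F z‖ₑ}) = 0 := by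
      rw [ae_iff]
      simp only [not_le]
      rfl
    rw [← this]
    exact ⟨fun h => (ENNReal.ae_le_essSup _).mono fun x hx => hx.trans h, fun h => essSup_le_of_ae_le _ h⟩
  rw [this]
  exact (measurable_measure_prodMk_left (measurableSet_lt measurable_const hF.enorm))
    (measurableSet_singleton 0)

end MatrixField

/-! ### Time slices of the symmetric gradient -/

/-- A function in `L¹_t L^∞_x` has a measurable representative with a pointwise bound. -/
theorem exists_bounded_representative {T : ℝ} {d : ℝ × Space n → ℝ}
    (hd : AEStronglyMeasurable d ((volume.restrict (Ioo 0 T)).prod (volume : Measure (Space n))))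
    (hfin : ∫⁻ t in Ioo 0 T, eLpNorm (fun x => d (t, x)) ⊤ volume < ⊤) :
    ∃ (d' : ℝ × Space n → ℝ) (m : ℝ → ℝ), Measurable d' ∧ IntegrableOn m (Ioo 0 T) ∧
      (∀ z, |d' z| ≤ m z.1) ∧
      ∀ᵐ t ∂(volume.restrict (Ioo 0 T)), ∀ᵐ x, d (t, x) = d' (t, x) := by
  set d₁ := hd.mk d with hd₁
  have hm₁ : Measurable d₁ := hd.stronglyMeasurable_mk.measurable
  have hs : ∀ᵐ t ∂(volume.restrict (Ioo 0 T)), ∀ᵐ x, d (t, x) = d₁ (t, x) :=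
    Measure.ae_ae_of_ae_prod hd.ae_eq_mk
  have hN := measurable_eLpNorm_top hm₁
  have hfin₁ : ∫⁻ t in Ioo 0 T, eLpNorm (fun x => d₁ (t, x)) ⊤ volume ≠ ⊤ := by
    rw [← lintegral_congr_ae (hs.mono fun t ht => eLpNorm_congr_ae ht)]
    exact hfin.ne
  set m : ℝ → ℝ := fun t => (eLpNorm (fun x => d₁ (t, x)) ⊤ volume).toReal with hm
  have hmm : Measurable m := hN.ennreal_toReal
  have hm0 : ∀ t, 0 ≤ m t := fun t => ENNReal.toReal_nonneg
  -- Truncation to `[-m, m]` turns the almost everywhere bound into a bound at every point. Where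
  -- the norm is infinite, `toReal` makes `m` zero and the truncation destroys `d₁`, but only for a
  -- null set of times.
  refine ⟨fun z => max (-m z.1) (min (m z.1) (d₁ z)), m, by fun_prop,
    integrable_toReal_of_lintegral_ne_top hN.aemeasurable hfin₁, fun z => ?_, ?_⟩
  · have := hm0 z.1
    rw [abs_le]
    exact ⟨le_max_left _ _, max_le (by linarith) (min_le_left _ _)⟩
  · filter_upwards [hs, ae_lt_top hN hfin₁] with t h1 h2
    filter_upwards [h1, ENNReal.ae_le_essSup fun x => ‖d₁ (t, x)‖ₑ] with x h3 h4
    have h5 : |d₁ (t, x)| ≤ m t := by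
      have := ENNReal.toReal_mono h2.ne h4
      simpa [hm, eLpNorm_exponent_top] using this
    rw [abs_le] at h5
    rw [h3, min_eq_right h5.2, max_eq_right h5.1]

theorem locallyIntegrable_bounded_slice {d' : ℝ × Space n → ℝ} {m : ℝ → ℝ} (hd : Measurable d')
    (hb : ∀ z, |d' z| ≤ m z.1) (t : ℝ) : LocallyIntegrable (fun x => d' (t, x)) volume :=
  (memLp_top_of_bound (hd.comp measurable_prodMk_left).aestronglyMeasurable (m t)
    (Eventually.of_forall fun x => hb (t, x))).locallyIntegrable le_top

/-- The field `∂_i ψ e_j + ∂_j ψ e_i`. -/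
def symField (ψ : Space n → ℝ) (i j : Fin n) (x : Space n) : Space n :=
  partialD i ψ x • EuclideanSpace.single j (1 : ℝ) + partialD j ψ x • EuclideanSpace.single i (1 : ℝ)

theorem memLp_symField {ψ : Space n → ℝ} (hψ : ContDiff ℝ ∞ ψ) (hc : HasCompactSupport ψ)
    (i j : Fin n) : MemLp (symField ψ i j) 2 volume := by
  refine memLp_of_hasCompactSupport ?_ ?_ 2
  · exact ((partialD_contDiff hψ i).continuous.smul continuous_const).add
      ((partialD_contDiff hψ j).continuous.smul continuous_const)
  · exact (partialD_hasCompactSupport hc i).smul_right.add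
      (partialD_hasCompactSupport hc j).smul_right

theorem inner_symField {ψ : Space n → ℝ} (hψ : ContDiff ℝ ∞ ψ) (hc : HasCompactSupport ψ)
    (i j : Fin n) (u : L2Field n) : inner ℝ u ((memLp_symField hψ hc i j).toLp _)
      = ∫ x, (u x j * partialD i ψ x + u x i * partialD j ψ x) := by
  rw [L2.inner_def]
  refine integral_congr_ae ?_
  filter_upwards [(memLp_symField hψ hc i j).coeFn_toLp] with x hx
  rw [hx, symField]
  simp only [inner_add_right, inner_smul_right, EuclideanSpace.inner_single_right]
  simp
  ring

/-- The symmetric gradient at almost every time, tested with a fixed function. -/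
theorem IsSymGrad.slice {T : ℝ} {w : ℝ → L2Field n}
    {D : ℝ × Space n → Matrix (Fin n) (Fin n) ℝ} (hw : ContinuousOn w (Icc 0 T))
    (hD : IsSymGrad T w D) {d' : ℝ × Space n → ℝ} {m : ℝ → ℝ} {i j : Fin n} (hd : Measurable d')
    (hb : ∀ z, |d' z| ≤ m z.1) (hm : IntegrableOn m (Ioo 0 T))
    (hdD : ∀ᵐ t ∂(volume.restrict (Ioo 0 T)), ∀ᵐ x, D (t, x) i j = d' (t, x))
    {ψ : Space n → ℝ} (hψ : ContDiff ℝ ∞ ψ) (hc : HasCompactSupport ψ) :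
    ∀ᵐ t ∂(volume.restrict (Ioo 0 T)), ∫ x, d' (t, x) * ψ x
      = -(1 / 2) * ∫ x, (w t x j * partialD i ψ x + w t x i * partialD j ψ x) := by
  have hψi : Integrable ψ volume := hψ.continuous.integrable_of_hasCompactSupport hc
  have hcont : ContinuousOn (fun t => inner ℝ (w t) ((memLp_symField hψ hc i j).toLp _)) (Icc 0 T) :=
    hw.inner continuousOn_const
  have i1 : IntegrableOn (fun t => ∫ x, d' (t, x) * ψ x) (Ioo 0 T) := by
    refine Integrable.mono' (hm.mul_const (∫ x, ‖ψ x‖)) ?_ (Eventually.of_forall fun t => ?_)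
    · have : StronglyMeasurable fun z : ℝ × Space n => d' z * ψ z.2 :=
        (hd.mul (hψ.continuous.measurable.comp measurable_snd)).stronglyMeasurable
      exact this.integral_prod_right.aestronglyMeasurable
    · rw [← integral_const_mul]
      refine norm_integral_le_of_norm_le (hψi.norm.const_mul _) (Eventually.of_forall fun x => ?_)
      rw [norm_mul]
      exact mul_le_mul_of_nonneg_right (hb (t, x)) (norm_nonneg _)
  have i2 : IntegrableOn (fun t => 1 / 2 * inner ℝ (w t) ((memLp_symField hψ hc i j).toLp _))
      (Ioo 0 T) := ((continuousOn_const.mul hcont).integrableOn_Icc).mono_set Ioo_subset_Icc_self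
  have key : ∀ᵐ t, t ∈ Ioo 0 T → (∫ x, d' (t, x) * ψ x)
      + 1 / 2 * inner ℝ (w t) ((memLp_symField hψ hc i j).toLp _) = 0 := by
    refine isOpen_Ioo.ae_eq_zero_of_integral_contDiff_smul_eq_zero
      ((i1.add i2).locallyIntegrableOn) fun θ h1 h2 h3 => ?_
    have h := hD i j (fun z => θ z.1 • ψ z.2) (isTest_smul h1 h2 h3 hψ hc)
    rw [← setIntegral_eq_integral_of_forall_compl_eq_zero (s := Ioo 0 T) fun x hx => by
      rw [image_eq_zero_of_notMem_tsupport fun h => hx (h3 h), zero_smul]]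
    obtain ⟨C, hC⟩ := h1.continuous.bounded_above_of_compact_support h2
    have hmul : ∀ {k : ℝ → ℝ}, IntegrableOn k (Ioo 0 T) →
        IntegrableOn (fun s => θ s * k s) (Ioo 0 T) := fun {k} hk =>
      hk.bdd_mul (c := C) h1.continuous.aestronglyMeasurable (Eventually.of_forall hC)
    have e1 : ∫ t in Ioo 0 T, ∫ x, D (t, x) i j * (θ t • ψ x)
        = ∫ t in Ioo 0 T, θ t * ∫ x, d' (t, x) * ψ x := by
      refine integral_congr_ae ?_
      filter_upwards [hdD] with t ht
      rw [← integral_const_mul]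
      refine integral_congr_ae ?_
      filter_upwards [ht] with x hx
      rw [hx, smul_eq_mul]
      ring
    have e2 : ∀ t, ∫ x, (w t x j * partialD i (fun y => θ t • ψ y) x
        + w t x i * partialD j (fun y => θ t • ψ y) x)
        = θ t * inner ℝ (w t) ((memLp_symField hψ hc i j).toLp _) := by
      intro t
      rw [inner_symField hψ hc, ← integral_const_mul]
      refine integral_congr_ae (Eventually.of_forall fun x => ?_)
      have : ∀ i, partialD i (fun y => θ t • ψ y) x = θ t * partialD i ψ x := fun i => by
        have h : HasFDerivAt (fun y => θ t • ψ y) (θ t • fderiv ℝ ψ x) x :=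
          (hψ.differentiable (by simp) x).hasFDerivAt.const_smul (θ t)
        rw [partialD, h.fderiv]
        rfl
      simp only [this]
      ring
    simp only [e2] at h
    rw [e1] at h
    simp only [smul_eq_mul, mul_add]
    rw [integral_add (hmul i1) (hmul i2), h, ← integral_const_mul,
      ← integral_add ((hmul (hcont.integrableOn_Icc.mono_set Ioo_subset_Icc_self)).const_mul _)
        (hmul i2)]
    refine (integral_congr_ae (Eventually.of_forall fun t => ?_)).trans (integral_zero _ _)
    ring
  refine (ae_restrict_iff' measurableSet_Ioo).2 (key.mono fun t h1 h2 => ?_)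
  have := h1 h2
  rw [inner_symField hψ hc] at this
  linarith

/-- The mollified symmetric gradient at almost every time. -/
theorem IsSymGrad.conv_slice {T : ℝ} {w : ℝ → L2Field n}
    {D : ℝ × Space n → Matrix (Fin n) (Fin n) ℝ} (hw : ContinuousOn w (Icc 0 T))
    (hD : IsSymGrad T w D) {d' : ℝ × Space n → ℝ} {m : ℝ → ℝ} {i j : Fin n} (hd : Measurable d')
    (hb : ∀ z, |d' z| ≤ m z.1) (hm : IntegrableOn m (Ioo 0 T))
    (hdD : ∀ᵐ t ∂(volume.restrict (Ioo 0 T)), ∀ᵐ x, D (t, x) i j = d' (t, x)) :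
    ∀ᵐ t ∂(volume.restrict (Ioo 0 T)), ∀ k x, conv (mol n k) (fun y => d' (t, y)) x
      = 1 / 2 * (partialD i (conv (mol n k) (w t)) x j + partialD j (conv (mol n k) (w t)) x i) := by
  -- Countably many kernels and centres give one null set of times; continuity in `x` then covers
  -- all centres.
  obtain ⟨p, hp⟩ := TopologicalSpace.exists_dense_seq (Space n)
  have hs : ∀ k x, ContDiff ℝ ∞ fun z => mol n k (x - z) := fun k x =>
    (mol_contDiff k).comp (contDiff_const.sub contDiff_id)
  have h : ∀ᵐ t ∂(volume.restrict (Ioo 0 T)), ∀ k l, _ := ae_all_iff.2 fun k => ae_all_iff.2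
    fun l => hD.slice hw hd hb hm hdD (hs k (p l))
      (hasCompactSupport_comp_sub (mol_hasCompactSupport k) (p l))
  filter_upwards [h] with t ht k
  have hη := mol_contDiff (n := n) k
  have hc := mol_hasCompactSupport (n := n) k
  have hlhs : Continuous (conv (mol n k) fun y => d' (t, y)) :=
    (conv_contDiff hη hc (locallyIntegrable_bounded_slice hd hb t)).continuous
  have hpd : ∀ i, Continuous (partialD i (conv (mol n k) (w t))) := fun i =>
    (partialD_contDiff (conv_contDiff hη hc (locallyIntegrable_L2 (w t))) i).continuous
  have hrhs : Continuous fun x => 1 / 2 * (partialD i (conv (mol n k) (w t)) x j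
      + partialD j (conv (mol n k) (w t)) x i) := by
    have := hpd i
    have := hpd j
    fun_prop
  refine fun x => congrFun (hp.equalizer hlhs hrhs (funext fun l => ?_)) x
  simp only [Function.comp_apply]
  have hi : ∀ i j, Integrable (fun y => partialD i (mol n k) (p l - y) * w t y j) volume :=
    fun i j => integrable_mul_coord
      ((partialD_contDiff hη i).continuous.comp (continuous_const.sub continuous_id))
      (hasCompactSupport_comp_sub (partialD_hasCompactSupport hc i) (p l)) (w t) j
  have e1 : conv (mol n k) (fun y => d' (t, y)) (p l) = ∫ y, d' (t, y) * mol n k (p l - y) := by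
    rw [conv_apply]
    refine integral_congr_ae (Eventually.of_forall fun y => ?_)
    simp only [smul_eq_mul, mul_comm]
  rw [e1, ht k l, partialD_conv hη hc (locallyIntegrable_L2 _),
    partialD_conv hη hc (locallyIntegrable_L2 _),
    conv_apply_coord (partialD_contDiff hη i) (partialD_hasCompactSupport hc i),
    conv_apply_coord (partialD_contDiff hη j) (partialD_hasCompactSupport hc j),
    ← integral_add (hi i j) (hi j i), ← integral_const_mul, ← integral_const_mul]
  refine integral_congr_ae (Eventually.of_forall fun y => ?_)
  simp only [partialD_comp_sub hη]
  ring

/-- A jointly measurable representative, as a field of operators, of the symmetric gradient. -/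
structure SymGradField (T : ℝ) (w : ℝ → L2Field n) (D : ℝ × Space n → Matrix (Fin n) (Fin n) ℝ)
    (M : ℝ → Space n → Space n →L[ℝ] Space n) (m : ℝ → ℝ) : Prop where
  meas : StronglyMeasurable fun z : ℝ × Space n => M z.1 z.2
  integrable : IntegrableOn m (Ioo 0 T)
  nonneg : ∀ t, 0 ≤ m t
  bound : ∀ t x, ‖M t x‖ ≤ m t
  symm : ∀ t x p q, inner ℝ p (M t x q) = inner ℝ q (M t x p)
  symGrad : ∀ᵐ t ∂(volume.restrict (Ioo 0 T)), IsSymGradAt (w t) (M t) (m t)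
  dMinus_meas : AEStronglyMeasurable (dMinusNorm D) (volume.restrict (Ioo 0 T))
  dMinus_le : ∀ᵐ t ∂(volume.restrict (Ioo 0 T)), dMinusNorm D t ≤ m t
  lower : ∀ᵐ t ∂(volume.restrict (Ioo 0 T)), ∀ z : L2Field n,
    -inner ℝ z (mulOp (M t) z) ≤ dMinusNorm D t * ‖z‖ ^ 2

theorem exists_symGradField (hn : 0 < n) {T : ℝ} {w : ℝ → L2Field n}
    {D : ℝ × Space n → Matrix (Fin n) (Fin n) ℝ} (hw : ContinuousOn w (Icc 0 T))
    (hD : IsSymGrad T w D) (hDm : MemL1Linfty T D) : ∃ M m, SymGradField T w D M m := by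
  choose d m₀ hd hm₀ hb hdD using fun i j =>
    exists_bounded_representative (hDm.aemeas i j) (hDm.finite i j)
  set m₁ : ℝ → ℝ := fun t => ∑ i, ∑ j, m₀ i j t with hm₁
  have hm₀0 : ∀ i j t, 0 ≤ m₀ i j t := fun i j t => (abs_nonneg _).trans (hb i j (t, 0))
  have hm₁0 : ∀ t, 0 ≤ m₁ t := fun t =>
    Finset.sum_nonneg fun i _ => Finset.sum_nonneg fun j _ => hm₀0 i j t
  have hle : ∀ i j t, m₀ i j t ≤ m₁ t := fun i j t =>
    (Finset.single_le_sum (fun j _ => hm₀0 i j t) (Finset.mem_univ j)).trans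
      (Finset.single_le_sum (f := fun i => ∑ j, m₀ i j t)
        (fun i _ => Finset.sum_nonneg fun j _ => hm₀0 i j t) (Finset.mem_univ i))
  -- Symmetrized so that symmetry holds at every point, as the variational characterization
  -- requires.
  set S : ℝ × Space n → Matrix (Fin n) (Fin n) ℝ := fun z =>
    Matrix.of fun i j => (d i j z + d j i z) / 2 with hS
  have hSm : ∀ i j, Measurable fun z => S z i j := fun i j => by
    have := hd i j
    have := hd j i
    simp only [hS, Matrix.of_apply]
    fun_prop
  have hSs : ∀ z i j, S z i j = S z j i := fun z i j => by simp only [hS, Matrix.of_apply, add_comm]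
  have hSb : ∀ z i j, |S z i j| ≤ m₁ z.1 := fun z i j => by
    have h1 := abs_le.1 ((hb i j z).trans (hle i j z.1))
    have h2 := abs_le.1 ((hb j i z).trans (hle j i z.1))
    simp only [hS, Matrix.of_apply]
    exact abs_le.2 ⟨by linarith [h1.1, h2.1], by linarith [h1.2, h2.2]⟩
  set m : ℝ → ℝ := fun t => n * (n * m₁ t) with hm
  have hm0 : ∀ t, 0 ≤ m t := fun t => by have := hm₁0 t; positivity
  have hMb : ∀ z, ‖matOp (S z)‖ ≤ m z.1 := fun z => norm_matOp_le (hSb z)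
  have hconv : ∀ᵐ t ∂(volume.restrict (Ioo 0 T)), ∀ i j k x, _ := ae_all_iff.2 fun i =>
    ae_all_iff.2 fun j => hD.conv_slice hw (hd i j) (hb i j) (hm₀ i j) (hdD i j)
  have hdD' : ∀ᵐ t ∂(volume.restrict (Ioo 0 T)), ∀ i j, _ := ae_all_iff.2 fun i =>
    ae_all_iff.2 fun j => hdD i j
  -- The mollified entries are symmetric in `i` and `j` by `ht`, and so are their almost everywhere
  -- limits; the symmetrization therefore changes nothing almost everywhere.
  have hdS : ∀ᵐ t ∂(volume.restrict (Ioo 0 T)), ∀ᵐ x, ∀ i j, d i j (t, x) = S (t, x) i j := by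
    filter_upwards [hconv] with t ht
    have : ∀ᵐ x, ∀ i j, Tendsto (fun k => conv (mol n k) (fun y => d i j (t, y)) x) atTop
        (𝓝 (d i j (t, x))) := ae_all_iff.2 fun i => ae_all_iff.2 fun j =>
      ae_conv_mol_tendsto (locallyIntegrable_bounded_slice (hd i j) (hb i j) t)
    filter_upwards [this] with x hx i j
    have h1 := hx i j
    have h2 := hx j i
    simp only [ht] at h1 h2
    have : d i j (t, x) = d j i (t, x) :=
      tendsto_nhds_unique h1 (h2.congr fun k => by ring)
    simp only [hS, Matrix.of_apply]
    linarith
  have hDS : ∀ᵐ t ∂(volume.restrict (Ioo 0 T)), ∀ᵐ x, D (t, x) = S (t, x) := by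
    filter_upwards [hdS, hdD'] with t h1 h2
    have h2' : ∀ᵐ x, ∀ i j, D (t, x) i j = d i j (t, x) :=
      ae_all_iff.2 fun i => ae_all_iff.2 fun j => h2 i j
    filter_upwards [h1, h2'] with x h3 h4
    ext i j
    rw [h4, h3]
  have hNm := measurable_negPartMinEigenvalue hn hSm hSs
  have hdm : ∀ᵐ t ∂(volume.restrict (Ioo 0 T)), dMinusNorm D t
      = (eLpNorm (fun x => negPartMinEigenvalue (S (t, x))) ⊤ volume).toReal := by
    filter_upwards [hDS] with t ht
    rw [dMinusNorm, eLpNorm_congr_ae]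
    filter_upwards [ht] with x hx
    rw [hx]
  have hNb : ∀ z, ‖negPartMinEigenvalue (S z)‖ ≤ m z.1 := fun z => by
    rw [Real.norm_of_nonneg (negPartMinEigenvalue_nonneg _),
      negPartMinEigenvalue_le_iff hn (hSs z) (hm0 _)]
    intro q
    refine (neg_le_abs _).trans ((abs_real_inner_le_norm _ _).trans ?_)
    calc ‖q‖ * ‖matOp (S z) q‖ ≤ ‖q‖ * (m z.1 * ‖q‖) := by
          gcongr; exact ContinuousLinearMap.le_of_opNorm_le _ (hMb z) _
      _ = _ := by ring
  have hNe : ∀ t, eLpNorm (fun x => negPartMinEigenvalue (S (t, x))) ⊤ (volume : Measure (Space n))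
      ≤ ENNReal.ofReal (m t) := fun t => by
    rw [eLpNorm_exponent_top]
    exact eLpNormEssSup_le_of_ae_bound (Eventually.of_forall fun x => hNb (t, x))
  have hMeas : StronglyMeasurable fun z : ℝ × Space n => matOp (S z) := by
    simp only [matOp]
    refine Finset.stronglyMeasurable_fun_sum _ fun i _ =>
      Finset.stronglyMeasurable_fun_sum _ fun j _ => ?_
    exact (hSm i j).stronglyMeasurable.smul_const _
  refine ⟨fun t x => matOp (S (t, x)), m, hMeas, ?_, hm0, fun t x => hMb (t, x), ?_,
    ?_, ?_, ?_, ?_⟩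
  · refine ((integrable_finsetSum _ fun i _ => integrable_finsetSum _ fun j _ =>
      hm₀ i j).const_mul _).const_mul _
  · intro t x p q
    rw [inner_matOp, inner_matOp, Finset.sum_comm]
    refine Finset.sum_congr rfl fun i _ => Finset.sum_congr rfl fun j _ => ?_
    rw [hSs _ j i]
    ring
  · filter_upwards [hconv, hdS] with t ht htS
    refine ⟨(hMeas.comp_measurable measurable_prodMk_left).aestronglyMeasurable, hm0 t,
      fun x => hMb (t, x), fun k x p q => ?_⟩
    have hη := mol_contDiff (n := n) k
    have hc := mol_hasCompactSupport (n := n) k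
    have hli : LocallyIntegrable (fun y => matOp (S (t, y))) volume :=
      (memLp_top_of_bound (hMeas.comp_measurable measurable_prodMk_left).aestronglyMeasurable (m t)
        (Eventually.of_forall fun x => hMb (t, x))).locallyIntegrable le_top
    have hci := conv_integrable hη hc hli x
    have e1 : inner ℝ p (conv (mol n k) (fun y => matOp (S (t, y))) x q)
        = ∑ i, ∑ j, conv (mol n k) (fun y => d i j (t, y)) x * (p i * q j) := by
      rw [conv_apply, ← ContinuousLinearMap.apply_apply q, ← ContinuousLinearMap.integral_comp_comm _ hci,
        ← integral_inner ((ContinuousLinearMap.apply ℝ (Space n) q).integrable_comp hci)]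
      simp only [conv_apply, ← integral_mul_const]
      have hij : ∀ i j, Integrable (fun y => mol n k (x - y) • d i j (t, y) * (p i * q j)) volume :=
        fun i j => (conv_integrable hη hc
          (locallyIntegrable_bounded_slice (hd i j) (hb i j) t) x).mul_const _
      simp only [← integral_finsetSum Finset.univ fun j _ => hij _ j]
      rw [← integral_finsetSum _ fun i _ => integrable_finsetSum _ fun j _ => hij i j]
      refine integral_congr_ae ?_
      filter_upwards [htS] with y hy
      rw [ContinuousLinearMap.apply_apply, smul_apply, inner_smul_right, inner_matOp,
        Finset.mul_sum]
      refine Finset.sum_congr rfl fun i _ => ?_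
      rw [Finset.mul_sum]
      refine Finset.sum_congr rfl fun j _ => ?_
      rw [hy, smul_eq_mul, mul_assoc]
    have e2 : ∀ p q : Space n, inner ℝ p (fderiv ℝ (conv (mol n k) (w t)) x q)
        = ∑ i, ∑ j, partialD j (conv (mol n k) (w t)) x i * (p i * q j) := fun p q => by
      conv_lhs => rw [← sum_smul_single q]
      rw [map_sum, inner_sum, Finset.sum_comm]
      refine Finset.sum_congr rfl fun j _ => ?_
      rw [map_smul, inner_smul_right, PiLp.inner_apply, Finset.mul_sum]
      refine Finset.sum_congr rfl fun i _ => ?_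
      rw [partialD]
      simp only [RCLike.inner_apply, conj_trivial]
      ring
    rw [e1, e2 p q, e2 q p, Finset.sum_comm (f := fun i j => _ * (q i * p j)),
      ← Finset.sum_add_distrib, Finset.mul_sum]
    refine Finset.sum_congr rfl fun i _ => ?_
    rw [← Finset.sum_add_distrib, Finset.mul_sum]
    refine Finset.sum_congr rfl fun j _ => ?_
    rw [ht]
    ring
  · refine (measurable_eLpNorm_top hNm).ennreal_toReal.aestronglyMeasurable.congr ?_
    exact hdm.mono fun t ht => ht.symm
  · filter_upwards [hdm] with t ht
    rw [ht]
    exact ENNReal.toReal_le_of_le_ofReal (hm0 t) (hNe t)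
  · filter_upwards [hdm] with t ht z
    have hmem : MemLp (fun x => matOp (S (t, x))) ⊤ volume :=
      memLp_top_of_bound (hMeas.comp_measurable measurable_prodMk_left).aestronglyMeasurable (m t)
        (Eventually.of_forall fun x => hMb (t, x))
    rw [inner_mulOp hmem, ← integral_norm_sq, ← integral_const_mul, ← integral_neg]
    have hz : Integrable (fun x => ‖z x‖ ^ 2) volume := by
      simpa only [sq] using integrable_norm_mul_norm (Lp.memLp z) (Lp.memLp z)
    refine integral_mono_ae (integrable_inner_apply hmem z z).neg (hz.const_mul _) ?_
    -- The Rayleigh bound holds at almost every point with the essential supremum as constant, and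
    -- is then integrated over space.
    filter_upwards [ENNReal.ae_le_essSup fun x => ‖negPartMinEigenvalue (S (t, x))‖ₑ] with x hx
    have h1 : negPartMinEigenvalue (S (t, x)) ≤ dMinusNorm D t := by
      rw [ht]
      have := ENNReal.toReal_mono ((hNe t).trans_lt ENNReal.ofReal_lt_top).ne hx
      simpa [abs_of_nonneg (negPartMinEigenvalue_nonneg (S (t, x)))] using this
    have h2 := (negPartMinEigenvalue_le_iff hn (hSs (t, x))
      ((negPartMinEigenvalue_nonneg _).trans h1)).1 h1
    exact h2 (z x)

/-! ### Projection onto solenoidal fields, and restriction in time -/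

instance : CompleteSpace (solSpace n) :=
  (Submodule.isClosed_topologicalClosure _).completeSpace_coe

theorem inner_starProjection_solSpace {h : L2Field n} (hh : h ∈ solSpace n) (u : L2Field n) :
    inner ℝ h ((solSpace n).starProjection u) = inner ℝ h u := by
  rw [← Submodule.inner_starProjection_left_eq_right, Submodule.starProjection_eq_self_iff.2 hh]

theorem ae_Ioc_of_ae_Ioo {T t : ℝ} (ht : t ≤ T) {p : ℝ → Prop}
    (h : ∀ᵐ s ∂(volume.restrict (Ioo 0 T)), p s) : ∀ᵐ s, s ∈ Ioc 0 t → p s := by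
  rw [Measure.restrict_congr_set Ioo_ae_eq_Ioc, ae_restrict_iff' measurableSet_Ioc] at h
  exact h.mono fun s hs h1 => hs ⟨h1.1, h1.2.trans ht⟩

theorem integrableOn_Ioc_of_Ioo {E : Type*} [NormedAddCommGroup E] {T t : ℝ} (ht : t ≤ T)
    {f : ℝ → E} (hf : IntegrableOn f (Ioo 0 T)) : IntegrableOn f (Ioc 0 t) :=
  ((integrableOn_Ioc_iff_integrableOn_Ioo (by simp)).2 hf).mono_set (Ioc_subset_Ioc_right ht)

theorem intervalIntegrable_of_Ioo {E : Type*} [NormedAddCommGroup E] {T t : ℝ}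
    (ht : t ∈ Icc 0 T) {f : ℝ → E} (hf : IntegrableOn f (Ioo 0 T)) :
    IntervalIntegrable f volume 0 t :=
  (intervalIntegrable_iff_integrableOn_Ioc_of_le ht.1).2
    (integrableOn_Ioc_of_Ioo ht.2 hf)

/-! ### The operator of multiplication by the symmetric gradient -/

section Field

variable {T : ℝ} {w e v : ℝ → L2Field n} {D : ℝ × Space n → Matrix (Fin n) (Fin n) ℝ}
  {M : ℝ → Space n → Space n →L[ℝ] Space n} {m : ℝ → ℝ}

theorem SymGradField.memLp (h : SymGradField T w D M m) (t : ℝ) : MemLp (M t) ⊤ volume :=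
  memLp_top_of_bound (h.meas.comp_measurable measurable_prodMk_left).aestronglyMeasurable (m t)
    (Eventually.of_forall (h.bound t))

theorem SymGradField.inner_symm (h : SymGradField T w D M m) (t : ℝ) (u f : L2Field n) :
    inner ℝ u (mulOp (M t) f) = inner ℝ f (mulOp (M t) u) := by
  rw [inner_mulOp (h.memLp t), inner_mulOp (h.memLp t)]
  simp only [h.symm t _ (u _)]

theorem SymGradField.norm_inner_le (h : SymGradField T w D M m) {K K' : ℝ} {u f : L2Field n}
    (hu : ‖u‖ ≤ K) (hf : ‖f‖ ≤ K') (t : ℝ) : ‖inner ℝ u (mulOp (M t) f)‖ ≤ m t * (K * K') := by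
  have h0 := (norm_nonneg u).trans hu
  have h1 := h.nonneg t
  refine (norm_integral_inner_apply_le h1 (h.bound t) u f).trans ?_
  rw [mul_assoc]
  gcongr

/-- The symmetry of `M` moves the operator from the moving vector `u t` to a fixed vector `g`. For a
fixed vector, weak measurability follows from joint measurability of `M` by integration over space.
-/
theorem SymGradField.aestronglyMeasurable (h : SymGradField T w D M m) {u : ℝ → L2Field n}
    {μ : Measure ℝ} (hu : AEStronglyMeasurable u μ) :
    AEStronglyMeasurable (fun t => mulOp (M t) (u t)) μ := by
  have h1 : ∀ f : L2Field n, AEStronglyMeasurable (fun t => mulOp (M t) f) μ := fun f => by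
    refine aestronglyMeasurable_of_inner fun g => ?_
    simp only [real_inner_comm g, inner_mulOp (h.memLp _)]
    have : StronglyMeasurable fun z : ℝ × Space n => (inner ℝ (g z.2) (M z.1 z.2 (f z.2)) : ℝ) :=
      ((Lp.stronglyMeasurable g).comp_measurable measurable_snd).inner
        (isBoundedBilinearMap_apply.continuous.comp_stronglyMeasurable
          (h.meas.prodMk ((Lp.stronglyMeasurable f).comp_measurable measurable_snd)))
    exact this.integral_prod_right.measurable.aemeasurable
  refine aestronglyMeasurable_of_inner fun g => ?_
  simp only [real_inner_comm g, h.inner_symm _ g]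
  exact (hu.inner (h1 g)).aemeasurable

theorem SymGradField.integrableOn_inner (h : SymGradField T w D M m) {u f : ℝ → L2Field n}
    {K K' : ℝ} (hu : AEStronglyMeasurable u (volume.restrict (Ioo 0 T)))
    (hf : AEStronglyMeasurable f (volume.restrict (Ioo 0 T)))
    (hK : ∀ t ∈ Icc 0 T, ‖u t‖ ≤ K) (hK' : ∀ t ∈ Icc 0 T, ‖f t‖ ≤ K') :
    IntegrableOn (fun t => inner ℝ (u t) (mulOp (M t) (f t))) (Ioo 0 T) := by
  refine Integrable.mono' (h.integrable.mul_const (K * K')) (hu.inner (h.aestronglyMeasurable hf)) ?_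
  refine (ae_restrict_iff' measurableSet_Ioo).2 (Eventually.of_forall fun t ht => ?_)
  exact h.norm_inner_le (hK t (Ioo_subset_Icc_self ht)) (hK' t (Ioo_subset_Icc_self ht)) t

theorem integrableOn_inner_of_bound {u : ℝ → L2Field n} {K : ℝ}
    (he : IntegrableOn e (Ioo 0 T)) (hu : AEStronglyMeasurable u (volume.restrict (Ioo 0 T)))
    (hK : ∀ t ∈ Icc 0 T, ‖u t‖ ≤ K) : IntegrableOn (fun t => inner ℝ (e t) (u t)) (Ioo 0 T) := by
  refine Integrable.mono' (he.norm.mul_const K) (he.aestronglyMeasurable.inner hu) ?_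
  refine (ae_restrict_iff' measurableSet_Ioo).2 (Eventually.of_forall fun t ht => ?_)
  exact (norm_inner_le_norm _ _).trans
    (mul_le_mul_of_nonneg_left (hK t (Ioo_subset_Icc_self ht)) (norm_nonneg _))

/-! ### The comparison field -/

/-- The time derivative of the comparison field: the solenoidal part of `-(e + 2 M w)`. -/
def timeDeriv (e w : ℝ → L2Field n) (M : ℝ → Space n → Space n →L[ℝ] Space n) (s : ℝ) : L2Field n :=
  -(solSpace n).starProjection (e s + (2 : ℝ) • mulOp (M s) (w s))

theorem timeDeriv_mem (s : ℝ) : timeDeriv e w M s ∈ solSpace n :=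
  neg_mem (Submodule.starProjection_apply_mem _ _)

theorem inner_timeDeriv {h : L2Field n} (hh : h ∈ solSpace n) (s : ℝ) :
    inner ℝ h (timeDeriv e w M s) = -inner ℝ (e s) h - 2 * inner ℝ h (mulOp (M s) (w s)) := by
  rw [timeDeriv, inner_neg_right, inner_starProjection_solSpace hh, inner_add_right,
    inner_smul_right, real_inner_comm h]
  ring

theorem SymGradField.integrableOn_force (h : SymGradField T w D M m) {K : ℝ}
    (hw : ContinuousOn w (Icc 0 T)) (hK : ∀ t ∈ Icc 0 T, ‖w t‖ ≤ K)
    (he : IntegrableOn e (Ioo 0 T)) :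
    IntegrableOn (fun s => e s + (2 : ℝ) • mulOp (M s) (w s)) (Ioo 0 T) := by
  have hwm : AEStronglyMeasurable w (volume.restrict (Ioo 0 T)) :=
    (hw.mono Ioo_subset_Icc_self).aestronglyMeasurable measurableSet_Ioo
  have : IntegrableOn (fun s => mulOp (M s) (w s)) (Ioo 0 T) := by
    refine Integrable.mono' (h.integrable.mul_const K) (h.aestronglyMeasurable hwm) ?_
    refine (ae_restrict_iff' measurableSet_Ioo).2 (Eventually.of_forall fun t ht => ?_)
    exact (norm_mulOp_le (h.nonneg t) (h.bound t) (w t)).trans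
      (mul_le_mul_of_nonneg_left (hK t (Ioo_subset_Icc_self ht)) (h.nonneg t))
  exact he.fun_add (this.smul (2 : ℝ))

theorem SymGradField.integrableOn_timeDeriv (h : SymGradField T w D M m) {K : ℝ}
    (hw : ContinuousOn w (Icc 0 T)) (hK : ∀ t ∈ Icc 0 T, ‖w t‖ ≤ K)
    (he : IntegrableOn e (Ioo 0 T)) : IntegrableOn (timeDeriv e w M) (Ioo 0 T) :=
  ((solSpace n).starProjection.integrable_comp (h.integrableOn_force hw hK he)).neg

/-- Both sides are solenoidal, so it suffices to pair them with test fields. There the claim is the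
integrated defect equation with the quadratic term rewritten by `IsSymGradAt.inner_mulOp_test`. The
gain is that `w` is differentiable in time as an `L²`-valued curve. -/
theorem SymGradField.eq_add_integral (hn : 0 < n) (hT : 0 < T) (h : SymGradField T w D M m) {K : ℝ}
    (hw : ContinuousOn w (Icc 0 T)) (hK : ∀ t ∈ Icc 0 T, ‖w t‖ ≤ K)
    (hd : DistribDivFree T w) (hdef : IsDefect T w e) (he : IntegrableOn e (Ioo 0 T))
    {t : ℝ} (ht : t ∈ Icc 0 T) : w t = w 0 + ∫ s in 0..t, timeDeriv e w M s := by
  have hgi := intervalIntegrable_of_Ioo ht (h.integrableOn_force hw hK he)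
  set g : ℝ → L2Field n := fun s => e s + (2 : ℝ) • mulOp (M s) (w s) with hg
  have e1 : ∫ s in 0..t, timeDeriv e w M s = -(solSpace n).starProjection (∫ s in 0..t, g s) := by
    rw [← ContinuousLinearMap.intervalIntegral_comp_comm _ hgi, ← intervalIntegral.integral_neg]
    rfl
  rw [e1, ← sub_eq_zero]
  have h0 := left_mem_Icc.2 hT.le
  refine eq_zero_of_weaklyDivFree_of_orthogonal hn ?_ fun u hu => ?_
  · rw [← mem_solSpace_iff hn]
    exact sub_mem ((mem_solSpace_iff hn).2 (hd.weaklyDivFree hT hw ht))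
      (add_mem ((mem_solSpace_iff hn).2 (hd.weaklyDivFree hT hw h0))
        (neg_mem (Submodule.starProjection_apply_mem _ _)))
  · have hu' : u ∈ solSpace n := Submodule.le_topologicalClosure _ hu
    rw [inner_sub_right, inner_add_right, inner_neg_right, inner_starProjection_solSpace hu']
    obtain ⟨ψ, hψ, hψu⟩ := hu
    obtain rfl : u = hψ.memLp.toLp ψ := Lp.ext (hψu.trans hψ.memLp.coeFn_toLp.symm)
    have h1 := hdef.inner_eq hT hw he (fun s hs => hK s (Ioo_subset_Icc_self hs)) hψ ht
    have h2 : ∫ s in 0..t, (inner ℝ (w s) (mulOp (fderiv ℝ ψ) (w s))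
        - inner ℝ (e s) (hψ.memLp.toLp ψ)) = -inner ℝ (hψ.memLp.toLp ψ) (∫ s in 0..t, g s) := by
      rw [← innerSL_apply_apply ℝ, ← ContinuousLinearMap.intervalIntegral_comp_comm _ hgi,
        ← intervalIntegral.integral_neg]
      refine intervalIntegral.integral_congr_ae ?_
      rw [uIoc_of_le ht.1]
      filter_upwards [ae_Ioc_of_ae_Ioo ht.2 h.symGrad] with s hs hst
      have hsT : s ∈ Icc 0 T := ⟨hst.1.le, hst.2.trans ht.2⟩
      rw [(hs hst).inner_mulOp_test (hd.weaklyDivFree hT hw hsT) hψ, innerSL_apply_apply, hg,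
        inner_add_right, inner_smul_right, real_inner_comm (e s)]
      ring
    rw [h2] at h1
    rw [real_inner_comm, h1, real_inner_comm (w 0)]
    ring

/-- The product rule for `w` with itself; the term in `M` drops out because `⟪w, M w⟫ = 0`. -/
theorem SymGradField.norm_sq_eq (hn : 0 < n) (hT : 0 < T) (h : SymGradField T w D M m) {K : ℝ}
    (hw : ContinuousOn w (Icc 0 T)) (hK : ∀ t ∈ Icc 0 T, ‖w t‖ ≤ K)
    (hd : DistribDivFree T w) (hdef : IsDefect T w e) (he : IntegrableOn e (Ioo 0 T))
    {t : ℝ} (ht : t ∈ Icc 0 T) :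
    ‖w t‖ ^ 2 = ‖w 0‖ ^ 2 - 2 * ∫ s in 0..t, inner ℝ (e s) (w s) := by
  have hG : IntegrableOn (timeDeriv e w M) (Ioc 0 t) :=
    integrableOn_Ioc_of_Ioo ht.2 (h.integrableOn_timeDeriv hw hK he)
  have hp := inner_add_integral_add_integral ht.1 (w 0) (w 0) hG hG
  have hweq := fun {s} hs => h.eq_add_integral hn hT hw hK hd hdef he (t := s) hs
  have key : ∫ s in 0..t, inner ℝ (w 0 + ∫ r in 0..s, timeDeriv e w M r) (timeDeriv e w M s)
      = -∫ s in 0..t, inner ℝ (e s) (w s) := by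
    rw [← intervalIntegral.integral_neg]
    refine intervalIntegral.integral_congr_ae ?_
    rw [uIoc_of_le ht.1]
    filter_upwards [ae_Ioc_of_ae_Ioo ht.2 h.symGrad] with s hs hst
    have hsT : s ∈ Icc 0 T := ⟨hst.1.le, hst.2.trans ht.2⟩
    have hdiv := hd.weaklyDivFree hT hw hsT
    rw [← hweq hsT, inner_timeDeriv ((mem_solSpace_iff hn).2 hdiv), (hs hst).inner_self hdiv]
    ring
  have key' : ∫ s in 0..t, inner ℝ (timeDeriv e w M s) (w 0 + ∫ r in 0..s, timeDeriv e w M r)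
      = -∫ s in 0..t, inner ℝ (e s) (w s) := by
    rw [← key]
    simp only [real_inner_comm (timeDeriv e w M _)]
  rw [← hweq ht, key, key', real_inner_self_eq_norm_sq, real_inner_self_eq_norm_sq] at hp
  linarith

end Field

/-! ### The mollified weak formulation -/

section Weak

variable {T : ℝ} {w e v : ℝ → L2Field n} {D : ℝ × Space n → Matrix (Fin n) (Fin n) ℝ}
  {M : ℝ → Space n → Space n →L[ℝ] Space n} {m : ℝ → ℝ} {v₀ : L2Field n}

/-- The quadratic flux `h ↦ ⟨u ⊗ u, ∇(η_k * h)⟩`, as an element of `L²`. -/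
def flux (k : ℕ) (u : L2Field n) : L2Field n :=
  (InnerProductSpace.toDual ℝ (L2Field n)).symm
    ((innerSL ℝ u).comp
      ((((ContinuousLinearMap.id ℝ (Space n →L[ℝ] Space n)).holderL volume ⊤ 2 2).flip u).comp
        (gradConv (mol n k) (mol_contDiff k) (mol_hasCompactSupport k))))

theorem inner_flux (k : ℕ) (u h : L2Field n) :
    inner ℝ (flux k u) h = inner ℝ u (mulOp (fderiv ℝ (conv (mol n k) h)) u) := by
  rw [flux, InnerProductSpace.toDual_symm_apply,
    mulOp_eq (memLp_top_fderiv_conv (mol_contDiff k) (mol_hasCompactSupport k) h)]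
  rfl

theorem exists_norm_flux_le (k : ℕ) : ∃ C : ℝ, 0 ≤ C ∧ ∀ u : L2Field n, ‖flux k u‖ ≤ C * ‖u‖ ^ 2 := by
  set H := (ContinuousLinearMap.id ℝ (Space n →L[ℝ] Space n)).holderL
    (volume : Measure (Space n)) ⊤ 2 2
  set G := gradConv (mol n k) (mol_contDiff k) (mol_hasCompactSupport k)
  refine ⟨‖H‖ * ‖G‖, by positivity, fun u => ?_⟩
  rw [flux, LinearIsometryEquiv.norm_map]
  refine ContinuousLinearMap.opNorm_le_bound _ (by positivity) fun h => ?_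
  calc ‖inner ℝ u (H (G h) u)‖ ≤ ‖u‖ * ‖H (G h) u‖ := norm_inner_le_norm _ _
    _ ≤ ‖u‖ * (‖H‖ * (‖G‖ * ‖h‖) * ‖u‖) := by
      gcongr
      exact (H.le_opNorm₂ _ _).trans (by gcongr; exact G.le_opNorm h)
    _ = _ := by ring

theorem integrableOn_flux {K : ℝ} (hv : AEStronglyMeasurable v (volume.restrict (Ioo 0 T)))
    (hK : ∀ t ∈ Icc 0 T, ‖v t‖ ≤ K) (k : ℕ) : IntegrableOn (fun s => flux k (v s)) (Ioo 0 T) := by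
  obtain ⟨C, hC0, hC⟩ := exists_norm_flux_le (n := n) k
  refine Integrable.mono' (g := fun _ => C * K ^ 2) (integrable_const _) ?_ ?_
  · refine aestronglyMeasurable_of_inner fun h => ?_
    simp only [inner_flux]
    exact (hv.inner ((mulOp _).continuous.comp_aestronglyMeasurable hv)).aemeasurable
  · refine (ae_restrict_iff' measurableSet_Ioo).2 (Eventually.of_forall fun t ht => ?_)
    refine (hC _).trans ?_
    gcongr
    exact hK t (Ioo_subset_Icc_self ht)

theorem conv_congr {E : Type*} [NormedAddCommGroup E] [NormedSpace ℝ E] (η : Space n → ℝ)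
    {f g : Space n → E} (h : f =ᵐ[volume] g) : conv η f = conv η g := by
  ext x
  rw [conv_apply, conv_apply]
  refine integral_congr_ae ?_
  filter_upwards [h] with y hy
  rw [hy]

theorem solTest_conv {h : L2Field n} (hh : h ∈ solTestSpace n) (k : ℕ) :
    SolTest (conv (mol n k) h) := by
  have hd := weaklyDivFree_of_mem_solTestSpace hh
  obtain ⟨ψ, hψ, hhψ⟩ := hh
  refine ⟨conv_contDiff (mol_contDiff k) (mol_hasCompactSupport k) (locallyIntegrable_L2 h), ?_,
    divergence_conv (mol_contDiff k) (mol_hasCompactSupport k) hd⟩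
  rw [conv_congr _ hhψ]
  exact (mol_hasCompactSupport k).convolution _ hψ.compact

/-- For a test field `h` the mollification is an admissible test field, and general solenoidal `h`
follow by density, both sides being continuous in `h`. The right side pairs `h` with an absolutely
continuous `L²`-valued curve that does not depend on `h`, so `h` may afterwards vary in time. -/
theorem IsWeakSolution.inner_mollify_eq (hT : 0 < T) (hv : IsWeakSolution T v₀ v)
    (hvc : WeaklyContinuous T v) {K : ℝ} (hK : ∀ t ∈ Icc 0 T, ‖v t‖ ≤ K) {t : ℝ} (ht : t ∈ Icc 0 T)
    (k : ℕ) {h : L2Field n} (hh : h ∈ solSpace n) :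
    inner ℝ (v t) (mollify k h) = inner ℝ ((mollify k).adjoint (v 0) + ∫ s in 0..t, flux k (v s)) h := by
  have hvm := hvc.aestronglyMeasurable.mono_measure
    (Measure.restrict_mono (Ioo_subset_Icc_self (a := (0 : ℝ)) (b := T)) le_rfl)
  have hfi := intervalIntegrable_of_Ioo ht (integrableOn_flux hvm hK k)
  refine closure_minimal (s := (solTestSpace n : Set (L2Field n)))
    (t := {h | inner ℝ (v t) (mollify k h)
      = inner ℝ ((mollify k).adjoint (v 0) + ∫ s in 0..t, flux k (v s)) h}) (fun h hh => ?_)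
    (isClosed_eq (continuous_const.inner (mollify k).continuous)
      (continuous_const.inner continuous_id)) hh
  have hψ := solTest_conv hh k
  have hm : mollify k h = hψ.memLp.toLp _ :=
    Lp.ext ((mollify_ae k h).trans hψ.memLp.coeFn_toLp.symm)
  rw [mem_ofPred_eq, inner_add_left, ContinuousLinearMap.adjoint_inner_left, hm,
    hv.inner_eq hT hvc (fun s hs => hK s (Ioo_subset_Icc_self hs)) hψ ht,
    real_inner_comm h (∫ s in 0..t, flux k (v s)), ← innerSL_apply_apply ℝ h,
    ← ContinuousLinearMap.intervalIntegral_comp_comm _ hfi]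
  simp only [innerSL_apply_apply, real_inner_comm (flux k (v _)), inner_flux]

-- The product rule for `w` and the curve `(mollify k)† v(0) + ∫ flux`. That curve represents
-- `(mollify k)† v(s)` only against solenoidal fields, which suffices because `w` and `timeDeriv`
-- are solenoidal.
set_option maxHeartbeats 400000 in
theorem SymGradField.inner_mollify_eq (hn : 0 < n) (hT : 0 < T) (h : SymGradField T w D M m)
    {K K' : ℝ} (hw : ContinuousOn w (Icc 0 T)) (hK' : ∀ t ∈ Icc 0 T, ‖w t‖ ≤ K')
    (hd : DistribDivFree T w) (hdef : IsDefect T w e) (he : IntegrableOn e (Ioo 0 T))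
    (hv : IsWeakSolution T v₀ v) (hvc : WeaklyContinuous T v) (hK : ∀ t ∈ Icc 0 T, ‖v t‖ ≤ K)
    {t : ℝ} (ht : t ∈ Icc 0 T) (k : ℕ) :
    inner ℝ (v t) (mollify k (w t)) = inner ℝ (v 0) (mollify k (w 0))
      + ((∫ s in 0..t, inner ℝ (flux k (v s)) (w s))
        + ∫ s in 0..t, inner ℝ (v s) (mollify k (timeDeriv e w M s))) := by
  have hsub : ∀ {s}, s ∈ uIoc 0 t → s ∈ Icc 0 T := fun hs => by
    rw [uIoc_of_le ht.1] at hs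
    exact ⟨hs.1.le, hs.2.trans ht.2⟩
  have hvm := hvc.aestronglyMeasurable.mono_measure
    (Measure.restrict_mono (Ioo_subset_Icc_self (a := (0 : ℝ)) (b := T)) le_rfl)
  have hG := integrableOn_Ioc_of_Ioo ht.2 (h.integrableOn_timeDeriv hw hK' he)
  have hweq : ∀ s ∈ Icc 0 T, w s = w 0 + ∫ r in 0..s, timeDeriv e w M r := fun s hs =>
    h.eq_add_integral hn hT hw hK' hd hdef he hs
  have hp := inner_add_integral_add_integral ht.1 ((mollify k).adjoint (v 0)) (w 0)
    (integrableOn_Ioc_of_Ioo ht.2 (integrableOn_flux hvm hK k)) hG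
  have e1 : ∫ s in 0..t, inner ℝ (flux k (v s)) (w 0 + ∫ r in 0..s, timeDeriv e w M r)
      = ∫ s in 0..t, inner ℝ (flux k (v s)) (w s) :=
    intervalIntegral.integral_congr_ae (Eventually.of_forall fun s hs =>
      congrArg (inner ℝ (flux k (v s))) (hweq s (hsub hs)).symm)
  have e2 : ∫ s in 0..t, inner ℝ ((mollify k).adjoint (v 0) + ∫ r in 0..s, flux k (v r))
      (timeDeriv e w M s) = ∫ s in 0..t, inner ℝ (v s) (mollify k (timeDeriv e w M s)) :=
    intervalIntegral.integral_congr_ae (Eventually.of_forall fun s hs =>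
      (hv.inner_mollify_eq hT hvc hK (hsub hs) k (timeDeriv_mem s)).symm)
  rw [e1, e2, ContinuousLinearMap.adjoint_inner_left (mollify k) (w 0) (v 0)] at hp
  exact (hv.inner_mollify_eq hT hvc hK ht k
    ((mem_solSpace_iff hn).2 (hd.weaklyDivFree hT hw ht))).trans
    ((congrArg (inner ℝ _) (hweq t ht)).trans hp)

/-- The limit of the mollified identity. The flux involves only `η_k ⋆ M`, so it is dominated by `m
K²`, and no bound on the full gradient of `w` is needed. The other integral is dominated since
mollification contracts `L²`. -/
theorem SymGradField.inner_eq (hn : 0 < n) (hT : 0 < T) (h : SymGradField T w D M m) {K K' : ℝ}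
    (hw : ContinuousOn w (Icc 0 T)) (hK' : ∀ t ∈ Icc 0 T, ‖w t‖ ≤ K')
    (hd : DistribDivFree T w) (hdef : IsDefect T w e) (he : IntegrableOn e (Ioo 0 T))
    (hv : IsWeakSolution T v₀ v) (hvc : WeaklyContinuous T v) (hK : ∀ t ∈ Icc 0 T, ‖v t‖ ≤ K)
    {t : ℝ} (ht : t ∈ Icc 0 T) :
    inner ℝ (v t) (w t) = inner ℝ (v 0) (w 0) + ((∫ s in 0..t, inner ℝ (v s) (mulOp (M s) (v s)))
      + ∫ s in 0..t, (-inner ℝ (e s) (v s) - 2 * inner ℝ (v s) (mulOp (M s) (w s)))) := by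
  have hsub : ∀ {s}, s ∈ Ioc 0 t → s ∈ Icc 0 T := fun hs => ⟨hs.1.le, hs.2.trans ht.2⟩
  have hvm := hvc.aestronglyMeasurable.mono_measure
    (Measure.restrict_mono (Ioo_subset_Icc_self (a := (0 : ℝ)) (b := T)) le_rfl)
  have hwm : AEStronglyMeasurable w (volume.restrict (Ioo 0 T)) :=
    (hw.mono Ioo_subset_Icc_self).aestronglyMeasurable measurableSet_Ioo
  have hle : volume.restrict (uIoc 0 t) ≤ volume.restrict (Ioo 0 T) := by
    rw [uIoc_of_le ht.1, Measure.restrict_congr_set Ioo_ae_eq_Ioc]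
    exact Measure.restrict_mono (Ioc_subset_Ioc_right ht.2) le_rfl
  have hGi := h.integrableOn_timeDeriv hw hK' he
  have hvs : ∀ {s}, s ∈ Icc 0 T → v s ∈ solSpace n := fun hs =>
    (mem_solSpace_iff hn).2 (hv.weaklyDivFree hT hvc hs)
  have l1 : Tendsto (fun k => ∫ s in 0..t, inner ℝ (flux k (v s)) (w s)) atTop
      (𝓝 (∫ s in 0..t, inner ℝ (v s) (mulOp (M s) (v s)))) := by
    have hsg := ae_Ioc_of_ae_Ioo ht.2 h.symGrad
    refine intervalIntegral.tendsto_integral_filter_of_dominated_convergence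
      (fun s => m s * (K * K)) (Eventually.of_forall fun k => ?_) (Eventually.of_forall fun k => ?_)
      ((intervalIntegrable_of_Ioo ht h.integrable).mul_const _) ?_
    · exact ((integrableOn_flux hvm hK k).aestronglyMeasurable.inner hwm).mono_measure hle
    · rw [uIoc_of_le ht.1]
      filter_upwards [hsg] with s hs hst
      rw [inner_flux, (hs hst).inner_mulOp_fderiv]
      refine (norm_integral_inner_apply_le (h.nonneg s) ((hs hst).conv_bound k) _ _).trans ?_
      have h1 := hK s (hsub hst)
      have h2 := h.nonneg s
      have h3 := (norm_nonneg _).trans h1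
      rw [mul_assoc]
      gcongr
    · rw [uIoc_of_le ht.1]
      filter_upwards [hsg] with s hs hst
      simp only [inner_flux, (hs hst).inner_mulOp_fderiv]
      exact (hs hst).tendsto_inner _ _
  have l2 : Tendsto (fun k => ∫ s in 0..t, inner ℝ (v s) (mollify k (timeDeriv e w M s))) atTop
      (𝓝 (∫ s in 0..t, inner ℝ (v s) (timeDeriv e w M s))) := by
    refine intervalIntegral.tendsto_integral_filter_of_dominated_convergence
      (fun s => K * ‖timeDeriv e w M s‖) (Eventually.of_forall fun k => ?_)
      (Eventually.of_forall fun k => Eventually.of_forall fun s hs => ?_)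
      ((intervalIntegrable_of_Ioo ht hGi).norm.const_mul _)
      (Eventually.of_forall fun s _ => tendsto_const_nhds.inner (mollify_tendsto _))
    · exact (hvm.inner ((mollify k).continuous.comp_aestronglyMeasurable
        hGi.aestronglyMeasurable)).mono_measure hle
    · rw [uIoc_of_le ht.1] at hs
      have h1 := hK s (hsub hs)
      have h3 := (norm_nonneg _).trans h1
      refine (norm_inner_le_norm _ _).trans ?_
      gcongr
      exact norm_mollify_le _ _
  have e2 : ∫ s in 0..t, inner ℝ (v s) (timeDeriv e w M s)
      = ∫ s in 0..t, (-inner ℝ (e s) (v s) - 2 * inner ℝ (v s) (mulOp (M s) (w s))) := by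
    refine intervalIntegral.integral_congr_ae (Eventually.of_forall fun s hs => ?_)
    rw [uIoc_of_le ht.1] at hs
    rw [inner_timeDeriv (hvs (hsub hs))]
  rw [← e2]
  refine tendsto_nhds_unique (tendsto_const_nhds.inner (mollify_tendsto (w t))) ?_
  simp only [h.inner_mollify_eq hn hT hw hK' hd hdef he hv hvc hK ht]
  exact (tendsto_const_nhds.inner (mollify_tendsto (w 0))).add (l1.add l2)

theorem integrableOn_dMinusNorm_mul {K K' : ℝ} (hdi : IntegrableOn (dMinusNorm D) (Ioo 0 T))
    (hv : AEStronglyMeasurable v (volume.restrict (Ioo 0 T)))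
    (hw : AEStronglyMeasurable w (volume.restrict (Ioo 0 T)))
    (hK : ∀ t ∈ Icc 0 T, ‖v t‖ ≤ K) (hK' : ∀ t ∈ Icc 0 T, ‖w t‖ ≤ K') :
    IntegrableOn (fun s => 2 * dMinusNorm D s * ‖v s - w s‖ ^ 2) (Ioo 0 T) := by
  refine (hdi.const_mul 2).mul_bdd (c := (K + K') ^ 2) ((hv.sub hw).norm.pow 2) ?_
  refine (ae_restrict_iff' measurableSet_Ioo).2 (Eventually.of_forall fun s hs => ?_)
  have hs' := Ioo_subset_Icc_self hs
  rw [norm_pow, norm_norm]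
  gcongr
  exact (norm_sub_le _ _).trans (add_le_add (hK s hs') (hK' s hs'))

/-- The relative energy inequality, before Gronwall's inequality. -/
theorem SymGradField.norm_sub_sq_le (hn : 0 < n) (hT : 0 < T) (h : SymGradField T w D M m)
    {K K' : ℝ} (hw : ContinuousOn w (Icc 0 T)) (hK' : ∀ t ∈ Icc 0 T, ‖w t‖ ≤ K')
    (hd : DistribDivFree T w) (hdef : IsDefect T w e) (he : IntegrableOn e (Ioo 0 T))
    (hv : IsWeakSolution T v₀ v) (hvc : WeaklyContinuous T v) (hK : ∀ t ∈ Icc 0 T, ‖v t‖ ≤ K)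
    (hdi : IntegrableOn (dMinusNorm D) (Ioo 0 T)) {t : ℝ} (hE : ‖v t‖ ≤ ‖v 0‖) (ht : t ∈ Icc 0 T) :
    ‖v t - w t‖ ^ 2 ≤ ‖v 0 - w 0‖ ^ 2 + ∫ s in 0..t, (2 * inner ℝ (e s) (v s - w s)
      + 2 * dMinusNorm D s * ‖v s - w s‖ ^ 2) := by
  have hsub : ∀ {s}, s ∈ Ioc 0 t → s ∈ Icc 0 T := fun hs => ⟨hs.1.le, hs.2.trans ht.2⟩
  have hvm := hvc.aestronglyMeasurable.mono_measure
    (Measure.restrict_mono (Ioo_subset_Icc_self (a := (0 : ℝ)) (b := T)) le_rfl)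
  have hwm : AEStronglyMeasurable w (volume.restrict (Ioo 0 T)) :=
    (hw.mono Ioo_subset_Icc_self).aestronglyMeasurable measurableSet_Ioo
  have i1 := intervalIntegrable_of_Ioo ht (h.integrableOn_inner hvm hvm hK hK)
  have i2 := intervalIntegrable_of_Ioo ht (h.integrableOn_inner hvm hwm hK hK')
  have i3 := intervalIntegrable_of_Ioo ht (integrableOn_inner_of_bound he hvm hK)
  have i4 := intervalIntegrable_of_Ioo ht (integrableOn_inner_of_bound he hwm hK')
  have i5 : IntervalIntegrable (fun s => 2 * inner ℝ (e s) (v s - w s)) volume 0 t := by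
    simp only [inner_sub_right]
    exact (i3.sub i4).const_mul 2
  have i6 : IntervalIntegrable (fun s => 2 * dMinusNorm D s * ‖v s - w s‖ ^ 2) volume 0 t :=
    intervalIntegrable_of_Ioo ht (integrableOn_dMinusNorm_mul hdi hvm hwm hK hK')
  have hmono : ∫ s in 0..t, (2 * inner ℝ (e s) (v s - w s) - 2 * (inner ℝ (v s) (mulOp (M s) (v s))
      - 2 * inner ℝ (v s) (mulOp (M s) (w s))))
      ≤ ∫ s in 0..t, (2 * inner ℝ (e s) (v s - w s) + 2 * dMinusNorm D s * ‖v s - w s‖ ^ 2) := by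
    rw [intervalIntegral.integral_of_le ht.1, intervalIntegral.integral_of_le ht.1]
    refine integral_mono_ae ((intervalIntegrable_iff_integrableOn_Ioc_of_le ht.1).1
      (i5.sub ((i1.sub (i2.const_mul 2)).const_mul 2)))
      ((intervalIntegrable_iff_integrableOn_Ioc_of_le ht.1).1 (i5.add i6)) ?_
    refine (ae_restrict_iff' measurableSet_Ioc).2 ?_
    -- Expanding `⟪v - w, M (v - w)⟫` gives the integrand on the left, because `⟪w, M w⟫ = 0` and
    -- the two cross terms agree by symmetry.
    filter_upwards [ae_Ioc_of_ae_Ioo ht.2 h.symGrad, ae_Ioc_of_ae_Ioo ht.2 h.lower] with s h1 h2 hst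
    have h3 := h2 hst (v s - w s)
    rw [map_sub, inner_sub_left, inner_sub_right, inner_sub_right,
      (h1 hst).inner_self (hd.weaklyDivFree hT hw (hsub hst)), h.inner_symm s (w s) (v s)] at h3
    linarith
  have e1 : ∫ s in 0..t, (2 * inner ℝ (e s) (v s - w s) - 2 * (inner ℝ (v s) (mulOp (M s) (v s))
      - 2 * inner ℝ (v s) (mulOp (M s) (w s)))) = 2 * (∫ s in 0..t, inner ℝ (e s) (v s))
      - 2 * (∫ s in 0..t, inner ℝ (e s) (w s)) - 2 * (∫ s in 0..t, inner ℝ (v s) (mulOp (M s) (v s)))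
      + 4 * ∫ s in 0..t, inner ℝ (v s) (mulOp (M s) (w s)) := by
    rw [intervalIntegral.integral_sub i5 ((i1.sub (i2.const_mul 2)).const_mul 2),
      intervalIntegral.integral_const_mul, intervalIntegral.integral_const_mul,
      intervalIntegral.integral_sub i1 (i2.const_mul 2), intervalIntegral.integral_const_mul]
    simp only [inner_sub_right]
    rw [intervalIntegral.integral_sub i3 i4]
    ring
  have e2 := h.inner_eq hn hT hw hK' hd hdef he hv hvc hK ht
  have i7 : IntervalIntegrable (fun s => -inner ℝ (e s) (v s)) volume 0 t := i3.neg
  rw [intervalIntegral.integral_sub i7 (i2.const_mul 2), intervalIntegral.integral_neg,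
    intervalIntegral.integral_const_mul] at e2
  have e3 := h.norm_sq_eq hn hT hw hK' hd hdef he ht
  have hE2 : ‖v t‖ ^ 2 ≤ ‖v 0‖ ^ 2 := by gcongr
  rw [norm_sub_sq_real, norm_sub_sq_real]
  linarith

end Weak

end Euler

end

open Euler in
/-- A weak solution in `C([0,T]; L²_w)` of the incompressible Euler equations which satisfies the
weak energy inequality is a dissipative solution in the sense of Lions. -/
theorem mainTheorem9 (n : ℕ) (hn : 2 ≤ n) (T : ℝ) (hT : 0 < T)
    (v₀ : Euler.L2Field n) (hv₀ : Euler.WeaklyDivFree v₀)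
    (v : ℝ → Euler.L2Field n) (hvc : Euler.WeaklyContinuous T v)
    (hv : Euler.IsWeakSolution T v₀ v) (hE : Euler.WeakEnergyInequality T v₀ v) :
    Euler.IsDissipativeSolution T v₀ v := by
  have hn' : 0 < n := by lia
  have hK' : ∀ t ∈ Ioc 0 T, ‖v t‖ ≤ ‖v₀‖ := fun t ht => by
    have := hE t ht
    rw [integral_norm_sq, integral_norm_sq] at this
    exact (pow_le_pow_iff_left₀ (norm_nonneg _) (norm_nonneg _) two_ne_zero).1 this
  -- The energy inequality is assumed only for `t > 0`; identifying `v 0` extends the bound to `t =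
  -- 0`.
  have h0 : v 0 = v₀ := hv.initial hn' hT hv₀ hvc fun t ht => hK' t (Ioo_subset_Ioc_self ht)
  have hK : ∀ t ∈ Icc 0 T, ‖v t‖ ≤ ‖v₀‖ := fun t ht => by
    rcases ht.1.eq_or_lt with rfl | h
    · rw [h0]
    · exact hK' t ⟨h, ht.2⟩
  refine ⟨memLp_top_of_bound hvc.aestronglyMeasurable ‖v₀‖
    ((ae_restrict_iff' measurableSet_Icc).2 (Filter.Eventually.of_forall hK)), hvc, h0,
    hv.distribDivFree, fun w e D hw hD hDm hdef he hd t ht => ?_⟩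
  obtain ⟨M, m, h⟩ := exists_symGradField hn' hw hD hDm
  obtain ⟨K, hKw⟩ := isCompact_Icc.exists_bound_of_continuousOn hw
  have hvm := hvc.aestronglyMeasurable.mono_measure
    (Measure.restrict_mono (Ioo_subset_Icc_self (a := (0 : ℝ)) (b := T)) le_rfl)
  have hwm : AEStronglyMeasurable w (volume.restrict (Ioo 0 T)) :=
    (hw.mono Ioo_subset_Icc_self).aestronglyMeasurable measurableSet_Ioo
  have hd0 : ∀ s, 0 ≤ dMinusNorm D s := fun s => ENNReal.toReal_nonneg
  have hdi : IntegrableOn (dMinusNorm D) (Ioo 0 T) := by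
    refine Integrable.mono' h.integrable h.dMinus_meas ?_
    filter_upwards [h.dMinus_le] with s hs
    rwa [Real.norm_of_nonneg (hd0 s)]
  have hei : IntegrableOn (fun s => 2 * inner ℝ (e s) (v s - w s)) (Ioo 0 T) := by
    simp only [inner_sub_right]
    exact ((integrableOn_inner_of_bound he hvm hK).sub
      (integrableOn_inner_of_bound he hwm hKw)).const_mul 2
  have hgr := gronwall_integral (T := T) (f := fun s => ‖v s - w s‖ ^ 2)
    (fun s => mul_nonneg zero_le_two (hd0 s)) (integrableOn_Ioc_of_Ioo le_rfl (hdi.const_mul 2))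
    (integrableOn_Ioc_of_Ioo le_rfl hei) (integrableOn_Ioc_of_Ioo le_rfl
      (integrableOn_dMinusNorm_mul hdi hvm hwm hK hKw))
    (fun s hs => h.norm_sub_sq_le hn' hT hw hKw hd hdef he hv hvc hK hdi
      (by rw [h0]; exact hK s hs) hs) ht
  have hsub : ∀ s, ∫ x, ‖v s x - w s x‖ ^ 2 = ‖v s - w s‖ ^ 2 := fun s => by
    rw [← integral_norm_sq]
    refine integral_congr_ae ?_
    filter_upwards [Lp.coeFn_sub (v s) (w s)] with x hx
    rw [hx, Pi.sub_apply]
  have hin : ∀ s (c : ℝ), ∫ x, c * inner ℝ (e s x) (v s x - w s x)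
      = c * inner ℝ (e s) (v s - w s) := fun s c => by
    rw [integral_const_mul, L2.inner_def]
    congr 1
    refine integral_congr_ae ?_
    filter_upwards [Lp.coeFn_sub (v s) (w s)] with x hx
    rw [hx, Pi.sub_apply]
  simp only [hin]
  rw [← h0, hsub, hsub, ← intervalIntegral.integral_const_mul]
  refine hgr.trans_eq ?_
  congr 1
  refine intervalIntegral.integral_congr fun s _ => ?_
  ring
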